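/- Let $M$ be a smooth manifold of dimension $2n+1$ with a paracontact metric structure $(\varphi,\xi,\eta,g)$. That is, $\varphi$ is a smooth $(1,1)$-tensor field, $\xi$ a smooth vector field, $\eta$ a smooth 1-form and $g$ a smooth pseudo-Riemannian metric such that $\varphi\xi=0$, $\eta\circ\varphi=0$, $\eta(\xi)=1$, $\varphi^2=\mathrm{id}-\eta\otimes\xi$, the restriction of $\varphi$ to each fibre of $\mathbb D=\ker\eta$ has eigenspaces of dimension $n$ for each of the eigenvalues $1$ and $-1$, $g(\varphi X,\varphi Y)=-g(X,Y)+\eta(X)\eta(Y)$, and $g(X,\varphi Y)=d\eta(X,Y)$, where $d\eta(X,Y)=\frac12\big(X\eta(Y)-Y\eta(X)-\eta([X,Y])\big)$. Let $\nabla$ be the Levi-Civita connection of $g$. The canonical paracontact connection is $$D_XY=\nabla_XY+\eta(X)\varphi Y-\eta(Y)\nabla_X\xi+(\nabla_X\eta)(Y)\,\xi .$$ Its Ricci tensor is $\mathrm{Ric}^D(Y,Z)=\mathrm{tr}\big(X\mapsto R^D(X,Y)Z\big)$ with $R^D(X,Y)=[D_X,D_Y]-D_{[X,Y]}$, and its scalar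 curvature is $W_1=g^{jk}\,\mathrm{Ric}^D_{jk}$. For a smooth function $f$ on $M$ put, in local coordinates, $f_i=\partial_i f$, $f^i=g^{ij}f_j$ and $$\Delta_{\mathbb D}f=(g^{ij}-\xi^i\xi^j)\nabla_i\nabla_jf,\qquad |df|^2_{\mathbb D}=(g^{ij}-\xi^i\xi^j)f_if_j .$$ Let $\sigma$ be a nowhere vanishing smooth function on $M$. Then there is a paracontact metric structure $(\widetilde\varphi,\widetilde\xi,\widetilde\eta,\widetilde g)$ on $M$ with $\widetilde\eta=\sigma\eta$ and $\widetilde\varphi=\varphi$ on $\mathbb D$. For every such structure, in every local coordinate system, $$\widetilde\xi^k=\frac1\sigma(\xi^k+\zeta^k),\qquad \zeta^k=-\frac1{2\sigma}\varphi^k_j\sigma^j,\qquad \widetilde\varphi^i_j=\varphi^i_j+\frac1{2\sigma}\big(\sigma^i-(\xi\sigma)\,\xi^i\big)\eta_j,$$ $$\widetilde g_{ij}=\sigma(g_{ij}-\eta_i\zeta_j-\eta_j\zeta_i)+\sigma(\sigma-1+|\zeta|^2)\eta_i\eta_j,$$ where $\zeta_i=g_{ij}\zeta^j$ and $|\zeta|^2=\zeta_i\zeta^i$.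 The scalar curvature $\widetilde W_1$ of the canonical paracontact connection of $(\widetilde\varphi,\widetilde\xi,\widetilde\eta,\widetilde g)$ satisfies $$\sigma\widetilde W_1=W_1-\frac{2(n+1)}{\sigma}\Delta_{\mathbb D}\sigma-\frac{(n+1)(n-2)}{\sigma^2}|d\sigma|^2_{\mathbb D}.$$ -/

import Mathlib

open scoped Manifold ContDiff

noncomputable section

namespace Paracontact

/-! ### Tensor calculus in local coordinates

A point of a coordinate domain is `u : EuclideanSpace ℝ (Fin N)`; tensors are given by their
components. -/

section Coordinates

variable {N : ℕ}

/-- The partial derivative `∂_i f`. -/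
def pd (i : Fin N) (f : EuclideanSpace ℝ (Fin N) → ℝ) (u : EuclideanSpace ℝ (Fin N)) : ℝ :=
  fderiv ℝ f u (EuclideanSpace.single i 1)

/-- The Christoffel symbols `Γ^k_{ij} = ½ g^{kl} (∂_i g_{lj} + ∂_j g_{il} - ∂_l g_{ij})` of the
Levi-Civita connection of the pseudo-Riemannian metric with components `g_{ij}`. -/
def christoffel (g : EuclideanSpace ℝ (Fin N) → Matrix (Fin N) (Fin N) ℝ)
    (k i j : Fin N) (u : EuclideanSpace ℝ (Fin N)) : ℝ :=
  (1 / 2) * ∑ l, (g u)⁻¹ k l *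
    (pd i (fun w => g w l j) u + pd j (fun w => g w i l) u - pd l (fun w => g w i j) u)

/-- `∇_i X^k` for the Levi-Civita connection of `g`. -/
def covVector (g : EuclideanSpace ℝ (Fin N) → Matrix (Fin N) (Fin N) ℝ)
    (X : Fin N → EuclideanSpace ℝ (Fin N) → ℝ) (i k : Fin N)
    (u : EuclideanSpace ℝ (Fin N)) : ℝ :=
  pd i (X k) u + ∑ s, christoffel g k i s u * X s u

/-- `∇_i α_j` for the Levi-Civita connection of `g`. -/
def covForm (g : EuclideanSpace ℝ (Fin N) → Matrix (Fin N) (Fin N) ℝ)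
    (α : Fin N → EuclideanSpace ℝ (Fin N) → ℝ) (i j : Fin N)
    (u : EuclideanSpace ℝ (Fin N)) : ℝ :=
  pd i (α j) u - ∑ s, christoffel g s i j u * α s u

/-- The component `R_{ijk}^l` of the curvature `R(∂_i, ∂_j) ∂_k = R_{ijk}^l ∂_l`,
`R(X, Y) = [D_X, D_Y] - D_{[X, Y]}`, of the linear connection `D` with coefficients
`D_{∂_i} ∂_j = Γ^k_{ij} ∂_k`, where `Γ^k_{ij}` is written `Γ k i j`. -/
def curvature (Γ : Fin N → Fin N → Fin N → EuclideanSpace ℝ (Fin N) → ℝ)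
    (i j k l : Fin N) (u : EuclideanSpace ℝ (Fin N)) : ℝ :=
  pd i (Γ l j k) u - pd j (Γ l i k) u
    + ∑ s, (Γ l i s u * Γ s j k u - Γ l j s u * Γ s i k u)

/-- The Ricci tensor `Ric_{jk} = R_{ijk}^i` of a linear connection. -/
def ricci (Γ : Fin N → Fin N → Fin N → EuclideanSpace ℝ (Fin N) → ℝ)
    (j k : Fin N) (u : EuclideanSpace ℝ (Fin N)) : ℝ :=
  ∑ i, curvature Γ i j k i u

end Coordinates

/-! ### Paracontact structures -/

/-- The exterior derivative of a 1-form on vector fields, with the factor one half: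
`dη(X, Y) = ½ (X η(Y) - Y η(X) - η([X, Y]))`. -/
def dForm {N : ℕ} {M : Type*} [TopologicalSpace M] [ChartedSpace (EuclideanSpace ℝ (Fin N)) M]
    (η : ∀ x : M, TangentSpace (𝓡 N) x →L[ℝ] ℝ) (X Y : ∀ x : M, TangentSpace (𝓡 N) x)
    (x : M) : ℝ :=
  (1 / 2) * (mvfderiv (𝓡 N) (fun y => η y (Y y)) x (X x)
    - mvfderiv (𝓡 N) (fun y => η y (X y)) x (Y x)
    - η x (VectorField.mlieBracket (𝓡 N) X Y x))

/-- An almost paracontact structure `(φ, ξ, η)` on a smooth manifold of dimension `2n+1`. -/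
structure AlmostParacontact (n : ℕ) (M : Type*) [TopologicalSpace M]
    [ChartedSpace (EuclideanSpace ℝ (Fin (2 * n + 1))) M]
    [IsManifold (𝓡 (2 * n + 1)) ∞ M] where
  φ : ∀ x : M, TangentSpace (𝓡 (2 * n + 1)) x →L[ℝ] TangentSpace (𝓡 (2 * n + 1)) x
  ξ : ∀ x : M, TangentSpace (𝓡 (2 * n + 1)) x
  η : ∀ x : M, TangentSpace (𝓡 (2 * n + 1)) x →L[ℝ] ℝ
  smooth_φ : ContMDiff (𝓡 (2 * n + 1))
    ((𝓡 (2 * n + 1)).prod 𝓘(ℝ, EuclideanSpace ℝ (Fin (2 * n + 1)) →L[ℝ]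
      EuclideanSpace ℝ (Fin (2 * n + 1)))) ∞
    (fun x => Bundle.TotalSpace.mk' (EuclideanSpace ℝ (Fin (2 * n + 1)) →L[ℝ]
      EuclideanSpace ℝ (Fin (2 * n + 1))) x (φ x))
  smooth_ξ : ContMDiff (𝓡 (2 * n + 1))
    ((𝓡 (2 * n + 1)).prod 𝓘(ℝ, EuclideanSpace ℝ (Fin (2 * n + 1)))) ∞
    (fun x => Bundle.TotalSpace.mk' (EuclideanSpace ℝ (Fin (2 * n + 1))) x (ξ x))
  smooth_η : ContMDiff (𝓡 (2 * n + 1))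
    ((𝓡 (2 * n + 1)).prod 𝓘(ℝ, EuclideanSpace ℝ (Fin (2 * n + 1)) →L[ℝ] ℝ)) ∞
    (fun x => Bundle.TotalSpace.mk' (EuclideanSpace ℝ (Fin (2 * n + 1)) →L[ℝ] ℝ) x (η x))
  φ_ξ : ∀ x, φ x (ξ x) = 0
  η_φ : ∀ x v, η x (φ x v) = 0
  η_ξ : ∀ x, η x (ξ x) = 1
  φ_φ : ∀ x v, φ x (φ x v) = v - η x v • ξ x
  /-- On each fibre of `𝔻 = ker η` the eigenspaces of `φ` for `1` and `-1` have dimension `n`. -/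
  finrank_pos : ∀ x, Module.finrank ℝ
    ↥(LinearMap.ker (η x).toLinearMap ⊓ Module.End.eigenspace (φ x).toLinearMap 1) = n
  finrank_neg : ∀ x, Module.finrank ℝ
    ↥(LinearMap.ker (η x).toLinearMap ⊓ Module.End.eigenspace (φ x).toLinearMap (-1)) = n

/-- A paracontact metric structure `(φ, ξ, η, g)`: an almost paracontact structure with a
compatible pseudo-Riemannian metric `g` such that `g(X, φY) = dη(X, Y)`. -/
structure ParacontactMetric (n : ℕ) (M : Type*) [TopologicalSpace M]
    [ChartedSpace (EuclideanSpace ℝ (Fin (2 * n + 1))) M]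
    [IsManifold (𝓡 (2 * n + 1)) ∞ M] extends AlmostParacontact n M where
  g : ∀ x : M, TangentSpace (𝓡 (2 * n + 1)) x →L[ℝ] TangentSpace (𝓡 (2 * n + 1)) x →L[ℝ] ℝ
  smooth_g : ContMDiff (𝓡 (2 * n + 1))
    ((𝓡 (2 * n + 1)).prod 𝓘(ℝ, EuclideanSpace ℝ (Fin (2 * n + 1)) →L[ℝ]
      EuclideanSpace ℝ (Fin (2 * n + 1)) →L[ℝ] ℝ)) ∞
    (fun x => Bundle.TotalSpace.mk' (EuclideanSpace ℝ (Fin (2 * n + 1)) →L[ℝ]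
      EuclideanSpace ℝ (Fin (2 * n + 1)) →L[ℝ] ℝ) x (g x))
  g_symm : ∀ x v w, g x v w = g x w v
  g_nondegenerate : ∀ x v, (∀ w, g x v w = 0) → v = 0
  g_compatible : ∀ x v w, g x (φ x v) (φ x w) = -g x v w + η x v * η x w
  /-- `g(X, φY) = dη(X, Y)` at `x`, for all vector fields that are smooth near `x`. -/
  g_contact : ∀ (x : M) (X Y : ∀ y : M, TangentSpace (𝓡 (2 * n + 1)) y),
    ContMDiffAt (𝓡 (2 * n + 1))
      ((𝓡 (2 * n + 1)).prod 𝓘(ℝ, EuclideanSpace ℝ (Fin (2 * n + 1)))) ∞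
      (fun y => Bundle.TotalSpace.mk' (EuclideanSpace ℝ (Fin (2 * n + 1))) y (X y)) x →
    ContMDiffAt (𝓡 (2 * n + 1))
      ((𝓡 (2 * n + 1)).prod 𝓘(ℝ, EuclideanSpace ℝ (Fin (2 * n + 1)))) ∞
      (fun y => Bundle.TotalSpace.mk' (EuclideanSpace ℝ (Fin (2 * n + 1))) y (Y y)) x →
    g x (X x) (φ x (Y x)) = dForm η X Y x

section Components

variable {N : ℕ} {M : Type*} [TopologicalSpace M] [ChartedSpace (EuclideanSpace ℝ (Fin N)) M]

/-- The coordinate vector field `∂_i` of the chart `e`, at the point with coordinates `u`. -/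
def coordVector (e : OpenPartialHomeomorph M (EuclideanSpace ℝ (Fin N))) (i : Fin N)
    (u : EuclideanSpace ℝ (Fin N)) : TangentSpace (𝓡 N) (e.symm u) :=
  mfderiv (𝓡 N) (𝓡 N) e.symm u (EuclideanSpace.single i (1 : ℝ) : EuclideanSpace ℝ (Fin N))

/-- The `i`-th component `dx^i(v)` in the chart `e` of a tangent vector `v` at the point with
coordinates `u`. -/
def coordComp (e : OpenPartialHomeomorph M (EuclideanSpace ℝ (Fin N))) (i : Fin N)
    (u : EuclideanSpace ℝ (Fin N)) (v : TangentSpace (𝓡 N) (e.symm u)) : ℝ :=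
  mvfderiv (𝓡 N) e (e.symm u) v i

end Components

namespace ParacontactMetric

variable {n : ℕ} {M : Type*} [TopologicalSpace M]
  [ChartedSpace (EuclideanSpace ℝ (Fin (2 * n + 1))) M] [IsManifold (𝓡 (2 * n + 1)) ∞ M]
  (S : ParacontactMetric n M)
  (e : OpenPartialHomeomorph M (EuclideanSpace ℝ (Fin (2 * n + 1))))

/-- The matrix `(g_{ij})` of the metric in the chart `e`. -/
def gComp (u : EuclideanSpace ℝ (Fin (2 * n + 1))) :
    Matrix (Fin (2 * n + 1)) (Fin (2 * n + 1)) ℝ :=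
  Matrix.of fun i j => S.g (e.symm u) (coordVector e i u) (coordVector e j u)

/-- The component `φ^i_j`. -/
def φComp (i j : Fin (2 * n + 1)) (u : EuclideanSpace ℝ (Fin (2 * n + 1))) : ℝ :=
  coordComp e i u (S.φ (e.symm u) (coordVector e j u))

/-- The component `ξ^i`. -/
def ξComp (i : Fin (2 * n + 1)) (u : EuclideanSpace ℝ (Fin (2 * n + 1))) : ℝ :=
  coordComp e i u (S.ξ (e.symm u))

/-- The component `η_i`. -/
def ηComp (i : Fin (2 * n + 1)) (u : EuclideanSpace ℝ (Fin (2 * n + 1))) : ℝ :=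
  S.η (e.symm u) (coordVector e i u)

/-- The coefficients of the canonical paracontact connection
`D_X Y = ∇_X Y + η(X) φY - η(Y) ∇_X ξ + (∇_X η)(Y) ξ`, with `∇` the Levi-Civita connection:
`D_{∂_i} ∂_j` has the components `canonicalConnection k i j`. -/
def canonicalConnection (k i j : Fin (2 * n + 1)) (u : EuclideanSpace ℝ (Fin (2 * n + 1))) : ℝ :=
  christoffel (S.gComp e) k i j u + S.ηComp e i u * S.φComp e k j u
    - S.ηComp e j u * covVector (S.gComp e) (S.ξComp e) i k u
    + covForm (S.gComp e) (S.ηComp e) i j u * S.ξComp e k u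

/-- The scalar curvature `W₁ = g^{jk} Ric_{jk}` of the canonical paracontact connection, at the
point with coordinates `u`. -/
def W₁ (u : EuclideanSpace ℝ (Fin (2 * n + 1))) : ℝ :=
  ∑ j, ∑ k, (S.gComp e u)⁻¹ j k * ricci (S.canonicalConnection e) j k u

/-- The component `f_i = ∂_i f` of `df`. -/
def dComp (f : M → ℝ) (i : Fin (2 * n + 1)) (u : EuclideanSpace ℝ (Fin (2 * n + 1))) : ℝ :=
  pd i (fun w => f (e.symm w)) u

/-- `Δ_𝔻 f = (g^{ij} - ξ^i ξ^j) ∇_i ∇_j f`. -/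
def laplacianD (f : M → ℝ) (u : EuclideanSpace ℝ (Fin (2 * n + 1))) : ℝ :=
  ∑ i, ∑ j, ((S.gComp e u)⁻¹ i j - S.ξComp e i u * S.ξComp e j u)
    * covForm (S.gComp e) (dComp e f) i j u

/-- `|df|²_𝔻 = (g^{ij} - ξ^i ξ^j) f_i f_j`. -/
def normSqD (f : M → ℝ) (u : EuclideanSpace ℝ (Fin (2 * n + 1))) : ℝ :=
  ∑ i, ∑ j, ((S.gComp e u)⁻¹ i j - S.ξComp e i u * S.ξComp e j u)
    * (dComp e f i u * dComp e f j u)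

/-- The component `f^i = g^{ij} f_j` of the gradient of `f`. -/
def gradComp (f : M → ℝ) (i : Fin (2 * n + 1)) (u : EuclideanSpace ℝ (Fin (2 * n + 1))) : ℝ :=
  ∑ j, (S.gComp e u)⁻¹ i j * dComp e f j u

/-- The derivative `ξ f = ξ^i f_i`. -/
def ξDeriv (f : M → ℝ) (u : EuclideanSpace ℝ (Fin (2 * n + 1))) : ℝ :=
  ∑ i, S.ξComp e i u * dComp e f i u

/-- The component `ζ^k = -(1 / (2σ)) φ^k_j σ^j`. -/
def ζComp (σ : M → ℝ) (k : Fin (2 * n + 1)) (u : EuclideanSpace ℝ (Fin (2 * n + 1))) : ℝ :=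
  -(1 / (2 * σ (e.symm u))) * ∑ j, S.φComp e k j u * S.gradComp e σ j u

/-- The component `ζ_i = g_{ij} ζ^j`. -/
def ζLower (σ : M → ℝ) (i : Fin (2 * n + 1)) (u : EuclideanSpace ℝ (Fin (2 * n + 1))) : ℝ :=
  ∑ j, S.gComp e u i j * S.ζComp e σ j u

/-- `|ζ|² = ζ_i ζ^i`. -/
def ζNormSq (σ : M → ℝ) (u : EuclideanSpace ℝ (Fin (2 * n + 1))) : ℝ :=
  ∑ i, S.ζLower e σ i u * S.ζComp e σ i u

end ParacontactMetric

/-- `S'` arises from `S` by the gauge transformation `η ↦ σ η`: the contact form of `S'` is `σ η`,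
and `φ` and `φ'` agree on `𝔻 = ker η`. -/
structure IsGauge {n : ℕ} {M : Type*} [TopologicalSpace M]
    [ChartedSpace (EuclideanSpace ℝ (Fin (2 * n + 1))) M] [IsManifold (𝓡 (2 * n + 1)) ∞ M]
    (σ : M → ℝ) (S S' : ParacontactMetric n M) : Prop where
  η_eq : ∀ x, S'.η x = σ x • S.η x
  φ_eq : ∀ x v, S.η x v = 0 → S'.φ x v = S.φ x v

end Paracontact

end

/-!
# Gauge transformations of paracontact metric structures

Write `𝔻 = ker η`, let `P` be the projection to `𝔻` along `ξ`, and put `m = 2n`.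

*Existence and the coordinate formulas* are pointwise algebra. With the factor one half in `dη`, the
contact form `σ η` has `d(σ η) = σ dη + ½ dσ ∧ η` (`ParacontactMetric.dForm_smul`). Evaluating the
contact condition `g'(v, φ' w) = d(σ η)(v, w)` at `w = ξ'`, where its left-hand side vanishes, gives
`φ ξ'` and hence `ξ'`; then `φ'` is known on `𝔻` and on `ξ'`, and finally `g'` on the image of `φ'`
and on `ξ'` (`PointwiseMetric.gauge_unique`). Conversely the tensors found in this way form a
paracontact metric structure (`PointwiseMetric.gauge`, `ParacontactMetric.gauge`); on `𝔻` the
endomorphism is unchanged, so its eigenspaces there are too.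

*The scalar curvature.* The components of the tensors in a chart are elements of the commutative ring
of smooth functions on the coordinate domain, on which the partial derivatives act as commuting
derivations. The computation is made over any commutative ring with commuting derivations in which
`2` is invertible (`ParacontactMatrix`, `GaugeMatrix`), and evaluated at a point at the end. It uses
only that the canonical connection is metric, that `ξ` and `η` are parallel, and that the torsion is
`2 dη ⊗ ξ + η ∧ τ` with `τ = φ + ∇ξ` (`AdaptedConnection`). From `d(dη) = 0` it follows that the
divergence of `φ` and the horizontal trace of `τ` vanish (`sum_φ_mul_nabla_φ`, `trace_τ_mul_P`), so
that `Δ_𝔻` may be computed with the canonical instead of the Levi-Civita connection.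

Let `A = D' - D` be the difference of the two canonical connections. On `𝔻` the metric is multiplied
by `σ`, and the torsions differ by `2 dη ⊗ ζ`. A Koszul argument determines the horizontal part of
`A` from this (`ParaHermitian.eq_gaugeTensor`, `GaugeMatrix.horizontalPart_eq`): it is the sum of the
difference tensor of a conformal change, with `θ = P dσ / (2σ)`, and of its `φ`-twisted counterpart
in `ζ = -φ θ♯`.

Both scalar curvatures are traces over `𝔻`, since `ξ` and `η` are parallel. Their difference consists
of a quadratic term in the horizontal part of `A` and of the exterior covariant derivative of `A`. As
`P` and the metric are parallel, the trace of the latter is a difference of two divergences plus a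
torsion term (`sum_covariant_curl`). The divergences are those of `-m θ♯` and `(m + 2) θ♯`. The torsion
term is `-2 tr(φ A_ξ)`, the only place where the vertical part of `A` enters; this trace is found by
comparing the torsions on `σ ξ' = ξ + ζ` (`trace_φ_mul_sub_ξ`). The result is
`σ W₁' - W₁ = -(2m + 4) div θ♯ - m (m + 2) |θ|²` (`scalar_curvature_sub`). Expanding the divergence of
`θ♯` produces `Δ_𝔻 σ`, and a multiple of `|dσ|²_𝔻` that changes
`m (m + 2) |θ|²` into `(m - 4) (m + 2) |θ|²`.
-/

namespace Paracontact

open Matrix Finset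

/-! ### Connections and curvature over a ring with derivations -/

section MatrixCalculus

variable {ι A : Type*} [CommRing A]

theorem map_derivation_vecMulVec (d : Derivation ℤ A A) (v w : ι → A) :
    (vecMulVec v w).map d = vecMulVec (d ∘ v) w + vecMulVec v (d ∘ w) := by
  ext i j
  simp only [map_apply, vecMulVec_apply, Derivation.leibniz, smul_eq_mul, Matrix.add_apply,
    Function.comp_apply]
  ring

theorem map_derivation_add (d : Derivation ℤ A A) (M N : Matrix ι ι A) :
    (M + N).map d = M.map d + N.map d := by
  ext i j; simp

theorem map_derivation_sub (d : Derivation ℤ A A) (M N : Matrix ι ι A) :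
    (M - N).map d = M.map d - N.map d := by
  ext i j; simp

theorem map_derivation_smul (d : Derivation ℤ A A) (a : A) (M : Matrix ι ι A) :
    (a • M).map d = d a • M + a • M.map d := by
  ext i j; simp; ring

theorem map_derivation_transpose (d : Derivation ℤ A A) (M : Matrix ι ι A) :
    Mᵀ.map d = (M.map d)ᵀ := rfl

theorem derivation_smul_vec (d : Derivation ℤ A A) (a : A) (v : ι → A) :
    d ∘ (a • v) = d a • v + a • (d ∘ v) := by
  ext i; simp; ring

theorem derivation_add_vec (d : Derivation ℤ A A) (v w : ι → A) :
    d ∘ (v + w) = d ∘ v + d ∘ w := by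
  ext i; simp

theorem derivation_neg_vec (d : Derivation ℤ A A) (v : ι → A) :
    d ∘ (-v) = -(d ∘ v) := by
  ext i; simp

variable [Fintype ι]

theorem map_derivation_mul (d : Derivation ℤ A A) (M N : Matrix ι ι A) :
    (M * N).map d = M.map d * N + M * N.map d := by
  ext i j
  simp only [map_apply, mul_apply, map_sum, Derivation.leibniz, Matrix.add_apply, smul_eq_mul,
    sum_add_distrib]
  rw [add_comm]
  congr 1
  exact sum_congr rfl fun _ _ => mul_comm _ _

theorem derivation_mulVec (d : Derivation ℤ A A) (M : Matrix ι ι A) (v : ι → A) :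
    (d ∘ (M *ᵥ v)) = M.map d *ᵥ v + M *ᵥ (d ∘ v) := by
  ext i
  simp only [Function.comp_apply, mulVec, dotProduct, map_sum, Derivation.leibniz, smul_eq_mul,
    sum_add_distrib, Pi.add_apply, map_apply]
  rw [add_comm]
  congr 1
  exact sum_congr rfl fun _ _ => mul_comm _ _

theorem derivation_vecMul (d : Derivation ℤ A A) (M : Matrix ι ι A) (v : ι → A) :
    (d ∘ (v ᵥ* M)) = (d ∘ v) ᵥ* M + v ᵥ* M.map d := by
  ext i
  simp only [Function.comp_apply, vecMul, dotProduct, map_sum, Derivation.leibniz, smul_eq_mul,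
    sum_add_distrib, Pi.add_apply, map_apply]
  rw [add_comm]
  congr 1
  exact sum_congr rfl fun _ _ => mul_comm _ _

theorem derivation_dotProduct (d : Derivation ℤ A A) (v w : ι → A) :
    d (v ⬝ᵥ w) = (d ∘ v) ⬝ᵥ w + v ⬝ᵥ (d ∘ w) := by
  simp only [dotProduct, map_sum, Derivation.leibniz, smul_eq_mul, sum_add_distrib,
    Function.comp_apply]
  rw [add_comm]
  congr 1
  exact sum_congr rfl fun _ _ => mul_comm _ _

/-- The derivative of the inverse matrix. -/
theorem map_derivation_inv [DecidableEq ι] (d : Derivation ℤ A A) {g gi : Matrix ι ι A}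
    (h : gi * g = 1) (h' : g * gi = 1) :
    gi.map d = -(gi * g.map d * gi) := by
  have h1 : (gi * g).map d = 0 := by
    rw [h]; ext i j; simp [one_apply]; split_ifs <;> simp
  rw [map_derivation_mul] at h1
  have h2 : (gi.map d * g + gi * g.map d) * gi = 0 := by rw [h1, zero_mul]
  rw [add_mul, mul_assoc, h', mul_one] at h2
  exact eq_neg_of_add_eq_zero_left h2

end MatrixCalculus

section Connection

variable {ι A : Type*} [Fintype ι] [CommRing A]

/-- The curvature matrices `(R(∂_i, ∂_j))^l_k = R_{ijk}^l` of the linear connection with connection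
matrices `(G i)^k_j = Γ^k_{ij}`, over a commutative ring with derivations `∂_i`. -/
def curv (δ : ι → Derivation ℤ A A) (G : ι → Matrix ι ι A) (i j : ι) : Matrix ι ι A :=
  (G j).map (δ i) - (G i).map (δ j) + (G i * G j - G j * G i)

/-- The divergence `∂_i V^i + Γ^i_{is} V^s` of a vector. -/
def divergence (δ : ι → Derivation ℤ A A) (G : ι → Matrix ι ι A) (V : ι → A) : A :=
  ∑ i, (δ i (V i) + ∑ s, G i i s * V s)

/-- The torsion `T^k_{ij} = Γ^k_{ij} - Γ^k_{ji}`. -/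
def torsion (G : ι → Matrix ι ι A) (k i j : ι) : A := G i k j - G j k i

variable {δ : ι → Derivation ℤ A A} {G : ι → Matrix ι ι A}

/-- The curvature annihilates parallel vector fields. -/
theorem curv_mulVec_eq_zero (hδ : ∀ i j a, δ i (δ j a) = δ j (δ i a)) {ξ : ι → A}
    (hξ : ∀ i, δ i ∘ ξ = -(G i *ᵥ ξ)) (i j : ι) : curv δ G i j *ᵥ ξ = 0 := by
  have key : ∀ i j, δ i ∘ (δ j ∘ ξ) = -((G j).map (δ i) *ᵥ ξ) + (G j * G i) *ᵥ ξ := by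
    intro i j
    rw [hξ j, derivation_neg_vec, derivation_mulVec, hξ i, mulVec_neg, mulVec_mulVec]
    abel
  have h : δ i ∘ (δ j ∘ ξ) = δ j ∘ (δ i ∘ ξ) := funext fun k => hδ i j (ξ k)
  rw [key, key] at h
  simp only [curv, add_mulVec, sub_mulVec]
  linear_combination (exp := 1) -h

/-- The curvature is annihilated by parallel covector fields. -/
theorem vecMul_curv_eq_zero (hδ : ∀ i j a, δ i (δ j a) = δ j (δ i a)) {η : ι → A}
    (hη : ∀ i, δ i ∘ η = η ᵥ* G i) (i j : ι) : η ᵥ* curv δ G i j = 0 := by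
  have key : ∀ i j, δ i ∘ (δ j ∘ η) = η ᵥ* (G i * G j) + η ᵥ* (G j).map (δ i) := by
    intro i j
    rw [hη j, derivation_vecMul, hη i, vecMul_vecMul]
  have h : δ i ∘ (δ j ∘ η) = δ j ∘ (δ i ∘ η) := funext fun k => hδ i j (η k)
  rw [key, key] at h
  simp only [curv, vecMul_add, vecMul_sub]
  linear_combination (exp := 1) h

/-- The curvature of `G + D` differs from that of `G` by the exterior covariant derivative of `D`
and a quadratic term. The exterior derivative is taken with `G` acting on the matrix indices of `D`
only, so no torsion occurs here. -/
theorem curv_add (D : ι → Matrix ι ι A) (i j : ι) :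
    curv δ (G + D) i j = curv δ G i j
      + (((D j).map (δ i) + G i * D j - D j * G i) - ((D i).map (δ j) + G j * D i - D i * G j))
      + (D i * D j - D j * D i) := by
  simp only [curv, Pi.add_apply, map_derivation_add]
  noncomm_ring

end Connection

section HorizontalTrace

variable {ι A : Type*} [Fintype ι] [CommRing A]
variable {δ : ι → Derivation ℤ A A} {G : ι → Matrix ι ι A}

/-- Integration by parts: contracting the exterior covariant derivative of a matrix-valued
1-form `D` with parallel tensors `P`, `h` gives two divergences and a torsion term. -/
theorem sum_covariant_curl {P h : Matrix ι ι A} (hP : ∀ i, P.map (δ i) = P * G i - G i * P)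
    (hh : ∀ i, h.map (δ i) = -(G i * h + h * (G i)ᵀ)) (D : ι → Matrix ι ι A) :
    ∑ i, ∑ j, (P * (((D j).map (δ i) + G i * D j - D j * G i)
        - ((D i).map (δ j) + G j * D i - D i * G j)) * h) i j
      = divergence δ G (fun i => ∑ j, (P * D j * h) i j)
        - divergence δ G (fun j => ∑ i, (P * D i * h) i j)
        + ∑ j, ∑ i, ∑ s, (P * D j * h) i s * torsion G j i s := by
  -- `P` and `h` are parallel, so they commute with the covariant derivative
  have key : ∀ i j, P * ((D j).map (δ i) + G i * D j - D j * G i) * h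
      = (P * D j * h).map (δ i) + G i * (P * D j * h) + (P * D j * h) * (G i)ᵀ := by
    intro i j
    rw [map_derivation_mul, map_derivation_mul, hP, hh]
    noncomm_ring
  have e1 : ∀ i j, (P * (((D j).map (δ i) + G i * D j - D j * G i)
        - ((D i).map (δ j) + G j * D i - D i * G j)) * h) i j
      = (δ i ((P * D j * h) i j) + ∑ s, G i i s * (P * D j * h) s j
          + ∑ s, (P * D j * h) i s * G i j s)
        - (δ j ((P * D i * h) i j) + ∑ s, G j i s * (P * D i * h) s j
          + ∑ s, (P * D i * h) i s * G j j s) := by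
    intro i j
    rw [mul_sub, sub_mul, key, key]
    rfl
  -- the divergences absorb one connection term each; the remaining ones pair up to the torsion
  simp_rw [e1]
  simp only [divergence, torsion, map_sum, sum_sub_distrib, sum_add_distrib, mul_sum, mul_sub]
  have s1 : ∑ i, ∑ j, ∑ s, G i i s * (P * D j * h) s j
      = ∑ i, ∑ s, ∑ j, G i i s * (P * D j * h) s j :=
    sum_congr rfl fun i _ => sum_comm
  have s2 : ∑ i, ∑ j, ∑ s, (P * D j * h) i s * G i j s
      = ∑ j, ∑ i, ∑ s, (P * D j * h) i s * G i j s := sum_comm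
  have s3 : ∑ i, ∑ j, δ j ((P * D i * h) i j) = ∑ j, ∑ i, δ j ((P * D i * h) i j) := sum_comm
  have s4 : ∑ i, ∑ j, ∑ s, (P * D i * h) i s * G j j s
      = ∑ j, ∑ s, ∑ i, G j j s * (P * D i * h) i s := by
    rw [sum_comm]
    refine sum_congr rfl fun j _ => ?_
    rw [sum_comm]
    exact sum_congr rfl fun s _ => sum_congr rfl fun i _ => mul_comm _ _
  have s5 : ∑ i, ∑ j, ∑ s, G j i s * (P * D i * h) s j
      = ∑ j, ∑ i, ∑ s, (P * D j * h) i s * G s j i := by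
    refine sum_congr rfl fun i _ => ?_
    rw [sum_comm]
    exact sum_congr rfl fun s _ => sum_congr rfl fun i _ => mul_comm _ _
  rw [s1, s2, s3, s4, s5]
  ring

/-- The horizontal part of a matrix-valued 1-form `D`: all three slots are projected by `P`, so that
its value at the index `r` is `P^i_r P D_i P`. -/
def horizontalPart (P : Matrix ι ι A) (D : ι → Matrix ι ι A) (r : ι) : Matrix ι ι A :=
  ∑ i, P i r • (P * D i * P)

end HorizontalTrace

/-! ### Para-Hermitian algebra and the gauge tensor -/

section RowColumn

variable {ι A : Type*} [Fintype ι] [CommRing A]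

theorem row_dotProduct (M : Matrix ι ι A) (v : ι → A) (r : ι) : M r ⬝ᵥ v = (M *ᵥ v) r := rfl

theorem dotProduct_row (M : Matrix ι ι A) (v : ι → A) (r : ι) : v ⬝ᵥ M r = (M *ᵥ v) r :=
  dotProduct_comm _ _

theorem dotProduct_col (M : Matrix ι ι A) (v : ι → A) (r : ι) : v ⬝ᵥ Mᵀ r = (v ᵥ* M) r := rfl

theorem row_dotProduct_col (M N : Matrix ι ι A) (r : ι) : M r ⬝ᵥ Nᵀ r = (M * N) r r := rfl

theorem trace_vecMulVec_mul (a b : ι → A) (M : Matrix ι ι A) :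
    trace (vecMulVec a b * M) = b ⬝ᵥ M *ᵥ a := by
  rw [vecMulVec_mul, trace_vecMulVec, dotProduct_mulVec, dotProduct_comm]

theorem trace_mul_vecMulVec (a b : ι → A) (M : Matrix ι ι A) :
    trace (M * vecMulVec a b) = b ⬝ᵥ M *ᵥ a := by
  rw [mul_vecMulVec, trace_vecMulVec, dotProduct_comm]

theorem trace_vecMulVec_mul_vecMulVec (a b c d : ι → A) :
    trace (vecMulVec a b * vecMulVec c d) = (b ⬝ᵥ c) * (a ⬝ᵥ d) := by
  rw [trace_vecMulVec_mul, vecMulVec_mulVec, dotProduct_comm d a]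
  simp [mul_comm]

end RowColumn

/-- The algebra of a para-Hermitian structure on a horizontal distribution, in matrices: the
projection `P`, the horizontal metric `k`, its horizontal inverse `h`, and the paracomplex
structure `φ`; `m` is the rank of the distribution. -/
structure ParaHermitian {ι A : Type*} [Fintype ι] [CommRing A] (m : A) (P h k φ : Matrix ι ι A) :
    Prop where
  k_symm : kᵀ = k
  h_symm : hᵀ = h
  h_mul_k : h * k = P
  k_mul_P : k * P = k
  P_mul_h : P * h = h
  P_mul_φ : P * φ = φ
  φ_mul_P : φ * P = φ
  φ_mul_φ : φ * φ = P
  skew : (k * φ)ᵀ = -(k * φ)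
  trace_P : trace P = m
  trace_φ : trace φ = 0

/-- A horizontal covector `θ` of a para-Hermitian structure together with the vectors and
covectors derived from it: `s = θ♯`, `ζ = -φ θ♯`, `z = ζ♭`, and `q = |θ|²`. -/
structure HorizontalCovector {ι A : Type*} [Fintype ι] [CommRing A] (P h k φ : Matrix ι ι A)
    (θ s ζ z : ι → A) (q : A) : Prop where
  θ_P : θ ᵥ* P = θ
  z_P : z ᵥ* P = z
  P_s : P *ᵥ s = s
  P_ζ : P *ᵥ ζ = ζ
  h_θ : h *ᵥ θ = s
  h_z : h *ᵥ z = ζ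
  k_s : k *ᵥ s = θ
  k_ζ : k *ᵥ ζ = z
  φ_s : φ *ᵥ s = -ζ
  φ_ζ : φ *ᵥ ζ = -s
  θ_φ : θ ᵥ* φ = z
  z_φ : z ᵥ* φ = θ
  θ_s : θ ⬝ᵥ s = q
  θ_ζ : θ ⬝ᵥ ζ = 0
  z_s : z ⬝ᵥ s = 0
  z_ζ : z ⬝ᵥ ζ = -q

/-- The horizontal part of the difference of the canonical connections of two paracontact metric
structures related by a gauge transformation: the conformal change of the Levi-Civita connection
with `θ = dσ / (2σ)`, and the contribution of the change of the Reeb field by `ζ`. -/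
def gaugeTensor {ι A : Type*} [Fintype ι] [CommRing A] (P k φ : Matrix ι ι A)
    (θ s ζ z : ι → A) (r : ι) : Matrix ι ι A :=
  θ r • P + vecMulVec (Pᵀ r) θ - vecMulVec s (k r)
    + vecMulVec ζ ((k * φ) r) + z r • φ + vecMulVec (φᵀ r) z

theorem eq_zero_of_two_mul_eq_zero {A : Type*} [CommRing A] [Invertible (2 : A)] {a : A}
    (h : 2 * a = 0) : a = 0 := by
  rw [← invOf_mul_cancel_left (2 : A) a, h, mul_zero]

namespace ParaHermitian

variable {ι A : Type*} [Fintype ι] [CommRing A] {m : A} {P h k φ : Matrix ι ι A}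
  (H : ParaHermitian m P h k φ) {θ : ι → A}

include H

theorem P_mul_P : P * P = P := by
  rw [← H.φ_mul_φ, mul_assoc, H.φ_mul_φ, H.φ_mul_P, H.φ_mul_φ]

theorem k_mul_h : k * h = Pᵀ := by
  rw [← H.h_mul_k, transpose_mul, H.k_symm, H.h_symm]

theorem h_mul_Pt : h * Pᵀ = h := by
  have := congrArg transpose H.P_mul_h
  rwa [transpose_mul, H.h_symm] at this

theorem Pt_mul_k : Pᵀ * k = k := by
  have := congrArg transpose H.k_mul_P
  rwa [transpose_mul, H.k_symm] at this

theorem φt_mul_k : φᵀ * k = -(k * φ) := by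
  have := H.skew
  rwa [transpose_mul, H.k_symm] at this

theorem φ_mul_h : φ * h = -(h * φᵀ) := by
  have : h * (φᵀ * k) * h = -(h * (k * φ) * h) := by rw [H.φt_mul_k]; simp
  rw [mul_assoc, mul_assoc, H.k_mul_h, ← mul_assoc h k φ, H.h_mul_k, H.P_mul_φ,
    ← transpose_mul, H.P_mul_φ] at this
  rw [this, neg_neg]

theorem kφ_mul_h : k * φ * h = -φᵀ := by
  rw [mul_assoc, H.φ_mul_h, mul_neg, ← mul_assoc, H.k_mul_h, ← transpose_mul, H.φ_mul_P]

/-- A horizontal covector `θ` determines the remaining data. That `θ♯` and `φ θ♯` are orthogonal, and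
that `φ` reverses the sign of the norm, follows from the skewness of `k φ` and `φ² = P`. -/
theorem horizontalCovector [Invertible (2 : A)] {s ζ z : ι → A} {q : A} (hθ : θ ᵥ* P = θ)
    (hs : s = h *ᵥ θ) (hζ : ζ = -(φ *ᵥ s)) (hz : z = k *ᵥ ζ) (hq : q = θ ⬝ᵥ s) :
    HorizontalCovector P h k φ θ s ζ z q := by
  have P_s : P *ᵥ s = s := by rw [hs, mulVec_mulVec, H.P_mul_h]
  have P_ζ : P *ᵥ ζ = ζ := by rw [hζ, mulVec_neg, mulVec_mulVec, H.P_mul_φ]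
  have k_s : k *ᵥ s = θ := by rw [hs, mulVec_mulVec, H.k_mul_h, mulVec_transpose, hθ]
  have φ_ζ : φ *ᵥ ζ = -s := by rw [hζ, mulVec_neg, mulVec_mulVec, H.φ_mul_φ, P_s]
  have θ_φ : θ ᵥ* φ = z := by
    rw [← k_s, ← mulVec_transpose, mulVec_mulVec, H.φt_mul_k, hz, hζ, mulVec_neg, neg_mulVec,
      mulVec_mulVec]
  have z_φ : z ᵥ* φ = θ := by rw [← θ_φ, vecMul_vecMul, H.φ_mul_φ, hθ]
  have z_s : z ⬝ᵥ s = 0 := by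
    have h1 : z ⬝ᵥ s = θ ⬝ᵥ ζ := by
      rw [hz, ← vecMul_transpose, H.k_symm, ← dotProduct_mulVec, k_s, dotProduct_comm]
    have h2 : z ⬝ᵥ s = -(θ ⬝ᵥ ζ) := by
      rw [hζ, dotProduct_neg, neg_neg, dotProduct_mulVec, θ_φ]
    exact eq_zero_of_two_mul_eq_zero (by linear_combination h1 + h2)
  exact
  { θ_P := hθ
    z_P := by rw [← θ_φ, vecMul_vecMul, H.φ_mul_P]
    P_s := P_s
    P_ζ := P_ζ
    h_θ := hs.symm
    h_z := by rw [hz, mulVec_mulVec, H.h_mul_k, P_ζ]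
    k_s := k_s
    k_ζ := hz.symm
    φ_s := by rw [hζ, neg_neg]
    φ_ζ := φ_ζ
    θ_φ := θ_φ
    z_φ := z_φ
    θ_s := hq.symm
    θ_ζ := by rw [hζ, dotProduct_neg, dotProduct_mulVec, θ_φ, z_s, neg_zero]
    z_s := z_s
    z_ζ := by rw [hζ, dotProduct_neg, dotProduct_mulVec, z_φ, hq] }

variable {s ζ z : ι → A} {q : A} (K : HorizontalCovector P h k φ θ s ζ z q)

include K

theorem gaugeTensor_mul_h (r : ι) : gaugeTensor P k φ θ s ζ z r * h
    = θ r • h + vecMulVec (Pᵀ r) s - vecMulVec s (Pᵀ r) - vecMulVec ζ (φᵀ r) + z r • (φ * h)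
      + vecMulVec (φᵀ r) ζ := by
  have t : ∀ v : ι → A, v ᵥ* h = h *ᵥ v := fun v => by rw [← mulVec_transpose, H.h_symm]
  have e1 : k r ᵥ* h = Pᵀ r := by rw [← H.k_mul_h]; rfl
  have e2 : (k * φ) r ᵥ* h = -(φᵀ r) := by
    have := H.kφ_mul_h
    exact congrFun this r
  simp only [gaugeTensor, add_mul, sub_mul, smul_mul, vecMulVec_mul, H.P_mul_h, e1, e2, t, K.h_θ,
    K.h_z, vecMulVec_neg]
  abel

/-- The contraction of the gauge tensor over its two arguments. -/
theorem sum_gaugeTensor_mul_h (i : ι) :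
    ∑ r, (gaugeTensor P k φ θ s ζ z r * h) i r = -m * s i := by
  have e : ∀ r, (gaugeTensor P k φ θ s ζ z r * h) i r
      = h i r * θ r + P i r * s r - s i * P r r + ζ i * -φ r r + (φ * h) i r * z r
        + φ i r * ζ r := by
    intro r
    rw [H.gaugeTensor_mul_h K]
    simp [vecMulVec_apply]
    ring
  have d : ∀ (M : Matrix ι ι A) (v : ι → A), ∑ r, M i r * v r = (M *ᵥ v) i := fun _ _ => rfl
  have hP : ∑ r, P r r = m := H.trace_P
  have hφ : ∑ r, φ r r = 0 := H.trace_φ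
  rw [sum_congr rfl fun r _ => e r]
  simp only [sum_add_distrib, sum_sub_distrib, ← mul_sum, d, sum_neg_distrib, hP, hφ,
    ← mulVec_mulVec, K.h_z, K.h_θ, K.P_s, K.φ_ζ, Pi.neg_apply]
  ring

/-- The trace of the gauge tensor over its first argument and its value. -/
theorem sum_gaugeTensor_diag (j : ι) :
    ∑ r, gaugeTensor P k φ θ s ζ z r r j = (m + 2) * θ j := by
  have e : ∀ r, gaugeTensor P k φ θ s ζ z r r j
      = θ r * P r j + P r r * θ j - s r * k r j + ζ r * (k * φ) r j + z r * φ r j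
        + φ r r * z j := by
    intro r
    simp [gaugeTensor, vecMulVec_apply]
  have d : ∀ (M : Matrix ι ι A) (v : ι → A), ∑ r, v r * M r j = (v ᵥ* M) j := fun _ _ => rfl
  have hP : ∑ r, P r r = m := H.trace_P
  have hφ : ∑ r, φ r r = 0 := H.trace_φ
  have t : ∀ v : ι → A, v ᵥ* k = k *ᵥ v := fun v => by rw [← mulVec_transpose, H.k_symm]
  rw [sum_congr rfl fun r _ => e r]
  simp only [sum_add_distrib, sum_sub_distrib, ← sum_mul, d, hP, hφ, ← vecMul_vecMul, t, K.k_ζ,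
    K.k_s, K.z_φ, K.θ_P]
  ring

/-- The trace of `φ ∘ B(ζ, ·)` for the gauge tensor `B`. -/
theorem trace_φ_mul_gaugeTensor :
    trace (φ * ∑ r, ζ r • gaugeTensor P k φ θ s ζ z r) = -(m + 4) * q := by
  have e1 : ∀ r, k r ⬝ᵥ φ *ᵥ s = -z r := by
    intro r
    rw [K.φ_s, dotProduct_neg, row_dotProduct, K.k_ζ]
  have e2 : ∀ r, (k * φ) r ⬝ᵥ φ *ᵥ ζ = z r := by
    intro r
    rw [K.φ_ζ, dotProduct_neg, row_dotProduct, ← mulVec_mulVec, K.φ_s, mulVec_neg, K.k_ζ,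
      Pi.neg_apply, neg_neg]
  have e3 : ∀ r, θ ⬝ᵥ φ *ᵥ Pᵀ r = z r := by
    intro r
    rw [dotProduct_mulVec, K.θ_φ, dotProduct_col, K.z_P]
  have e4 : ∀ r, z ⬝ᵥ φ *ᵥ φᵀ r = z r := by
    intro r
    rw [dotProduct_mulVec, K.z_φ, dotProduct_col, K.θ_φ]
  have e : ∀ r, trace (φ * ζ r • gaugeTensor P k φ θ s ζ z r) = (m + 4) * (z r * ζ r) := by
    intro r
    simp only [gaugeTensor, mul_smul_comm, mul_add, mul_sub, trace_add, trace_sub, trace_smul,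
      H.φ_mul_P, H.trace_φ, trace_mul_vecMulVec, H.φ_mul_φ, H.trace_P, smul_eq_mul,
      e1, e2, e3, e4]
    ring
  rw [mul_sum, trace_sum, sum_congr rfl fun r _ => e r, ← mul_sum]
  change (m + 4) * (z ⬝ᵥ ζ) = _
  rw [K.z_ζ]
  ring

/-- The contraction `tr_{Y,Z} tr (X ↦ B(Y, B(X, Z)))` of the square of the gauge tensor. -/
theorem sum_gaugeTensor_mul_gaugeTensor :
    ∑ r, ∑ j, (gaugeTensor P k φ θ s ζ z j * gaugeTensor P k φ θ s ζ z r * h) r j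
      = -(2 * m + 4) * q := by
  -- for fixed `r`, the sum over `j` is the trace of a product of two matrices
  have e : ∀ r, ∑ j, (gaugeTensor P k φ θ s ζ z j * gaugeTensor P k φ θ s ζ z r * h) r j
      = trace ((vecMulVec θ (P r) + vecMulVec (P r) θ - s r • k + ζ r • (k * φ)
          + vecMulVec z (φ r) + vecMulVec (φ r) z) * (gaugeTensor P k φ θ s ζ z r * h)) := by
    intro r
    refine sum_congr rfl fun j _ => ?_
    rw [mul_assoc, mul_apply, diag_apply, mul_apply]
    refine sum_congr rfl fun t _ => ?_
    congr 1
  have kP : trace (k * h) = m := by rw [H.k_mul_h, trace_transpose, H.trace_P]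
  have kφ : trace (k * (φ * h)) = 0 := by
    rw [← mul_assoc, H.kφ_mul_h, trace_neg, trace_transpose, H.trace_φ, neg_zero]
  have kφh : trace (k * φ * h) = 0 := by rw [mul_assoc, kφ]
  have kφφ : trace (k * φ * (φ * h)) = m := by
    rw [mul_assoc, ← mul_assoc φ, H.φ_mul_φ, ← mul_assoc, H.k_mul_P, kP]
  have t : ∀ v : ι → A, v ᵥ* h = h *ᵥ v := fun v => by rw [← mulVec_transpose, H.h_symm]
  have tk : ∀ v : ι → A, v ᵥ* k = k *ᵥ v := fun v => by rw [← mulVec_transpose, H.k_symm]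
  have f : ∀ r, trace ((vecMulVec θ (P r) + vecMulVec (P r) θ - s r • k + ζ r • (k * φ)
          + vecMulVec z (φ r) + vecMulVec (φ r) z) * (gaugeTensor P k φ θ s ζ z r * h))
      = (m + 4) * (z r * ζ r) - m * (θ r * s r) := by
    intro r
    rw [H.gaugeTensor_mul_h K]
    -- pairings of the rows and columns occurring in the two factors
    have p1 : P r ⬝ᵥ s = s r := by rw [row_dotProduct, K.P_s]
    have p2 : P r ⬝ᵥ ζ = ζ r := by rw [row_dotProduct, K.P_ζ]
    have p3 : P r ⬝ᵥ φᵀ r = φ r r := by rw [row_dotProduct_col, H.P_mul_φ]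
    have p4 : P r ⬝ᵥ Pᵀ r = P r r := by rw [row_dotProduct_col, H.P_mul_P]
    have p5 : φ r ⬝ᵥ Pᵀ r = φ r r := by rw [row_dotProduct_col, H.φ_mul_P]
    have p6 : φ r ⬝ᵥ s = -ζ r := by rw [row_dotProduct, K.φ_s, Pi.neg_apply]
    have p7 : φ r ⬝ᵥ ζ = -s r := by rw [row_dotProduct, K.φ_ζ, Pi.neg_apply]
    have p8 : φ r ⬝ᵥ φᵀ r = P r r := by rw [row_dotProduct_col, H.φ_mul_φ]
    have p9 : θ ⬝ᵥ Pᵀ r = θ r := by rw [dotProduct_col, K.θ_P]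
    have p10 : θ ⬝ᵥ φᵀ r = z r := by rw [dotProduct_col, K.θ_φ]
    have p11 : z ⬝ᵥ Pᵀ r = z r := by rw [dotProduct_col, K.z_P]
    have p12 : z ⬝ᵥ φᵀ r = θ r := by rw [dotProduct_col, K.z_φ]
    have h1 : θ ⬝ᵥ h *ᵥ P r = s r := by
      rw [dotProduct_mulVec, t, K.h_θ, dotProduct_row, K.P_s]
    have h2 : z ⬝ᵥ h *ᵥ φ r = -s r := by
      rw [dotProduct_mulVec, t, K.h_z, dotProduct_row, K.φ_ζ, Pi.neg_apply]
    have h3 : P r ⬝ᵥ (φ * h) *ᵥ θ = -ζ r := by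
      rw [← mulVec_mulVec, K.h_θ, K.φ_s, dotProduct_neg, p2]
    have h4 : θ ⬝ᵥ (φ * h) *ᵥ P r = ζ r := by
      rw [← mulVec_mulVec, dotProduct_mulVec, K.θ_φ, dotProduct_mulVec, t, K.h_z,
        dotProduct_row, K.P_ζ]
    have h5 : φ r ⬝ᵥ (φ * h) *ᵥ z = ζ r := by
      rw [← mulVec_mulVec, K.h_z, K.φ_ζ, dotProduct_neg, p6, neg_neg]
    have h6 : z ⬝ᵥ (φ * h) *ᵥ φ r = -ζ r := by
      rw [← mulVec_mulVec, dotProduct_mulVec, K.z_φ, dotProduct_mulVec, t, K.h_θ,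
        dotProduct_row, K.φ_s, Pi.neg_apply]
    have k1 : s ⬝ᵥ k *ᵥ Pᵀ r = θ r := by rw [dotProduct_mulVec, tk, K.k_s, p9]
    have k2 : Pᵀ r ⬝ᵥ k *ᵥ s = θ r := by rw [K.k_s, dotProduct_comm, p9]
    have k3 : φᵀ r ⬝ᵥ k *ᵥ ζ = θ r := by rw [K.k_ζ, dotProduct_comm, p12]
    have k4 : ζ ⬝ᵥ k *ᵥ φᵀ r = θ r := by rw [dotProduct_mulVec, tk, K.k_ζ, p12]
    have k5 : s ⬝ᵥ (k * φ) *ᵥ Pᵀ r = z r := by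
      rw [dotProduct_mulVec, ← vecMul_vecMul, tk, K.k_s, K.θ_φ, p11]
    have k6 : Pᵀ r ⬝ᵥ (k * φ) *ᵥ s = -z r := by
      rw [← mulVec_mulVec, K.φ_s, mulVec_neg, K.k_ζ, dotProduct_neg, dotProduct_comm, p11]
    have k7 : φᵀ r ⬝ᵥ (k * φ) *ᵥ ζ = -z r := by
      rw [← mulVec_mulVec, K.φ_ζ, mulVec_neg, K.k_s, dotProduct_neg, dotProduct_comm, p10]
    have k8 : ζ ⬝ᵥ (k * φ) *ᵥ φᵀ r = z r := by
      rw [dotProduct_mulVec, ← vecMul_vecMul, tk, K.k_ζ, K.z_φ, p10]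
    simp only [add_mul, sub_mul, mul_add, mul_sub, smul_mul, mul_smul_comm, trace_add, trace_sub,
      trace_smul, smul_eq_mul, trace_vecMulVec_mul_vecMulVec, kP, kφ, kφh, kφφ]
    simp only [trace_vecMulVec_mul, trace_mul_vecMulVec, p1, p2, p3, p4, p5, p6, p7, p8, p9, p10,
      p11, p12, h1, h2, h3, h4, h5, h6, k1, k2, k3, k4, k5, k6, k7, k8, K.h_θ, K.h_z, K.θ_s,
      K.θ_ζ, K.z_s, K.z_ζ]
    ring
  rw [sum_congr rfl fun r _ => (e r).trans (f r), sum_sub_distrib, ← mul_sum, ← mul_sum]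
  change (m + 4) * (z ⬝ᵥ ζ) - m * (θ ⬝ᵥ s) = _
  rw [K.z_ζ, K.θ_s]
  ring

end ParaHermitian

/-! ### Horizontal parts and the horizontal Koszul formula -/

theorem sum_sum_comm_sum_sum {ι A : Type*} [Fintype ι] [AddCommMonoid A]
    (f : ι → ι → ι → ι → A) :
    ∑ i, ∑ j, ∑ r, ∑ s, f i j r s = ∑ r, ∑ s, ∑ i, ∑ j, f i j r s := by
  have e : ∀ i, ∑ j, ∑ r, ∑ s, f i j r s = ∑ r, ∑ s, ∑ j, f i j r s := fun i => by
    rw [sum_comm]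
    exact sum_congr rfl fun r _ => sum_comm
  rw [sum_congr rfl fun i _ => e i, sum_comm]
  exact sum_congr rfl fun r _ => sum_comm

namespace ParaHermitian

variable {ι A : Type*} [Fintype ι] [CommRing A] {m : A} {P h k φ : Matrix ι ι A}
  (H : ParaHermitian m P h k φ)

include H

theorem sum_mul_h_eq_horizontalPart (D : ι → Matrix ι ι A) (i : ι) :
    ∑ j, (P * D j * h) i j = ∑ r, (horizontalPart P D r * h) i r := by
  have e : ∀ j, (P * D j * h) i j = ∑ r, P j r * (P * D j * h) i r := by
    intro j
    conv_lhs => rw [← H.h_mul_Pt, ← mul_assoc, mul_apply]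
    exact sum_congr rfl fun r _ => mul_comm _ _
  rw [sum_congr rfl fun j _ => e j, sum_comm]
  refine sum_congr rfl fun r _ => ?_
  simp only [horizontalPart, Matrix.sum_mul, Matrix.sum_apply, smul_mul, Matrix.smul_apply,
    smul_eq_mul, mul_assoc, H.P_mul_h]

theorem sum_mul_h_diag_eq_horizontalPart (D : ι → Matrix ι ι A) (j : ι) :
    ∑ i, (P * D i * h) i j = ∑ r, (horizontalPart P D r * h) r j := by
  have e : ∀ i, (P * D i * h) i j = ∑ r, P i r * (P * D i * h) r j := by
    intro i
    conv_lhs => rw [← H.P_mul_P, mul_assoc, mul_assoc, mul_apply]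
    simp only [mul_assoc]
  rw [sum_congr rfl fun j _ => e j, sum_comm]
  refine sum_congr rfl fun r _ => ?_
  simp only [horizontalPart, Matrix.sum_mul, Matrix.sum_apply, smul_mul, Matrix.smul_apply,
    smul_eq_mul, mul_assoc, H.P_mul_h]

/-- The quadratic part of the change of curvature involves only the horizontal part of `D`, provided
that `D` maps horizontal vectors to horizontal vectors. -/
theorem sum_mul_mul_h_eq_horizontalPart {D : ι → Matrix ι ι A}
    (hD : ∀ i j, P * D i * P * D j * h = P * D i * D j * h) :
    ∑ i, ∑ j, (P * (D i * D j - D j * D i) * h) i j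
      = ∑ r, ∑ s, (horizontalPart P D r * horizontalPart P D s * h) r s
        - ∑ r, ∑ s, (horizontalPart P D s * horizontalPart P D r * h) r s := by
  have c : ∀ r s, horizontalPart P D r * horizontalPart P D s * h
      = ∑ i, ∑ j, (P i r * P j s) • (P * (D i * D j) * h) := by
    intro r s
    have f : ∀ i j, (P i r • (P * D i * P)) * (P j s • (P * D j * P)) * h
        = (P i r * P j s) • (P * (D i * D j) * h) := by
      intro i j
      rw [smul_mul, mul_smul_comm, smul_smul, smul_mul, ← mul_assoc P (D i) (D j), ← hD]
      congr 1
      simp only [mul_assoc, H.P_mul_h]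
      rw [← mul_assoc P P, H.P_mul_P]
    simp only [horizontalPart, Matrix.sum_mul, Matrix.mul_sum, f]
    exact sum_comm
  have e : ∀ M : Matrix ι ι A, ∀ i j, (P * M * h) i j
      = ∑ r, ∑ s, P i r * P j s * (P * M * h) r s := by
    intro M i j
    have : P * M * h = P * (P * M * h) * Pᵀ := by
      simp only [mul_assoc, H.h_mul_Pt]
      simp only [← mul_assoc, H.P_mul_P]
    conv_lhs => rw [this, Matrix.mul_apply]
    rw [sum_comm]
    refine sum_congr rfl fun s _ => ?_
    rw [Matrix.mul_apply, sum_mul]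
    refine sum_congr rfl fun r _ => ?_
    rw [transpose_apply]
    ring
  have split : ∀ i j, (P * (D i * D j - D j * D i) * h) i j
      = (P * (D i * D j) * h) i j - (P * (D j * D i) * h) i j := fun i j => by
    rw [mul_sub, sub_mul]
    rfl
  simp_rw [split, sum_sub_distrib]
  congr 1
  · rw [sum_congr rfl fun i _ => sum_congr rfl fun j _ => e (D i * D j) i j, sum_sum_comm_sum_sum]
    refine sum_congr rfl fun r _ => sum_congr rfl fun s _ => ?_
    rw [c]
    simp only [Matrix.sum_apply, Matrix.smul_apply, smul_eq_mul]
  · rw [sum_congr rfl fun i _ => sum_congr rfl fun j _ => e (D j * D i) i j, sum_sum_comm_sum_sum]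
    refine sum_congr rfl fun r _ => sum_congr rfl fun s _ => ?_
    rw [c, sum_comm, Matrix.sum_apply]
    refine sum_congr rfl fun i _ => ?_
    rw [Matrix.sum_apply]
    refine sum_congr rfl fun j _ => ?_
    rw [Matrix.smul_apply, smul_eq_mul, mul_comm (P j r)]

theorem trace_φ_mul_horizontalPart (D : ι → Matrix ι ι A) {ζ : ι → A} (hζ : P *ᵥ ζ = ζ) :
    trace (φ * ∑ r, ζ r • horizontalPart P D r) = trace (φ * ∑ i, ζ i • D i) := by
  have e : ∑ r, ζ r • horizontalPart P D r = P * (∑ i, ζ i • D i) * P := by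
    simp only [horizontalPart, smul_sum, smul_smul, Matrix.mul_sum, Matrix.sum_mul, smul_mul,
      mul_smul_comm]
    rw [sum_comm]
    refine sum_congr rfl fun i _ => ?_
    rw [← sum_smul]
    congr 1
    conv_rhs => rw [← hζ]
    exact sum_congr rfl fun r _ => mul_comm _ _
  rw [e, ← mul_assoc, trace_mul_comm, ← mul_assoc, ← mul_assoc, H.P_mul_φ, H.φ_mul_P]

variable {θ s ζ z : ι → A} {q : A} (K : HorizontalCovector P h k φ θ s ζ z q)

include K

/-- The horizontal Koszul formula: a horizontal tensor is determined by its action on the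
metric and its skew part. -/
theorem eq_gaugeTensor [Invertible (2 : A)] {C : ι → Matrix ι ι A} (hP : ∀ r, P * C r = C r)
    (hskew : ∀ r t l, C r l t - C t l r = 2 * (k * φ) r t * ζ l)
    (hmetric : ∀ r, (C r)ᵀ * k + k * C r = (2 * θ r) • k) (r : ι) :
    C r = gaugeTensor P k φ θ s ζ z r := by
  have ks : ∀ a b, k a b = k b a := fun a b => congrFun (congrFun H.k_symm b) a
  have ωs : ∀ a b, (k * φ) a b = -(k * φ) b a := fun a b => congrFun (congrFun H.skew b) a
  have hB : ∀ r, k * gaugeTensor P k φ θ s ζ z r = θ r • k + vecMulVec (k r) θ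
      - vecMulVec θ (k r) + vecMulVec z ((k * φ) r) + z r • (k * φ)
      - vecMulVec ((k * φ) r) z := by
    intro r
    have e1 : k *ᵥ Pᵀ r = k r := by
      ext a
      change (k * P) a r = _
      rw [H.k_mul_P, ks]
    have e2 : k *ᵥ φᵀ r = -(k * φ) r := by
      ext a
      exact ωs a r
    simp only [gaugeTensor, mul_add, mul_sub, mul_smul_comm, mul_vecMulVec, H.k_mul_P, e1, e2,
      K.k_s, K.k_ζ, neg_vecMulVec]
    abel
  -- `F a r b` is the lowered difference: symmetric in its outer, skew in its inner indices
  set F : ι → ι → ι → A := fun r a b => (k * C r) a b - (k * gaugeTensor P k φ θ s ζ z r) a b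
    with hF
  have F_symm : ∀ r a b, F r a b = F b a r := by
    intro r a b
    have h1 : (k * C r) a b - (k * C b) a r = 2 * (k * φ) r b * z a := by
      rw [Matrix.mul_apply, Matrix.mul_apply, ← sum_sub_distrib, ← K.k_ζ, mulVec, dotProduct,
        mul_sum]
      refine sum_congr rfl fun l _ => ?_
      rw [← mul_sub, hskew]
      ring
    have h2 : (k * gaugeTensor P k φ θ s ζ z r) a b - (k * gaugeTensor P k φ θ s ζ z b) a r
        = 2 * (k * φ) r b * z a := by
      simp only [hB, Matrix.add_apply, Matrix.sub_apply, Matrix.smul_apply, vecMulVec_apply,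
        smul_eq_mul]
      rw [ks b a, ks r a, ks b r, ωs b r, ωs a b, ωs a r]
      ring
    simp only [hF]
    linear_combination h1 - h2
  have F_skew : ∀ r a b, F r a b = -F r b a := by
    intro r a b
    have h1 : (k * C r) b a + (k * C r) a b = 2 * θ r * k a b := by
      have := congrFun (congrFun (hmetric r) a) b
      rw [show (C r)ᵀ * k = (k * C r)ᵀ by rw [transpose_mul, H.k_symm]] at this
      exact this
    have h2 : (k * gaugeTensor P k φ θ s ζ z r) b a + (k * gaugeTensor P k φ θ s ζ z r) a b
        = 2 * θ r * k a b := by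
      simp only [hB, Matrix.add_apply, Matrix.sub_apply, Matrix.smul_apply, vecMulVec_apply,
        smul_eq_mul]
      rw [ks b a, ωs b a]
      ring
    simp only [hF]
    linear_combination h1 - h2
  -- six applications permute the indices cyclically, ending at `F = -F`
  have F_zero : ∀ r a b, F r a b = 0 := by
    intro r a b
    refine eq_zero_of_two_mul_eq_zero ?_
    linear_combination F_symm r a b + F_skew b a r - F_symm b r a - F_skew a r b
      + F_symm a b r + F_skew r b a
  have e : k * C r = k * gaugeTensor P k φ θ s ζ z r := by
    ext a b
    exact sub_eq_zero.mp (F_zero r a b)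
  have hPB : P * gaugeTensor P k φ θ s ζ z r = gaugeTensor P k φ θ s ζ z r := by
    have e1 : P *ᵥ Pᵀ r = Pᵀ r := by
      ext a
      exact congrFun (congrFun H.P_mul_P a) r
    have e2 : P *ᵥ φᵀ r = φᵀ r := by
      ext a
      exact congrFun (congrFun H.P_mul_φ a) r
    simp only [gaugeTensor, mul_add, mul_sub, mul_smul_comm, mul_vecMulVec, H.P_mul_P, e1, e2,
      K.P_s, K.P_ζ, H.P_mul_φ]
  calc C r = h * (k * C r) := by rw [← mul_assoc, H.h_mul_k, hP]
    _ = _ := by rw [e, ← mul_assoc, H.h_mul_k, hPB]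

end ParaHermitian

/-! ### Paracontact metric structures and the canonical connection in components -/

section LeviCivita

variable {ι A : Type*} [Fintype ι] [CommRing A] [Invertible (2 : A)]

/-- The connection matrices `(Γ_i)^k_j = Γ^k_{ij}` of the Levi-Civita connection of the metric `g`
with inverse `gi`. -/
def leviCivita (δ : ι → Derivation ℤ A A) (g gi : Matrix ι ι A) (i : ι) : Matrix ι ι A :=
  Matrix.of fun k j => ⅟2 * ∑ l, gi k l * (δ i (g l j) + δ j (g i l) - δ l (g i j))

/-- The matrix `(∇ξ)^k_i = ∇_i ξ^k`. -/
def nablaVector (δ : ι → Derivation ℤ A A) (g gi : Matrix ι ι A) (ξ : ι → A) : Matrix ι ι A :=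
  Matrix.of fun k i => δ i (ξ k) + ∑ s, leviCivita δ g gi i k s * ξ s

/-- The matrix `(∇η)_{ij} = ∇_i η_j`. -/
def nablaForm (δ : ι → Derivation ℤ A A) (g gi : Matrix ι ι A) (η : ι → A) : Matrix ι ι A :=
  Matrix.of fun i j => δ i (η j) - ∑ s, leviCivita δ g gi i s j * η s

/-- The connection matrices of the canonical paracontact connection. -/
def canonicalMatrix (δ : ι → Derivation ℤ A A) (g gi φ : Matrix ι ι A) (ξ η : ι → A) (i : ι) :
    Matrix ι ι A :=
  leviCivita δ g gi i + η i • φ - vecMulVec ((nablaVector δ g gi ξ)ᵀ i) η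
    + vecMulVec ξ (nablaForm δ g gi η i)

variable {δ : ι → Derivation ℤ A A} {g gi : Matrix ι ι A}

theorem leviCivita_symm (hg : gᵀ = g) (i j k : ι) :
    leviCivita δ g gi i k j = leviCivita δ g gi j k i := by
  have gs : ∀ a b, g a b = g b a := fun a b => congrFun (congrFun hg b) a
  simp only [leviCivita, of_apply]
  congr 1
  refine sum_congr rfl fun l _ => ?_
  rw [gs l j, gs i l, gs i j]
  ring

/-- The Levi-Civita connection is metric. -/
theorem map_derivation_eq_leviCivita [DecidableEq ι] (hg : gᵀ = g) (h : g * gi = 1) (i : ι) :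
    g.map (δ i) = (leviCivita δ g gi i)ᵀ * g + g * leviCivita δ g gi i := by
  have gs : ∀ a b, g a b = g b a := fun a b => congrFun (congrFun hg b) a
  have e : ∀ l j, (g * leviCivita δ g gi i) l j
      = ⅟2 * (δ i (g l j) + δ j (g i l) - δ l (g i j)) := by
    intro l j
    have : ∀ k, g l k * leviCivita δ g gi i k j
        = ⅟2 * ∑ r, g l k * gi k r * (δ i (g r j) + δ j (g i r) - δ r (g i j)) := by
      intro k
      simp only [leviCivita, of_apply, mul_sum]
      exact sum_congr rfl fun _ _ => by ring
    rw [Matrix.mul_apply, sum_congr rfl fun k _ => this k, ← mul_sum, sum_comm]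
    congr 1
    have h2 : ∀ r, ∑ k, g l k * gi k r * (δ i (g r j) + δ j (g i r) - δ r (g i j))
        = (1 : Matrix ι ι A) l r * (δ i (g r j) + δ j (g i r) - δ r (g i j)) := by
      intro r
      rw [← sum_mul, ← h, Matrix.mul_apply]
    rw [sum_congr rfl fun r _ => h2 r]
    simp [one_apply]
  have e' : (leviCivita δ g gi i)ᵀ * g = (g * leviCivita δ g gi i)ᵀ := by
    rw [transpose_mul, hg]
  ext l j
  rw [e', Matrix.add_apply, transpose_apply, e, e, map_apply, gs i l, gs i j, gs j l]
  linear_combination -(δ i (g l j)) * invOf_mul_self (2 : A)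

end LeviCivita

/-- The components of a paracontact metric structure over a commutative ring with derivations
`δ i`, on a free module of rank `m + 1`. -/
structure ParacontactMatrix {ι A : Type*} [Fintype ι] [DecidableEq ι] [CommRing A]
    (δ : ι → Derivation ℤ A A) (m : A) (g gi φ : Matrix ι ι A) (ξ η : ι → A) : Prop where
  g_symm : gᵀ = g
  gi_mul_g : gi * g = 1
  φ_ξ : φ *ᵥ ξ = 0
  η_φ : η ᵥ* φ = 0
  η_ξ : η ⬝ᵥ ξ = 1
  φ_mul_φ : φ * φ = 1 - vecMulVec ξ η
  compatible : φᵀ * g * φ = -g + vecMulVec η η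
  contact : ∀ i j, 2 * (g * φ) i j = δ i (η j) - δ j (η i)
  card : (Fintype.card ι : A) = m + 1

/-- A metric connection preserving `ξ` and `η` whose torsion is
`T(X, Y) = 2 dη(X, Y) ξ + η(X) τ Y - η(Y) τ X`, with the properties of `τ` and `φ` that hold for
the canonical connection of a paracontact metric structure. -/
structure AdaptedConnection {ι A : Type*} [Fintype ι] [CommRing A]
    (δ : ι → Derivation ℤ A A) (g φ : Matrix ι ι A) (ξ η : ι → A) (G : ι → Matrix ι ι A)
    (τ : Matrix ι ι A) : Prop where
  parallel_g : ∀ i, g.map (δ i) = (G i)ᵀ * g + g * G i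
  parallel_ξ : ∀ i, δ i ∘ ξ = -(G i *ᵥ ξ)
  parallel_η : ∀ i, δ i ∘ η = η ᵥ* G i
  torsion_eq : ∀ k i j, torsion G k i j = 2 * (g * φ) i j * ξ k + η i * τ k j - η j * τ k i
  η_τ : η ᵥ* τ = 0

namespace ParacontactMatrix

variable {ι A : Type*} [Fintype ι] [DecidableEq ι] [CommRing A]
  {δ : ι → Derivation ℤ A A} {m : A} {g gi φ : Matrix ι ι A} {ξ η : ι → A}
  (S : ParacontactMatrix δ m g gi φ ξ η)

include S

theorem g_mul_gi : g * gi = 1 := mul_eq_one_comm.mp S.gi_mul_g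

theorem gi_symm : giᵀ = gi := by
  have h : giᵀ * g = 1 := by
    have := congrArg transpose S.g_mul_gi
    rwa [transpose_mul, S.g_symm, transpose_one] at this
  calc giᵀ = giᵀ * (g * gi) := by rw [S.g_mul_gi, mul_one]
    _ = gi := by rw [← mul_assoc, h, one_mul]

theorem g_ξ : g *ᵥ ξ = η := by
  have h : (φᵀ * g * φ) *ᵥ ξ = 0 := by rw [← mulVec_mulVec, S.φ_ξ, mulVec_zero]
  rw [S.compatible, add_mulVec, neg_mulVec, vecMulVec_mulVec, S.η_ξ] at h
  simpa using (neg_eq_of_add_eq_zero_right h).symm.symm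

theorem gi_η : gi *ᵥ η = ξ := by
  rw [← S.g_ξ, mulVec_mulVec, S.gi_mul_g, one_mulVec]

theorem ξ_g : ξ ᵥ* g = η := by rw [← mulVec_transpose, S.g_symm, S.g_ξ]

theorem η_gi : η ᵥ* gi = ξ := by rw [← mulVec_transpose, S.gi_symm, S.gi_η]

theorem ξ_η : ξ ⬝ᵥ η = 1 := by rw [dotProduct_comm, S.η_ξ]

theorem kφ : (g - vecMulVec η η) * φ = g * φ := by
  rw [sub_mul, vecMulVec_mul, S.η_φ, vecMulVec_zero, sub_zero]

variable [Invertible (2 : A)]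

theorem skew_apply (i j : ι) : (g * φ) j i = -(g * φ) i j := by
  have : 2 * ((g * φ) j i + (g * φ) i j) = 0 := by
    linear_combination S.contact i j + S.contact j i
  exact eq_neg_of_add_eq_zero_left (eq_zero_of_two_mul_eq_zero this)

theorem skew : (g * φ)ᵀ = -(g * φ) := by
  ext i j
  exact S.skew_apply i j

theorem φt_mul_g : φᵀ * g = -(g * φ) := by
  have := S.skew
  rwa [transpose_mul, S.g_symm] at this

theorem φ_mul_gi_skew : (φ * gi)ᵀ = -(φ * gi) := by
  have : gi * (φᵀ * g) * gi = gi * (-(g * φ)) * gi := by rw [S.φt_mul_g]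
  rw [mul_assoc, mul_assoc, S.g_mul_gi, mul_one, mul_neg, ← mul_assoc, S.gi_mul_g, one_mul,
    neg_mul] at this
  rw [transpose_mul, S.gi_symm, this]

theorem trace_φ : trace φ = 0 := by
  have h : trace (gi * (g * φ)) = -trace (gi * (g * φ)) := by
    conv_lhs => rw [← trace_transpose, transpose_mul, S.skew, S.gi_symm, trace_mul_comm]
    rw [mul_neg, trace_neg]
  rw [← mul_assoc, S.gi_mul_g, one_mul] at h
  exact eq_zero_of_two_mul_eq_zero (by linear_combination h)

/-- The horizontal part of a paracontact metric structure. -/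
theorem paraHermitian : ParaHermitian m (1 - vecMulVec ξ η) (gi - vecMulVec ξ ξ)
    (g - vecMulVec η η) φ where
  k_symm := by rw [transpose_sub, S.g_symm, transpose_vecMulVec]
  h_symm := by rw [transpose_sub, S.gi_symm, transpose_vecMulVec]
  h_mul_k := by
    simp only [sub_mul, mul_sub, S.gi_mul_g, mul_vecMulVec, vecMulVec_mul, S.gi_η, S.ξ_g,
      vecMulVec_mulVec, S.ξ_η]
    simp
  k_mul_P := by
    simp only [sub_mul, mul_sub, mul_one, mul_vecMulVec, S.g_ξ, vecMulVec_mulVec, S.η_ξ]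
    simp
  P_mul_h := by
    simp only [sub_mul, mul_sub, one_mul, vecMulVec_mul, S.η_gi, mul_vecMulVec, vecMulVec_mulVec,
      S.η_ξ]
    simp
  P_mul_φ := by rw [sub_mul, one_mul, vecMulVec_mul, S.η_φ, vecMulVec_zero, sub_zero]
  φ_mul_P := by rw [mul_sub, mul_one, mul_vecMulVec, S.φ_ξ, zero_vecMulVec, sub_zero]
  φ_mul_φ := S.φ_mul_φ
  skew := by rw [S.kφ, S.skew]
  trace_P := by
    rw [trace_sub, trace_one, trace_vecMulVec, S.ξ_η, S.card]
    ring
  trace_φ := S.trace_φ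

section NablaLemmas

theorem nablaForm_eq (i : ι) :
    nablaForm δ g gi η i = g *ᵥ (nablaVector δ g gi ξ)ᵀ i := by
  have h1 : nablaForm δ g gi η i = δ i ∘ η - η ᵥ* leviCivita δ g gi i := by
    ext j
    simp [nablaForm, vecMul, dotProduct, mul_comm]
  have h2 : (nablaVector δ g gi ξ)ᵀ i = δ i ∘ ξ + leviCivita δ g gi i *ᵥ ξ := by
    ext j
    simp [nablaVector, mulVec, dotProduct]
  have h3 : δ i ∘ η = g.map (δ i) *ᵥ ξ + g *ᵥ (δ i ∘ ξ) := by
    rw [← derivation_mulVec, S.g_ξ]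
  rw [h1, h2, h3, map_derivation_eq_leviCivita S.g_symm S.g_mul_gi, add_mulVec, mulVec_add,
    ← mulVec_mulVec, S.g_ξ, mulVec_transpose, mulVec_mulVec]
  abel

omit [DecidableEq ι] S in
theorem derivation_ξ (i : ι) :
    δ i ∘ ξ = (nablaVector δ g gi ξ)ᵀ i - leviCivita δ g gi i *ᵥ ξ := by
  ext j
  simp [nablaVector, mulVec, dotProduct]

omit [DecidableEq ι] S in
theorem derivation_η (i : ι) :
    δ i ∘ η = nablaForm δ g gi η i + η ᵥ* leviCivita δ g gi i := by
  ext j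
  simp [nablaForm, vecMul, dotProduct, mul_comm]

/-- `∇_i η_j - ∇_j η_i = 2 dη_{ij}`, since the Levi-Civita connection is torsion-free. -/
theorem nablaForm_skew (i j : ι) :
    nablaForm δ g gi η i j - nablaForm δ g gi η j i = 2 * (g * φ) i j := by
  rw [S.contact]
  simp only [nablaForm, of_apply]
  rw [sum_congr rfl fun s _ => by rw [leviCivita_symm S.g_symm i j s]]
  ring

theorem nablaVector_eq : nablaVector δ g gi ξ = gi * (nablaForm δ g gi η)ᵀ := by
  ext k i
  have : (gi *ᵥ nablaForm δ g gi η i) k = (nablaVector δ g gi ξ)ᵀ i k := by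
    rw [S.nablaForm_eq, mulVec_mulVec, S.gi_mul_g, one_mulVec]
  exact this.symm

theorem η_nablaVector (i : ι) : η ⬝ᵥ (nablaVector δ g gi ξ)ᵀ i = 0 := by
  have h0 : δ i (η ⬝ᵥ ξ) = 0 := by rw [S.η_ξ]; simp
  rw [derivation_dotProduct, derivation_η (gi := gi) (g := g), derivation_ξ (g := g) (gi := gi),
    add_dotProduct, dotProduct_sub, ← dotProduct_mulVec, S.nablaForm_eq] at h0
  have h1 : g *ᵥ (nablaVector δ g gi ξ)ᵀ i ⬝ᵥ ξ = η ⬝ᵥ (nablaVector δ g gi ξ)ᵀ i := by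
    rw [← vecMul_transpose, S.g_symm, ← dotProduct_mulVec, S.g_ξ, dotProduct_comm]
  exact eq_zero_of_two_mul_eq_zero (by linear_combination h0 - h1)

theorem nablaForm_ξ (i : ι) : nablaForm δ g gi η i ⬝ᵥ ξ = 0 := by
  rw [S.nablaForm_eq, ← vecMul_transpose, S.g_symm, ← dotProduct_mulVec, S.g_ξ, dotProduct_comm,
    S.η_nablaVector]

/-- The canonical connection is metric, preserves `ξ` and `η`, and has torsion
`2 dη ⊗ ξ + η ∧ (φ + ∇ξ)`. -/
theorem adaptedConnection : AdaptedConnection δ g φ ξ η (canonicalMatrix δ g gi φ ξ η)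
    (φ + nablaVector δ g gi ξ) where
  parallel_g i := by
    have h1 : (nablaVector δ g gi ξ)ᵀ i ᵥ* g = nablaForm δ g gi η i := by
      rw [S.nablaForm_eq, ← mulVec_transpose, S.g_symm]
    simp only [canonicalMatrix, transpose_add, transpose_sub, transpose_smul, transpose_vecMulVec,
      add_mul, sub_mul, mul_add, mul_sub, smul_mul, mul_smul_comm, vecMulVec_mul, mul_vecMulVec,
      S.ξ_g, S.g_ξ, h1, ← S.nablaForm_eq, S.φt_mul_g,
      map_derivation_eq_leviCivita S.g_symm S.g_mul_gi]
    simp only [smul_neg]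
    abel
  parallel_ξ i := by
    simp only [canonicalMatrix, add_mulVec, sub_mulVec, smul_mulVec, S.φ_ξ, vecMulVec_mulVec,
      S.η_ξ, S.nablaForm_ξ, derivation_ξ (g := g) (gi := gi)]
    simp
  parallel_η i := by
    simp only [canonicalMatrix, vecMul_add, vecMul_sub, vecMul_smul, S.η_φ, vecMul_vecMulVec,
      S.η_nablaVector, S.η_ξ, derivation_η (g := g) (gi := gi)]
    simp [add_comm]
  torsion_eq k i j := by
    simp only [torsion, canonicalMatrix, Matrix.add_apply, Matrix.sub_apply, Matrix.smul_apply,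
      vecMulVec_apply, smul_eq_mul, transpose_apply, leviCivita_symm S.g_symm i j k]
    linear_combination ξ k * S.nablaForm_skew (gi := gi) i j
  η_τ := by
    rw [vecMul_add, S.η_φ, zero_add]
    ext i
    exact S.η_nablaVector i

/-- The torsion tensor `τ = φ + ∇ξ` satisfies `tr(φ τ) = 0`. In `tr(φ ∇ξ)` only the skew part
`dη` of `∇η` contributes, so that this trace is `-tr(φ²)`. -/
theorem trace_φ_mul_τ : trace (φ * (φ + nablaVector δ g gi ξ)) = 0 := by
  have hM : nablaForm δ g gi η - (nablaForm δ g gi η)ᵀ = (2 : A) • (g * φ) := by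
    ext i j
    exact S.nablaForm_skew i j
  have h1 : trace (φ * gi * (nablaForm δ g gi η)ᵀ) = -trace (φ * gi * nablaForm δ g gi η) := by
    rw [← trace_transpose, transpose_mul, transpose_transpose, S.φ_mul_gi_skew, mul_neg,
      trace_neg, trace_mul_comm]
  have h2 : trace (φ * gi * nablaForm δ g gi η) - trace (φ * gi * (nablaForm δ g gi η)ᵀ)
      = 2 * trace (φ * φ) := by
    rw [← trace_sub, ← mul_sub, hM, mul_smul_comm, trace_smul, mul_assoc, ← mul_assoc gi,
      S.gi_mul_g, one_mul, smul_eq_mul]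
  rw [mul_add, trace_add, S.nablaVector_eq, ← mul_assoc]
  exact eq_zero_of_two_mul_eq_zero (by linear_combination h1 - h2)

end NablaLemmas

end ParacontactMatrix

/-! ### Divergence identities from `d(dη) = 0` -/

namespace ParacontactMatrix

variable {ι A : Type*} [Fintype ι] [DecidableEq ι] [CommRing A]
  {δ : ι → Derivation ℤ A A} {m : A} {g gi φ : Matrix ι ι A} {ξ η : ι → A}
  (S : ParacontactMatrix δ m g gi φ ξ η) {G : ι → Matrix ι ι A} {τ : Matrix ι ι A}

omit [Fintype ι] in
theorem map_derivation_one (d : Derivation ℤ A A) : (1 : Matrix ι ι A).map d = 0 := by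
  ext i j
  by_cases h : i = j <;> simp [one_apply, h]

theorem parallel_P (C : AdaptedConnection δ g φ ξ η G τ) (i : ι) :
    (1 - vecMulVec ξ η).map (δ i) = (1 - vecMulVec ξ η) * G i - G i * (1 - vecMulVec ξ η) := by
  rw [map_derivation_sub, map_derivation_one, map_derivation_vecMulVec, C.parallel_ξ, C.parallel_η,
    neg_vecMulVec, sub_mul, mul_sub, vecMulVec_mul, mul_vecMulVec, one_mul, mul_one]
  abel

include S

theorem parallel_h (C : AdaptedConnection δ g φ ξ η G τ) (i : ι) :
    (gi - vecMulVec ξ ξ).map (δ i)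
      = -(G i * (gi - vecMulVec ξ ξ) + (gi - vecMulVec ξ ξ) * (G i)ᵀ) := by
  rw [map_derivation_sub, map_derivation_inv (δ i) S.gi_mul_g S.g_mul_gi, C.parallel_g, mul_add,
    add_mul, map_derivation_vecMulVec, C.parallel_ξ, mul_sub, sub_mul, mul_vecMulVec,
    vecMulVec_mul, vecMul_transpose, neg_vecMulVec, vecMulVec_neg, ← mul_assoc gi g, S.gi_mul_g,
    one_mul, mul_assoc gi, mul_assoc (G i)ᵀ, S.g_mul_gi, mul_one]
  abel

omit S in
/-- As `ξ` and `η` are parallel, the curvature of an adapted connection is horizontal in its matrix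
indices. -/
theorem curv_mul_gi (hδ : ∀ i j a, δ i (δ j a) = δ j (δ i a))
    (C : AdaptedConnection δ g φ ξ η G τ) (i j : ι) :
    curv δ G i j * gi = (1 - vecMulVec ξ η) * curv δ G i j * (gi - vecMulVec ξ ξ) := by
  rw [sub_mul, one_mul, vecMulVec_mul, vecMul_curv_eq_zero hδ C.parallel_η, vecMulVec_zero,
    sub_zero, mul_sub, mul_vecMulVec, curv_mulVec_eq_zero hδ C.parallel_ξ, zero_vecMulVec, sub_zero]

theorem gi_mul_Pt_mul_g : gi * (1 - vecMulVec ξ η)ᵀ * g = 1 - vecMulVec ξ η := by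
  rw [transpose_sub, transpose_one, transpose_vecMulVec, mul_sub, sub_mul, mul_one, S.gi_mul_g,
    mul_vecMulVec, S.gi_η, vecMulVec_mul, S.ξ_g]

variable [Invertible (2 : A)]

/-- The horizontal trace of `φ ∇φ` vanishes, because `φ² = P` is parallel. -/
theorem trace_φ_mul_nabla_φ (C : AdaptedConnection δ g φ ξ η G τ) (k : ι) :
    trace (φ * (φ.map (δ k) + G k * φ - φ * G k)) = 0 := by
  have h : (φ.map (δ k) + G k * φ - φ * G k) * φ + φ * (φ.map (δ k) + G k * φ - φ * G k) = 0 := by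
    have := parallel_P C k
    rw [← S.φ_mul_φ, map_derivation_mul] at this
    have e : (φ.map (δ k) + G k * φ - φ * G k) * φ + φ * (φ.map (δ k) + G k * φ - φ * G k)
        = (φ.map (δ k) * φ + φ * φ.map (δ k)) - (φ * φ * G k - G k * (φ * φ)) := by
      noncomm_ring
    rw [e, this, sub_self]
  have h2 := congrArg trace h
  rw [trace_add, trace_mul_comm, trace_zero] at h2
  exact eq_zero_of_two_mul_eq_zero (by linear_combination h2)

/-- The cyclic sum of the covariant derivative of `ω = dη` with respect to a connection with
torsion, from `dω = 0`. -/
theorem cyclic_sum_nabla_ω (hδ : ∀ i j a, δ i (δ j a) = δ j (δ i a))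
    (C : AdaptedConnection δ g φ ξ η G τ) (i j k : ι) :
    (g * (φ.map (δ i) + G i * φ - φ * G i)) j k + (g * (φ.map (δ j) + G j * φ - φ * G j)) k i
      + (g * (φ.map (δ k) + G k * φ - φ * G k)) i j
      = -(η i * (τᵀ * (g * φ)) j k - η j * (τᵀ * (g * φ)) i k
        + (η j * (τᵀ * (g * φ)) k i - η k * (τᵀ * (g * φ)) j i)
        + (η k * (τᵀ * (g * φ)) i j - η i * (τᵀ * (g * φ)) k j)) := by
  have hΩ : ∀ i j k, (g * (φ.map (δ i) + G i * φ - φ * G i)) j k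
      = δ i ((g * φ) j k) - ∑ s, G i s j * (g * φ) s k + ∑ s, G i s k * (g * φ) s j := by
    intro i j k
    have e : g * (φ.map (δ i) + G i * φ - φ * G i)
        = (g * φ).map (δ i) - (G i)ᵀ * (g * φ) - (g * φ) * G i := by
      rw [map_derivation_mul, C.parallel_g]
      noncomm_ring
    rw [e, Matrix.sub_apply, Matrix.sub_apply, Matrix.mul_apply, Matrix.mul_apply, sub_eq_add_neg,
      ← sum_neg_distrib]
    congr 1
    refine sum_congr rfl fun s _ => ?_
    rw [S.skew_apply s j]
    ring
  have hd : ∀ i j k, 2 * δ i ((g * φ) j k) = δ i (δ j (η k)) - δ i (δ k (η j)) := by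
    intro i j k
    rw [← map_sub, ← S.contact, two_mul, two_mul, map_add]
  have hT : ∀ i j k, ∑ s, G i s j * (g * φ) s k - ∑ s, G j s i * (g * φ) s k
      = η i * (τᵀ * (g * φ)) j k - η j * (τᵀ * (g * φ)) i k := by
    intro i j k
    have e : ∀ s, G i s j * (g * φ) s k - G j s i * (g * φ) s k
        = 2 * (g * φ) i j * (ξ s * (g * φ) s k) + η i * (τᵀ j s * (g * φ) s k)
          - η j * (τᵀ i s * (g * φ) s k) := by
      intro s
      have := C.torsion_eq s i j
      simp only [torsion] at this
      rw [transpose_apply, transpose_apply]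
      linear_combination (g * φ) s k * this
    have hξ : ∑ s, ξ s * (g * φ) s k = 0 := by
      have : (ξ ᵥ* (g * φ)) k = 0 := by rw [← vecMul_vecMul, S.ξ_g, S.η_φ, Pi.zero_apply]
      exact this
    rw [← sum_sub_distrib, sum_congr rfl fun s _ => e s, sum_sub_distrib, sum_add_distrib,
      ← mul_sum, ← mul_sum, ← mul_sum, hξ, mul_zero, zero_add]
    rfl
  have hc : δ i ((g * φ) j k) + δ j ((g * φ) k i) + δ k ((g * φ) i j) = 0 := by
    refine eq_zero_of_two_mul_eq_zero ?_
    linear_combination hd i j k + hd j k i + hd k i j + hδ i j (η k) + hδ j k (η i) + hδ k i (η j)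
  rw [hΩ, hΩ, hΩ]
  linear_combination hc - hT i j k - hT j k i - hT k i j

/-- The divergence of `φ` with respect to an adapted connection is vertical: contract the cyclic sum
of `∇ω` with the skew tensor `χ = φ g⁻¹`. Its first two terms both give the divergence, the third one
vanishes, and of the torsion terms only the trace of `τ` survives, because `χ` annihilates `η`. -/
theorem sum_φ_mul_nabla_φ_eq (hδ : ∀ i j a, δ i (δ j a) = δ j (δ i a))
    (C : AdaptedConnection δ g φ ξ η G τ) (k : ι) :
    ∑ i, (φ * (φ.map (δ i) + G i * φ - φ * G i)) i k
      = η k * trace (τ * (1 - vecMulVec ξ η)) := by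
  set X : ι → Matrix ι ι A := fun i => φ.map (δ i) + G i * φ - φ * G i with hX
  set Q := τᵀ * (g * φ) with hQ
  set χ := φ * gi with hχ
  have χs : ∀ i j, χ i j = -χ j i := fun i j => congrFun (congrFun S.φ_mul_gi_skew j) i
  have χg : χ * g = φ := by rw [hχ, mul_assoc, S.gi_mul_g, mul_one]
  have Xs : ∀ i, (g * X i)ᵀ = -(g * X i) := by
    intro i
    have e : g * X i = (g * φ).map (δ i) - (G i)ᵀ * (g * φ) - (g * φ) * G i := by
      rw [map_derivation_mul, C.parallel_g, hX]
      noncomm_ring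
    have e2 : ((g * φ).map (δ i))ᵀ = -(g * φ).map (δ i) := by
      rw [← map_derivation_transpose, S.skew]
      ext a b
      simp
    rw [e, transpose_sub, transpose_sub, transpose_mul (G i)ᵀ, transpose_mul (g * φ) (G i), e2,
      S.skew, transpose_transpose]
    noncomm_ring
  have t1 : ∑ i, ∑ j, χ i j * (g * X i) j k = ∑ i, (φ * X i) i k := by
    refine sum_congr rfl fun i _ => ?_
    rw [← χg, mul_assoc]
    rfl
  have t2 : ∑ i, ∑ j, χ i j * (g * X j) k i = ∑ i, (φ * X i) i k := by
    rw [← t1, sum_comm]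
    refine sum_congr rfl fun i _ => sum_congr rfl fun j _ => ?_
    rw [χs j i, show (g * X i) k j = -(g * X i) j k from congrFun (congrFun (Xs i) j) k]
    ring
  have t3 : ∑ i, ∑ j, χ i j * (g * X k) i j = 0 := by
    have : trace (χ * (g * X k)ᵀ) = 0 := by
      rw [Xs, mul_neg, ← mul_assoc, χg, trace_neg, S.trace_φ_mul_nabla_φ C, neg_zero]
    exact this
  have ηχ : ∀ j, ∑ i, χ i j * η i = 0 := by
    intro j
    have : (η ᵥ* χ) j = 0 := by rw [hχ, ← vecMul_vecMul, S.η_φ, zero_vecMul, Pi.zero_apply]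
    rw [← this]
    exact sum_congr rfl fun i _ => mul_comm _ _
  have χη : ∀ i, ∑ j, χ i j * η j = 0 := by
    intro i
    have : (χ *ᵥ η) i = 0 := by rw [hχ, ← mulVec_mulVec, S.gi_η, S.φ_ξ, Pi.zero_apply]
    exact this
  have z1 : ∀ f : ι → A, ∑ i, ∑ j, χ i j * (η i * f j) = 0 := by
    intro f
    rw [sum_comm]
    refine sum_eq_zero fun j _ => ?_
    rw [sum_congr rfl fun i _ => (mul_assoc (χ i j) (η i) (f j)).symm, ← sum_mul, ηχ, zero_mul]
  have z2 : ∀ f : ι → A, ∑ i, ∑ j, χ i j * (η j * f i) = 0 := by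
    intro f
    refine sum_eq_zero fun i _ => ?_
    rw [sum_congr rfl fun j _ => (mul_assoc (χ i j) (η j) (f i)).symm, ← sum_mul, χη, zero_mul]
  have tQ : ∑ i, ∑ j, χ i j * Q j i = trace (τ * (1 - vecMulVec ξ η)) := by
    have : trace (χ * Q) = trace (τ * (1 - vecMulVec ξ η)) := by
      have e : χ * Q = φ * (gi * τᵀ * g * φ) := by rw [hχ, hQ]; noncomm_ring
      rw [e, trace_mul_comm, mul_assoc, S.φ_mul_φ, ← trace_transpose]
      simp only [transpose_mul, transpose_transpose, S.g_symm, S.gi_symm]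
      rw [← mul_assoc, ← mul_assoc, trace_mul_comm, ← mul_assoc, ← mul_assoc, trace_mul_comm,
        S.gi_mul_Pt_mul_g]
    exact this
  have tQ' : ∑ i, ∑ j, χ i j * Q i j = -trace (τ * (1 - vecMulVec ξ η)) := by
    rw [← tQ, sum_comm, ← sum_neg_distrib]
    refine sum_congr rfl fun i _ => ?_
    rw [← sum_neg_distrib]
    refine sum_congr rfl fun j _ => ?_
    rw [χs j i]
    ring
  have key : ∑ i, ∑ j, χ i j * ((g * X i) j k + (g * X j) k i + (g * X k) i j)
      = ∑ i, ∑ j, χ i j * -(η i * Q j k - η j * Q i k + (η j * Q k i - η k * Q j i)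
        + (η k * Q i j - η i * Q k j)) :=
    sum_congr rfl fun i _ => sum_congr rfl fun j _ =>
      congrArg (χ i j * ·) (S.cyclic_sum_nabla_ω hδ C i j k)
  have rhs : ∀ i j, χ i j * -(η i * Q j k - η j * Q i k + (η j * Q k i - η k * Q j i)
        + (η k * Q i j - η i * Q k j))
      = χ i j * (η i * (Q k j - Q j k)) + χ i j * (η j * (Q i k - Q k i))
        + η k * (χ i j * Q j i) - η k * (χ i j * Q i j) := by
    intro i j
    ring
  simp only [rhs, mul_add, sum_add_distrib, sum_sub_distrib, ← mul_sum, t1, t2, t3, tQ, tQ'] at key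
  rw [z1 (fun j => Q k j - Q j k), z2 (fun i => Q i k - Q k i)] at key
  rw [← sub_eq_zero]
  exact eq_zero_of_two_mul_eq_zero (by linear_combination key)

/-- The horizontal trace of `τ` vanishes: the divergence of `φ` is `tr(τ P) η`, while its value on
`ξ` is zero because `φ ξ = 0` and `ξ` is parallel. -/
theorem trace_τ_mul_P (hδ : ∀ i j a, δ i (δ j a) = δ j (δ i a))
    (C : AdaptedConnection δ g φ ξ η G τ) : trace (τ * (1 - vecMulVec ξ η)) = 0 := by
  have h : ∀ i, (φ.map (δ i) + G i * φ - φ * G i) *ᵥ ξ = 0 := by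
    intro i
    have : δ i ∘ (φ *ᵥ ξ) = φ.map (δ i) *ᵥ ξ + φ *ᵥ (δ i ∘ ξ) := derivation_mulVec _ _ _
    rw [S.φ_ξ, C.parallel_ξ] at this
    have z : δ i ∘ (0 : ι → A) = 0 := by ext; simp
    rw [z, mulVec_neg, mulVec_mulVec] at this
    rw [sub_mulVec, add_mulVec, ← mulVec_mulVec _ (G i) φ, S.φ_ξ, mulVec_zero, add_zero]
    rw [sub_eq_add_neg, ← this]
  have e : ∑ k, (∑ i, (φ * (φ.map (δ i) + G i * φ - φ * G i)) i k) * ξ k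
      = ∑ i, ((φ * (φ.map (δ i) + G i * φ - φ * G i)) *ᵥ ξ) i := by
    simp only [sum_mul]
    rw [sum_comm]
    rfl
  simp only [← mulVec_mulVec, h, mulVec_zero, Pi.zero_apply, sum_const_zero,
    S.sum_φ_mul_nabla_φ_eq hδ C] at e
  have e2 : ∀ k, η k * trace (τ * (1 - vecMulVec ξ η)) * ξ k
      = η k * ξ k * trace (τ * (1 - vecMulVec ξ η)) := fun k => by ring
  rw [sum_congr rfl fun k _ => e2 k, ← sum_mul] at e
  have e3 : ∑ k, η k * ξ k = 1 := S.η_ξ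
  rw [e3, one_mul] at e
  exact e

/-- The divergence of `φ` with respect to an adapted connection, composed with `φ`, vanishes. -/
theorem sum_φ_mul_nabla_φ (hδ : ∀ i j a, δ i (δ j a) = δ j (δ i a))
    (C : AdaptedConnection δ g φ ξ η G τ) (k : ι) :
    ∑ i, (φ * (φ.map (δ i) + G i * φ - φ * G i)) i k = 0 := by
  rw [S.sum_φ_mul_nabla_φ_eq hδ C, S.trace_τ_mul_P hδ C, mul_zero]

/-- The horizontal trace of `∇η` vanishes: it is the horizontal trace of `τ - φ`. -/
theorem sum_h_mul_nablaForm (hδ : ∀ i j a, δ i (δ j a) = δ j (δ i a)) :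
    ∑ i, ∑ j, (gi - vecMulVec ξ ξ) i j * nablaForm δ g gi η i j = 0 := by
  have h1 := S.trace_τ_mul_P hδ S.adaptedConnection
  have e : trace ((gi - vecMulVec ξ ξ) * (nablaForm δ g gi η)ᵀ) = 0 := by
    rw [sub_mul, trace_sub, ← S.nablaVector_eq, trace_vecMulVec_mul, mulVec_transpose]
    rw [mul_sub, mul_one, trace_sub, trace_mul_vecMulVec, dotProduct_mulVec,
      S.adaptedConnection.η_τ, zero_dotProduct, trace_add, S.trace_φ] at h1
    have h2 : ξ ⬝ᵥ ξ ᵥ* nablaForm δ g gi η = 0 := by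
      rw [dotProduct_comm, ← dotProduct_mulVec]
      have : nablaForm δ g gi η *ᵥ ξ = 0 := funext fun i => S.nablaForm_ξ i
      rw [this, dotProduct_zero]
    rw [h2]
    linear_combination h1
  exact e

/-- The horizontal Laplacian can be computed with the canonical connection. -/
theorem sum_h_mul_canonicalMatrix (hδ : ∀ i j a, δ i (δ j a) = δ j (δ i a)) (s : ι) :
    ∑ i, ∑ j, (gi - vecMulVec ξ ξ) i j * canonicalMatrix δ g gi φ ξ η i s j
      = ∑ i, ∑ j, (gi - vecMulVec ξ ξ) i j * leviCivita δ g gi i s j := by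
  have hη : ∀ i, ∑ j, (gi - vecMulVec ξ ξ) i j * η j = 0 := by
    intro i
    have : ((gi - vecMulVec ξ ξ) *ᵥ η) i = 0 := by
      rw [sub_mulVec, S.gi_η, vecMulVec_mulVec, S.ξ_η]
      simp
    exact this
  have ηh : ∀ j, ∑ i, (gi - vecMulVec ξ ξ) i j * η i = 0 := by
    intro j
    rw [← hη j]
    exact sum_congr rfl fun i _ => by
      rw [show (gi - vecMulVec ξ ξ) i j = (gi - vecMulVec ξ ξ) j i from
        congrFun (congrFun S.paraHermitian.h_symm j) i]
  have e : ∀ i j, (gi - vecMulVec ξ ξ) i j * canonicalMatrix δ g gi φ ξ η i s j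
      = (gi - vecMulVec ξ ξ) i j * leviCivita δ g gi i s j
        + (gi - vecMulVec ξ ξ) i j * η i * φ s j
        - (gi - vecMulVec ξ ξ) i j * η j * nablaVector δ g gi ξ s i
        + ξ s * ((gi - vecMulVec ξ ξ) i j * nablaForm δ g gi η i j) := by
    intro i j
    have : canonicalMatrix δ g gi φ ξ η i s j = leviCivita δ g gi i s j + η i * φ s j
        - nablaVector δ g gi ξ s i * η j + ξ s * nablaForm δ g gi η i j := rfl
    rw [this]
    ring
  have z1 : ∑ i, ∑ j, (gi - vecMulVec ξ ξ) i j * η i * φ s j = 0 := by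
    rw [sum_comm]
    exact sum_eq_zero fun j _ => by rw [← sum_mul, ηh, zero_mul]
  have z2 : ∑ i, ∑ j, (gi - vecMulVec ξ ξ) i j * η j * nablaVector δ g gi ξ s i = 0 :=
    sum_eq_zero fun i _ => by rw [← sum_mul, hη, zero_mul]
  simp only [e, sum_add_distrib, sum_sub_distrib, ← mul_sum]
  rw [z1, z2, S.sum_h_mul_nablaForm hδ]
  ring

end ParacontactMatrix

/-! ### The difference of two canonical connections -/

/-- Two paracontact metric structures in components related by the gauge transformation
`η' = σ η`, with the transformation rules for the other tensors; `si` is the inverse of `σ`,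
`θ` is the horizontal part of `dσ / (2σ)`, `s = θ♯`, `ζ = -φ θ♯`, `z = ζ♭`, `q = |θ|²`. -/
structure GaugeMatrix {ι A : Type*} [Fintype ι] [DecidableEq ι] [CommRing A] [Invertible (2 : A)]
    (δ : ι → Derivation ℤ A A) (m : A) (g gi φ : Matrix ι ι A) (ξ η : ι → A)
    (g' gi' φ' : Matrix ι ι A) (ξ' η' : ι → A) (σ si : A) (θ s ζ z : ι → A) (q : A) : Prop where
  fst : ParacontactMatrix δ m g gi φ ξ η
  snd : ParacontactMatrix δ m g' gi' φ' ξ' η'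
  commute : ∀ i j a, δ i (δ j a) = δ j (δ i a)
  σ_mul_si : σ * si = 1
  θ_eq : θ = (⅟2 * si) • ((fun i => δ i σ) ᵥ* (1 - vecMulVec ξ η))
  covector : HorizontalCovector (1 - vecMulVec ξ η) (gi - vecMulVec ξ ξ) (g - vecMulVec η η) φ
    θ s ζ z q
  η_eq : η' = σ • η
  ξ_eq : σ • ξ' = ξ + ζ
  φ_eq : φ' = φ + vecMulVec s η
  g_eq : g' = σ • (g - vecMulVec η z - vecMulVec z η)
    + (σ * (σ - 1 + z ⬝ᵥ ζ)) • vecMulVec η η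

namespace GaugeMatrix

variable {ι A : Type*} [Fintype ι] [DecidableEq ι] [CommRing A] [Invertible (2 : A)]
  {δ : ι → Derivation ℤ A A} {m : A} {g gi φ : Matrix ι ι A} {ξ η : ι → A}
  {g' gi' φ' : Matrix ι ι A} {ξ' η' : ι → A} {σ si : A} {θ s ζ z : ι → A} {q : A}
  (T : GaugeMatrix δ m g gi φ ξ η g' gi' φ' ξ' η' σ si θ s ζ z q)

include T

theorem η_h : η ᵥ* (gi - vecMulVec ξ ξ) = 0 := by
  rw [vecMul_sub, T.fst.η_gi, vecMul_vecMulVec, T.fst.η_ξ, one_smul, sub_self]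

theorem h_η : (gi - vecMulVec ξ ξ) *ᵥ η = 0 := by
  rw [sub_mulVec, T.fst.gi_η, vecMulVec_mulVec, T.fst.ξ_η]
  simp

theorem η_P : η ᵥ* (1 - vecMulVec ξ η) = 0 := by
  rw [vecMul_sub, vecMul_one, vecMul_vecMulVec, T.fst.η_ξ, one_smul, sub_self]

theorem Pt_η : (1 - vecMulVec ξ η)ᵀ *ᵥ η = 0 := by rw [mulVec_transpose, T.η_P]

theorem si_mul_σ : si * σ = 1 := by rw [mul_comm, T.σ_mul_si]

theorem η_s : η ⬝ᵥ s = 0 := by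
  rw [← T.covector.P_s, dotProduct_mulVec, T.η_P, zero_dotProduct]

theorem η_ζ : η ⬝ᵥ ζ = 0 := by
  rw [← T.covector.P_ζ, dotProduct_mulVec, T.η_P, zero_dotProduct]

theorem φ_ξ' : φ *ᵥ ξ' = -(si • s) := by
  have h := congrArg (fun v => si • (φ *ᵥ v)) T.ξ_eq
  simp only [mulVec_smul, smul_smul, T.si_mul_σ, one_smul, mulVec_add, T.fst.φ_ξ,
    T.covector.φ_ζ, zero_add, smul_neg] at h
  exact h

theorem dσ_P : (fun i => δ i σ) ᵥ* (1 - vecMulVec ξ η) = (2 * σ) • θ := by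
  rw [T.θ_eq, smul_smul]
  have : 2 * σ * (⅟2 * si) = 1 := by
    linear_combination T.σ_mul_si + σ * si * mul_invOf_self (2 : A)
  rw [this, one_smul]

theorem dσ_s : (fun i => δ i σ) ⬝ᵥ s = 2 * σ * q := by
  rw [← T.covector.P_s, dotProduct_mulVec, T.dσ_P, smul_dotProduct, T.covector.θ_s, smul_eq_mul]

/-- The inverse of the transformed metric. -/
theorem gi'_eq : gi' = si • (gi - vecMulVec ξ ξ) + vecMulVec ξ' ξ' := by
  have hg : (gi - vecMulVec ξ ξ) * g = 1 - vecMulVec ξ η := by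
    rw [sub_mul, T.fst.gi_mul_g, vecMulVec_mul, T.fst.ξ_g]
  have h : (si • (gi - vecMulVec ξ ξ) + vecMulVec ξ' ξ') * g' = 1 := by
    rw [add_mul, vecMulVec_mul, T.snd.ξ_g, T.η_eq, vecMulVec_smul, ← smul_vecMulVec, T.ξ_eq, T.g_eq,
      mul_add, mul_smul_comm, mul_smul_comm, mul_sub, mul_sub, smul_mul, smul_mul, smul_mul,
      smul_mul,
      hg, mul_vecMulVec, mul_vecMulVec, mul_vecMulVec, T.h_η, T.covector.h_z, smul_sub, smul_sub,
      smul_smul, smul_smul, smul_smul, T.σ_mul_si, add_vecMulVec]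
    simp
  calc gi' = (si • (gi - vecMulVec ξ ξ) + vecMulVec ξ' ξ') * (g' * gi') := by
        rw [← mul_assoc, h, one_mul]
    _ = _ := by rw [T.snd.g_mul_gi, mul_one]

/-- The transformed metric is `σ` times the old one on the horizontal distribution. -/
theorem Pt_g'_P : (1 - vecMulVec ξ η)ᵀ * g' * (1 - vecMulVec ξ η) = σ • (g - vecMulVec η η) := by
  have hk : (1 - vecMulVec ξ η)ᵀ * g * (1 - vecMulVec ξ η) = g - vecMulVec η η := by
    have h := T.fst.paraHermitian.Pt_mul_k
    have h' := T.fst.paraHermitian.k_mul_P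
    rw [mul_sub, mul_vecMulVec, T.Pt_η, zero_vecMulVec, sub_zero] at h
    rw [h, h']
  have a1 : ∀ v : ι → A, (1 - vecMulVec ξ η)ᵀ * vecMulVec η v * (1 - vecMulVec ξ η) = 0 := by
    intro v
    rw [mul_vecMulVec, T.Pt_η, zero_vecMulVec, zero_mul]
  have a2 : ∀ v : ι → A, (1 - vecMulVec ξ η)ᵀ * vecMulVec v η * (1 - vecMulVec ξ η) = 0 := by
    intro v
    rw [mul_assoc, vecMulVec_mul, T.η_P, vecMulVec_zero, mul_zero]
  rw [T.g_eq]
  obtain ⟨P, hP⟩ : ∃ P, P = 1 - vecMulVec ξ η := ⟨_, rfl⟩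
  rw [← hP] at a1 a2 hk ⊢
  simp only [mul_add, add_mul, mul_sub, sub_mul, mul_smul_comm, smul_mul, a1, a2, hk]
  simp

/-- `dη' = σ dη` on horizontal vectors. -/
theorem Pt_ω'_P : (1 - vecMulVec ξ η)ᵀ * (g' * φ') * (1 - vecMulVec ξ η) = σ • (g * φ) := by
  have h : g' * φ' = σ • (g * φ)
      + (⅟2 : A) • (vecMulVec (fun i => δ i σ) η - vecMulVec η (fun i => δ i σ)) := by
    ext i j
    have h1 := T.snd.contact i j
    have h2 := T.fst.contact i j
    rw [T.η_eq] at h1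
    simp only [Pi.smul_apply, smul_eq_mul, Derivation.leibniz] at h1
    simp only [Matrix.add_apply, Matrix.smul_apply, Matrix.sub_apply, vecMulVec_apply, smul_eq_mul]
    linear_combination ⅟2 * h1 - ⅟2 * σ * h2
      + (σ * (g * φ) i j - (g' * φ') i j) * invOf_mul_self (2 : A)
  have hω : (1 - vecMulVec ξ η)ᵀ * (g * φ) * (1 - vecMulVec ξ η) = g * φ := by
    have h' := T.fst.paraHermitian.Pt_mul_k
    rw [mul_assoc, mul_assoc, T.fst.paraHermitian.φ_mul_P, ← T.fst.kφ, ← mul_assoc, h']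
  have a1 : ∀ v : ι → A, (1 - vecMulVec ξ η)ᵀ * vecMulVec η v * (1 - vecMulVec ξ η) = 0 := by
    intro v
    rw [mul_vecMulVec, T.Pt_η, zero_vecMulVec, zero_mul]
  have a2 : ∀ v : ι → A, (1 - vecMulVec ξ η)ᵀ * vecMulVec v η * (1 - vecMulVec ξ η) = 0 := by
    intro v
    rw [mul_assoc, vecMulVec_mul, T.η_P, vecMulVec_zero, mul_zero]
  rw [h]
  obtain ⟨P, hP⟩ : ∃ P, P = 1 - vecMulVec ξ η := ⟨_, rfl⟩
  rw [← hP] at a1 a2 hω ⊢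
  simp only [mul_add, add_mul, mul_sub, sub_mul, mul_smul_comm, smul_mul, a1, a2, hω]
  simp

section Connections

variable {G G' : ι → Matrix ι ι A} {τ τ' : Matrix ι ι A}
  (C : AdaptedConnection δ g φ ξ η G τ) (C' : AdaptedConnection δ g' φ' ξ' η' G' τ')

include C C'

/-- `η` is parallel for the first connection and `σ η` for the second one. -/
theorem η_mul_sub (i : ι) : η ᵥ* (G' - G) i = (si * δ i σ) • η := by
  have h := C'.parallel_η i
  rw [T.η_eq, derivation_smul_vec, C.parallel_η, smul_vecMul] at h
  have h2 := congrArg (si • ·) h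
  simp only [smul_add, smul_smul, T.si_mul_σ, one_smul] at h2
  rw [Pi.sub_apply, vecMul_sub, ← h2]
  abel

theorem η_mul_sub_mul_h (i : ι) : η ᵥ* ((G' - G) i * (gi - vecMulVec ξ ξ)) = 0 := by
  rw [← vecMul_vecMul, T.η_mul_sub C C', smul_vecMul, T.η_h, smul_zero]

theorem P_mul_sub_mul_P (i : ι) : (1 - vecMulVec ξ η) * ((G' - G) i * (1 - vecMulVec ξ η))
    = (G' - G) i * (1 - vecMulVec ξ η) := by
  rw [sub_mul 1, one_mul, vecMulVec_mul, ← vecMul_vecMul, T.η_mul_sub C C', smul_vecMul, T.η_P,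
    smul_zero, vecMulVec_zero, sub_zero]

/-- The horizontal part of the difference acts on the horizontal metric `k` as a scaling, because `k`
is parallel for the first connection and `σ k`, the horizontal part of `g'`, is parallel for the
second one modulo `η`. -/
theorem horizontal_metric (i : ι) :
    ((1 - vecMulVec ξ η) * (G' - G) i * (1 - vecMulVec ξ η))ᵀ * (g - vecMulVec η η)
      + (g - vecMulVec η η) * ((1 - vecMulVec ξ η) * (G' - G) i * (1 - vecMulVec ξ η))
      = (si * δ i σ) • (g - vecMulVec η η) := by
  have dP := ParacontactMatrix.parallel_P C i
  have hPP := T.fst.paraHermitian.P_mul_P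
  have hPgP := T.Pt_g'_P
  have hPDP := T.P_mul_sub_mul_P C C' i
  have ks := T.fst.paraHermitian.k_symm
  obtain ⟨P, hP⟩ : ∃ P, P = 1 - vecMulVec ξ η := ⟨_, rfl⟩
  obtain ⟨k, hk⟩ : ∃ k, k = g - vecMulVec η η := ⟨_, rfl⟩
  rw [← hP] at dP hPP hPgP hPDP ⊢
  rw [← hk] at hPgP ks ⊢
  have dk : k.map (δ i) = (G i)ᵀ * k + k * G i := by
    rw [hk, map_derivation_sub, map_derivation_vecMulVec, C.parallel_g, C.parallel_η, mul_sub,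
      sub_mul, mul_vecMulVec, vecMulVec_mul, mulVec_transpose]
    abel
  have h1 : (Pᵀ * g' * P).map (δ i) = (G i)ᵀ * (Pᵀ * g' * P) + (Pᵀ * g' * P) * G i
      + (Pᵀ * ((G' - G) i)ᵀ * g' * P + Pᵀ * g' * ((G' - G) i * P)) := by
    rw [map_derivation_mul, map_derivation_mul, map_derivation_transpose, dP, C'.parallel_g,
      transpose_sub, transpose_mul, transpose_mul, Pi.sub_apply, transpose_sub]
    noncomm_ring
  rw [hPgP, map_derivation_smul, dk, mul_smul_comm, smul_mul, ← smul_add, add_comm] at h1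
  have h2 := add_left_cancel h1
  have h3 : σ • (k * (P * (G' - G) i * P)) = Pᵀ * g' * ((G' - G) i * P) := by
    rw [← smul_mul, ← hPgP, mul_assoc P, mul_assoc (Pᵀ * g') P, ← mul_assoc P P, hPP, hPDP]
  have h4 : σ • ((P * (G' - G) i * P)ᵀ * k) = Pᵀ * ((G' - G) i)ᵀ * g' * P := by
    have := congrArg transpose h3
    rw [transpose_smul, transpose_mul, ks] at this
    rw [this]
    simp only [transpose_mul, transpose_transpose, T.snd.g_symm, mul_assoc]
  rw [← h3, ← h4, ← smul_add] at h2
  have h5 := congrArg (si • ·) h2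
  simp only [smul_smul, T.si_mul_σ, one_smul] at h5
  exact h5.symm

/-- The horizontal part of the difference of the two connections is the gauge tensor. Only the
vertical parts `2 dη ⊗ ξ` and `2 dη' ⊗ ξ'` of the torsions are seen by horizontal vectors; their
difference is `2 dη ⊗ (σ ξ' - ξ)`, with horizontal part `2 dη ⊗ ζ`. -/
theorem horizontalPart_eq (r : ι) :
    horizontalPart (1 - vecMulVec ξ η) (G' - G) r
      = gaugeTensor (1 - vecMulVec ξ η) (g - vecMulVec η η) φ θ s ζ z r := by
  have H := T.fst.paraHermitian
  refine H.eq_gaugeTensor T.covector (fun r => ?_) (fun r t l => ?_) (fun r => ?_) r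
  · simp only [horizontalPart, Matrix.mul_sum, mul_smul_comm]
    refine sum_congr rfl fun i _ => ?_
    rw [mul_assoc (1 - vecMulVec ξ η) ((G' - G) i), ← mul_assoc (1 - vecMulVec ξ η) _,
      H.P_mul_P]
  · -- `U a` is the component `a` of the values of the difference; its skew part is given by torsion
    have hω' := T.Pt_ω'_P
    have hPζ : (1 - vecMulVec ξ η) *ᵥ (σ • ξ' - ξ) = ζ := by
      rw [T.ξ_eq, add_sub_cancel_left, T.covector.P_ζ]
    have Pt_η := T.Pt_η
    have η_P := T.η_P
    obtain ⟨P, hP⟩ : ∃ P, P = 1 - vecMulVec ξ η := ⟨_, rfl⟩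
    rw [← hP] at hω' hPζ Pt_η η_P H ⊢
    let U : ι → Matrix ι ι A := fun a => Matrix.of fun i b => (G' - G) i a b
    have hU : ∀ a, U a - (U a)ᵀ = (2 * ξ' a) • (g' * φ') - (2 * ξ a) • (g * φ)
        + vecMulVec η (σ • τ' a - τ a) - vecMulVec (σ • τ' a - τ a) η := by
      intro a
      ext i b
      have h1 := C'.torsion_eq a i b
      have h2 := C.torsion_eq a i b
      rw [T.η_eq] at h1
      simp only [torsion, Pi.smul_apply, smul_eq_mul] at h1 h2
      simp only [U, Matrix.sub_apply, of_apply, Pi.sub_apply, transpose_apply, Matrix.add_apply,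
        Matrix.smul_apply, vecMulVec_apply, Pi.smul_apply, smul_eq_mul]
      linear_combination h1 - h2
    have hω : Pᵀ * (g * φ) * P = g * φ := by
      rw [mul_assoc, mul_assoc, H.φ_mul_P, ← T.fst.kφ, ← mul_assoc, H.Pt_mul_k]
    have hPU : ∀ a, Pᵀ * U a * P - (Pᵀ * U a * P)ᵀ = (2 * (σ * ξ' a - ξ a)) • (g * φ) := by
      intro a
      have : (Pᵀ * U a * P)ᵀ = Pᵀ * (U a)ᵀ * P := by
        rw [transpose_mul, transpose_mul, transpose_transpose, mul_assoc]
      rw [this, ← sub_mul, ← mul_sub, hU]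
      have a1 : ∀ v : ι → A, Pᵀ * vecMulVec η v * P = 0 := by
        intro v
        rw [mul_vecMulVec, Pt_η, zero_vecMulVec, zero_mul]
      have a2 : ∀ v : ι → A, Pᵀ * vecMulVec v η * P = 0 := by
        intro v
        rw [mul_assoc, vecMulVec_mul, η_P, vecMulVec_zero, mul_zero]
      simp only [mul_add, add_mul, mul_sub, sub_mul, mul_smul_comm, smul_mul, a1, a2, hω,
        hω']
      rw [smul_smul, ← sub_smul, add_zero, sub_zero]
      congr 1
      ring
    have hC : ∀ r l t, horizontalPart P (G' - G) r l t = ∑ a, P l a * (Pᵀ * U a * P) r t := by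
      intro r l t
      have e : ∀ a, (Pᵀ * U a * P) r t = ∑ i, P i r * ∑ b, (G' - G) i a b * P b t := by
        intro a
        rw [mul_assoc, Matrix.mul_apply]
        rfl
      have e' : ∀ i, (P * (G' - G) i * P) l t = ∑ a, P l a * ∑ b, (G' - G) i a b * P b t := by
        intro i
        rw [mul_assoc, Matrix.mul_apply]
        rfl
      simp only [horizontalPart, Matrix.sum_apply, Matrix.smul_apply, smul_eq_mul, e, e', mul_sum]
      rw [sum_comm]
      refine sum_congr rfl fun a _ => sum_congr rfl fun i _ => sum_congr rfl fun b _ => ?_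
      ring
    have hζ : ∑ a, P l a * (σ * ξ' a - ξ a) = ζ l := congrFun hPζ l
    have hr : ∀ a, P l a * (Pᵀ * U a * P) r t - P l a * (Pᵀ * U a * P) t r
        = 2 * (g * φ) r t * (P l a * (σ * ξ' a - ξ a)) := by
      intro a
      have := congrFun (congrFun (hPU a) r) t
      simp only [Matrix.sub_apply, transpose_apply, Matrix.smul_apply, smul_eq_mul] at this
      linear_combination P l a * this
    rw [hC, hC, ← sum_sub_distrib, sum_congr rfl fun a _ => hr a, ← mul_sum, hζ, T.fst.kφ]
  · have e : ∀ i, ((1 - vecMulVec ξ η) i r • ((1 - vecMulVec ξ η) * (G' - G) i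
        * (1 - vecMulVec ξ η)))ᵀ * (g - vecMulVec η η)
        + (g - vecMulVec η η) * ((1 - vecMulVec ξ η) i r • ((1 - vecMulVec ξ η) * (G' - G) i
        * (1 - vecMulVec ξ η)))
        = (si * (δ i σ * (1 - vecMulVec ξ η) i r)) • (g - vecMulVec η η) := by
      intro i
      rw [transpose_smul, smul_mul, mul_smul_comm, ← smul_add, T.horizontal_metric C C', smul_smul]
      congr 1
      ring
    rw [horizontalPart, transpose_sum, Matrix.sum_mul, Matrix.mul_sum, ← sum_add_distrib,
      sum_congr rfl fun i _ => e i, ← sum_smul, ← mul_sum]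
    congr 1
    have := congrFun T.dσ_P r
    change si * ((fun i => δ i σ) ᵥ* (1 - vecMulVec ξ η)) r = _
    rw [this, Pi.smul_apply, smul_eq_mul]
    linear_combination 2 * θ r * T.si_mul_σ

end Connections

end GaugeMatrix

/-! ### The change of the scalar curvature -/

section Divergence

variable {ι A : Type*} [Fintype ι] [CommRing A] {δ : ι → Derivation ℤ A A}
  {G : ι → Matrix ι ι A}

theorem divergence_smul_const {c : A} (hc : ∀ i, δ i c = 0) (V : ι → A) :
    divergence δ G (c • V) = c * divergence δ G V := by
  simp only [divergence, Pi.smul_apply, smul_eq_mul, Derivation.leibniz, hc, mul_zero, add_zero,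
    mul_sum, mul_add, sum_add_distrib]
  congr 1
  exact sum_congr rfl fun _ _ => sum_congr rfl fun _ _ => by ring

/-- The divergence of `h α` for a parallel symmetric tensor `h` and a covector `α`. -/
theorem divergence_mulVec {h : Matrix ι ι A}
    (hh : ∀ i, h.map (δ i) = -(G i * h + h * (G i)ᵀ)) (α : ι → A) :
    divergence δ G (h *ᵥ α)
      = ∑ i, ∑ j, h i j * δ i (α j) - ∑ s, (∑ i, ∑ j, h i j * G i s j) * α s := by
  have e : ∀ i, δ i ((h *ᵥ α) i) + ∑ s, G i i s * (h *ᵥ α) s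
      = ∑ j, h i j * δ i (α j) - ∑ s, (∑ j, h i j * G i s j) * α s := by
    intro i
    have h1 : δ i ((h *ᵥ α) i) = (h.map (δ i) *ᵥ α + h *ᵥ (δ i ∘ α)) i :=
      congrFun (derivation_mulVec (δ i) h α) i
    have h2 : ∑ s, G i i s * (h *ᵥ α) s = (G i *ᵥ (h *ᵥ α)) i := rfl
    have h3 : ((h * (G i)ᵀ) *ᵥ α) i = ∑ s, (∑ j, h i j * G i s j) * α s := by
      simp only [mulVec, dotProduct, Matrix.mul_apply, transpose_apply]
    rw [h1, h2, hh, ← h3, neg_mulVec, add_mulVec, mulVec_mulVec]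
    simp only [Pi.add_apply, Pi.neg_apply]
    have h4 : (h *ᵥ (δ i ∘ α)) i = ∑ j, h i j * δ i (α j) := rfl
    rw [h4]
    ring
  rw [divergence, sum_congr rfl fun i _ => e i, sum_sub_distrib]
  congr 1
  rw [sum_comm]
  exact sum_congr rfl fun s _ => (sum_mul _ _ _).symm

end Divergence

namespace GaugeMatrix

variable {ι A : Type*} [Fintype ι] [DecidableEq ι] [CommRing A] [Invertible (2 : A)]
  {δ : ι → Derivation ℤ A A} {m : A} {g gi φ : Matrix ι ι A} {ξ η : ι → A}
  {g' gi' φ' : Matrix ι ι A} {ξ' η' : ι → A} {σ si : A} {θ s ζ z : ι → A} {q : A}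
  (T : GaugeMatrix δ m g gi φ ξ η g' gi' φ' ξ' η' σ si θ s ζ z q)
  {G G' : ι → Matrix ι ι A} {τ τ' : Matrix ι ι A}
  (C : AdaptedConnection δ g φ ξ η G τ) (C' : AdaptedConnection δ g' φ' ξ' η' G' τ')

include T C in
/-- The trace of `φ ∘ Dζ` is the divergence of `-θ♯`, because the divergence of `φ` vanishes. -/
theorem sum_φ_mul_nabla_ζ :
    ∑ j, (φ *ᵥ (δ j ∘ ζ + G j *ᵥ ζ)) j = -divergence δ G s := by
  have hP : ∀ j, (1 - vecMulVec ξ η) *ᵥ (δ j ∘ s + G j *ᵥ s) = δ j ∘ s + G j *ᵥ s := by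
    intro j
    have h0 : δ j (η ⬝ᵥ s) = 0 := by rw [T.η_s, map_zero]
    rw [derivation_dotProduct, C.parallel_η, ← dotProduct_mulVec] at h0
    rw [sub_mulVec, one_mulVec, vecMulVec_mulVec, dotProduct_add, add_comm (η ⬝ᵥ δ j ∘ s), h0]
    simp
  have hζ : ζ = -(φ *ᵥ s) := by rw [T.covector.φ_s, neg_neg]
  have e : ∀ j, φ *ᵥ (δ j ∘ ζ + G j *ᵥ ζ)
      = -((φ * (φ.map (δ j) + G j * φ - φ * G j)) *ᵥ s) - (δ j ∘ s + G j *ᵥ s) := by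
    intro j
    conv_rhs => rw [← hP j, ← T.fst.φ_mul_φ]
    rw [hζ, derivation_neg_vec, derivation_mulVec]
    simp only [mulVec_add, mulVec_neg, mulVec_mulVec, mul_add, mul_sub, add_mulVec,
      sub_mulVec, mul_assoc]
    abel
  have e2 : ∑ j, ((φ * (φ.map (δ j) + G j * φ - φ * G j)) *ᵥ s) j = 0 := by
    simp only [mulVec, dotProduct]
    rw [sum_comm]
    refine sum_eq_zero fun k _ => ?_
    rw [← sum_mul, T.fst.sum_φ_mul_nabla_φ T.commute C, zero_mul]
  simp only [e, Pi.sub_apply, Pi.neg_apply, sum_sub_distrib, sum_neg_distrib, e2]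
  rw [neg_zero, zero_sub]
  rfl

include T C C' in
/-- The vertical part `A_ξ` of the difference of the connections enters the scalar curvature only
through the trace of `φ A_ξ`, which is determined by the torsions. -/
theorem trace_φ_mul_sub_ξ (hτ : trace (φ * τ) = 0) (hτ' : trace (φ' * τ') = 0) :
    trace (φ * ∑ i, ξ i • (G' - G) i) = (m + 2) * q + divergence δ G s := by
  -- the torsion formulas contracted with `σ ξ' = ξ + ζ`
  have hν : ∑ i, (ξ + ζ) i • (G' - G) i
      = (Matrix.of fun k j => ((G' - G) j *ᵥ (ξ + ζ)) k) + (σ • τ' - τ)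
        - vecMulVec (σ • (τ' *ᵥ ξ')) η' + vecMulVec (τ *ᵥ (ξ + ζ)) η
        - vecMulVec ξ ((2 : A) • (ζ ᵥ* (g * φ))) := by
    ext k j
    have h1 : ∑ i, (σ * ξ' i) * torsion G' k i j
        = σ * τ' k j - σ * η' j * (τ' *ᵥ ξ') k := by
      have a1 : ∑ i, ξ' i * (g' * φ') i j = 0 := by
        have : (ξ' ᵥ* (g' * φ')) j = 0 := by
          rw [← vecMul_vecMul, T.snd.ξ_g, T.snd.η_φ, Pi.zero_apply]
        exact this
      have a2 : ∑ i, ξ' i * η' i = 1 := T.snd.ξ_η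
      have a3 : ∀ i, (σ * ξ' i) * torsion G' k i j
          = 2 * σ * ξ' k * (ξ' i * (g' * φ') i j) + σ * τ' k j * (ξ' i * η' i)
            - σ * η' j * (τ' k i * ξ' i) := by
        intro i
        rw [C'.torsion_eq]
        ring
      rw [sum_congr rfl fun i _ => a3 i, sum_sub_distrib, sum_add_distrib, ← mul_sum, ← mul_sum,
        ← mul_sum, a1, a2, mulVec, dotProduct]
      ring
    have h2 : ∑ i, (ξ + ζ) i * torsion G k i j
        = 2 * (ζ ᵥ* (g * φ)) j * ξ k + τ k j - η j * (τ *ᵥ (ξ + ζ)) k := by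
      have a1 : ∑ i, (ξ + ζ) i * (g * φ) i j = (ζ ᵥ* (g * φ)) j := by
        have : ((ξ + ζ) ᵥ* (g * φ)) j = (ζ ᵥ* (g * φ)) j := by
          rw [add_vecMul, ← vecMul_vecMul ξ, T.fst.ξ_g, T.fst.η_φ, zero_add]
        exact this
      have a2 : ∑ i, (ξ + ζ) i * η i = 1 := by
        have : (ξ + ζ) ⬝ᵥ η = 1 := by
          rw [add_dotProduct, T.fst.ξ_η, dotProduct_comm ζ, T.η_ζ, add_zero]
        exact this
      have a3 : ∀ i, (ξ + ζ) i * torsion G k i j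
          = 2 * ξ k * ((ξ + ζ) i * (g * φ) i j) + τ k j * ((ξ + ζ) i * η i)
            - η j * (τ k i * (ξ + ζ) i) := by
        intro i
        rw [C.torsion_eq]
        ring
      rw [sum_congr rfl fun i _ => a3 i, sum_sub_distrib, sum_add_distrib, ← mul_sum, ← mul_sum,
        ← mul_sum, a1, a2, mulVec, dotProduct]
      ring
    have h3 : ∀ i, (ξ + ζ) i = σ * ξ' i := fun i => (congrFun T.ξ_eq i).symm
    have h4 : ∀ i, (ξ + ζ) i * (G' - G) i k j
        = (G' - G) j k i * (ξ + ζ) i + (σ * ξ' i * torsion G' k i j)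
          - (ξ + ζ) i * torsion G k i j := by
      intro i
      rw [← h3]
      simp only [torsion, Pi.sub_apply, Matrix.sub_apply]
      ring
    rw [Matrix.sum_apply]
    simp only [Matrix.smul_apply, smul_eq_mul, h4, sum_add_distrib, sum_sub_distrib, h1, h2]
    simp only [Matrix.add_apply, Matrix.sub_apply, of_apply, Matrix.smul_apply, vecMulVec_apply,
      smul_eq_mul, Pi.smul_apply]
    have h5 : ∑ i, (G' - G) j k i * (ξ + ζ) i = ((G' - G) j *ᵥ (ξ + ζ)) k := rfl
    rw [h5]
    ring
  -- `φ` may replace `φ'` in the trace, since `φ' - φ = s ⊗ η` and `η τ' = 0`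
  have hτσ : trace (φ * τ') = 0 := by
    have h : φ = φ' - vecMulVec s η := by rw [T.φ_eq, add_sub_cancel_right]
    have h2 : η ᵥ* τ' = 0 := by
      have := congrArg (si • ·) C'.η_τ
      simp only [T.η_eq, smul_vecMul, smul_smul, T.si_mul_σ, one_smul, smul_zero] at this
      exact this
    rw [h, sub_mul, vecMulVec_mul, h2, vecMulVec_zero, sub_zero, hτ']
  -- `ξ` is parallel for the first connection and `ξ' = σ⁻¹ (ξ + ζ)` for the second one
  have hE : ∀ j, (G' - G) j *ᵥ (ξ + ζ) = δ j σ • ξ' - (δ j ∘ ζ + G j *ᵥ ζ) := by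
    intro j
    have h1 : δ j ∘ (σ • ξ') = δ j σ • ξ' - G' j *ᵥ (ξ + ζ) := by
      rw [derivation_smul_vec, C'.parallel_ξ, smul_neg, ← mulVec_smul, T.ξ_eq, sub_eq_add_neg]
    rw [T.ξ_eq, derivation_add_vec, C.parallel_ξ] at h1
    rw [Pi.sub_apply, sub_mulVec, mulVec_add (G j)]
    have h2 : G' j *ᵥ (ξ + ζ) = δ j σ • ξ' - (-(G j *ᵥ ξ) + δ j ∘ ζ) := by
      rw [h1]
      abel
    rw [h2]
    abel
  have hφE : trace (φ * (Matrix.of fun k j => ((G' - G) j *ᵥ (ξ + ζ)) k))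
      = -2 * q + divergence δ G s := by
    have e : ∀ j, (φ * (Matrix.of fun k j => ((G' - G) j *ᵥ (ξ + ζ)) k)) j j
        = -si * (δ j σ * s j) - (φ *ᵥ (δ j ∘ ζ + G j *ᵥ ζ)) j := by
      intro j
      have : (φ * (Matrix.of fun k j => ((G' - G) j *ᵥ (ξ + ζ)) k)) j j
          = (φ *ᵥ ((G' - G) j *ᵥ (ξ + ζ))) j := rfl
      rw [this, hE, mulVec_sub, mulVec_smul, T.φ_ξ']
      simp only [Pi.sub_apply, Pi.smul_apply, Pi.neg_apply, smul_eq_mul]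
      ring
    have hd : ∑ j, δ j σ * s j = 2 * σ * q := T.dσ_s
    change ∑ j, (φ * (Matrix.of fun k j => ((G' - G) j *ᵥ (ξ + ζ)) k)) j j = _
    rw [sum_congr rfl fun j _ => e j, sum_sub_distrib, ← mul_sum, hd,
      T.sum_φ_mul_nabla_ζ C]
    linear_combination -2 * q * T.si_mul_σ
  have hφη : ∀ v, trace (φ * vecMulVec v η) = 0 := by
    intro v
    rw [trace_mul_vecMulVec, dotProduct_mulVec, T.fst.η_φ, zero_dotProduct]
  have h1 := congrArg (fun M => trace (φ * M)) hν
  simp only [mul_add, mul_sub, trace_add, trace_sub, mul_smul_comm, trace_smul, hτ, hτσ, hφE, hφη,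
    T.η_eq, vecMulVec_smul, mul_vecMulVec φ ξ, T.fst.φ_ξ, zero_vecMulVec, trace_zero,
    smul_zero] at h1
  have h2 : trace (φ * ∑ i, ζ i • (G' - G) i) = -(m + 4) * q := by
    rw [← T.fst.paraHermitian.trace_φ_mul_horizontalPart (G' - G) T.covector.P_ζ,
      ← T.fst.paraHermitian.trace_φ_mul_gaugeTensor T.covector,
      sum_congr rfl fun r _ => congrArg (ζ r • ·) (T.horizontalPart_eq C C' r)]
  have h3 : ∑ i, (ξ + ζ) i • (G' - G) i = ∑ i, ξ i • (G' - G) i + ∑ i, ζ i • (G' - G) i := by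
    simp only [Pi.add_apply (ξ), add_smul, sum_add_distrib]
  rw [h3, mul_add, trace_add, h2] at h1
  linear_combination h1

include T C in
/-- The torsion term of the integration by parts: its two arguments are horizontal, so that only the
vertical part `2 dη ⊗ ξ` of the torsion contributes. -/
theorem sum_mul_torsion :
    ∑ j, ∑ i, ∑ k, ((1 - vecMulVec ξ η) * (G' - G) j * (gi - vecMulVec ξ ξ)) i k * torsion G j i k
      = -2 * trace (φ * ∑ i, ξ i • (G' - G) i) := by
  have H := T.fst.paraHermitian
  have hη := T.h_η
  have Pt_η := T.η_P
  have hω : (g * φ)ᵀ * (1 - vecMulVec ξ η) = -(g * φ) := by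
    rw [T.fst.skew, neg_mul, mul_assoc, H.φ_mul_P]
  have hhω : (gi - vecMulVec ξ ξ) * (g * φ) = φ := by
    rw [← T.fst.kφ, ← mul_assoc, H.h_mul_k, H.P_mul_φ]
  have ht : (gi - vecMulVec ξ ξ)ᵀ = gi - vecMulVec ξ ξ := H.h_symm
  obtain ⟨P, hP⟩ : ∃ P, P = 1 - vecMulVec ξ η := ⟨_, rfl⟩
  obtain ⟨h, hh⟩ : ∃ h, h = gi - vecMulVec ξ ξ := ⟨_, rfl⟩
  rw [← hP] at Pt_η hω ⊢
  rw [← hh] at hη hhω ht ⊢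
  have z1 : ∀ j k, ∑ i, (P * (G' - G) j * h) i k * η i = 0 := by
    intro j k
    have : (η ᵥ* (P * (G' - G) j * h)) k = 0 := by
      rw [mul_assoc, ← vecMul_vecMul, Pt_η, zero_vecMul, Pi.zero_apply]
    rw [← this]
    exact sum_congr rfl fun i _ => mul_comm _ _
  have z2 : ∀ j i, ∑ k, (P * (G' - G) j * h) i k * η k = 0 := by
    intro j i
    have : ((P * (G' - G) j * h) *ᵥ η) i = 0 := by
      rw [← mulVec_mulVec, hη, mulVec_zero, Pi.zero_apply]
    exact this
  have e : ∀ j i k, (P * (G' - G) j * h) i k * torsion G j i k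
      = 2 * ξ j * ((P * (G' - G) j * h) i k * (g * φ) i k)
        + (P * (G' - G) j * h) i k * η i * τ j k - (P * (G' - G) j * h) i k * η k * τ j i := by
    intro j i k
    rw [C.torsion_eq]
    ring
  have s1 : ∀ j, ∑ i, ∑ k, (P * (G' - G) j * h) i k * η i * τ j k = 0 := by
    intro j
    rw [sum_comm]
    exact sum_eq_zero fun k _ => by rw [← sum_mul, z1, zero_mul]
  have s2 : ∀ j, ∑ i, ∑ k, (P * (G' - G) j * h) i k * η k * τ j i = 0 := fun j =>
    sum_eq_zero fun i _ => by rw [← sum_mul, z2, zero_mul]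
  have s3 : ∀ j, ∑ i, ∑ k, (P * (G' - G) j * h) i k * (g * φ) i k
      = -trace (φ * (G' - G) j) := by
    intro j
    have : trace ((P * (G' - G) j * h) * (g * φ)ᵀ) = -trace (φ * (G' - G) j) := by
      rw [mul_assoc, mul_assoc, trace_mul_comm, mul_assoc, mul_assoc, hω]
      rw [mul_neg, mul_neg, trace_neg, hhω, trace_mul_comm]
    exact this
  simp only [e, sum_add_distrib, sum_sub_distrib, s1, s2, ← mul_sum, s3, add_zero, sub_zero]
  rw [Matrix.mul_sum, trace_sum, mul_sum]
  refine sum_congr rfl fun j _ => ?_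
  rw [mul_smul_comm, trace_smul, smul_eq_mul]
  ring

include T C C' in
/-- The change of the scalar curvature under a gauge transformation, in terms of the divergence
and the norm of `θ`. -/
theorem scalar_curvature_sub (hτ : trace (φ * τ) = 0) (hτ' : trace (φ' * τ') = 0) :
    σ * ∑ i, ∑ j, (curv δ G' i j * gi') i j - ∑ i, ∑ j, (curv δ G i j * gi) i j
      = -(2 * m + 4) * divergence δ G s - m * (m + 2) * q := by
  have H := T.fst.paraHermitian
  have K := T.covector
  have hm : ∀ i, δ i m = 0 := by
    intro i
    have h : m = (Fintype.card ι : A) - 1 := by rw [T.fst.card, add_sub_cancel_right]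
    rw [h, map_sub, Derivation.map_natCast, Derivation.map_one_eq_zero, sub_zero]
  -- both scalar curvatures are horizontal traces, with the same projection and the same metric
  have e1 : ∀ i j, σ * (curv δ G' i j * gi') i j
      = ((1 - vecMulVec ξ η) * curv δ G' i j * (gi - vecMulVec ξ ξ)) i j := by
    intro i j
    have hη : η ᵥ* curv δ G' i j = 0 := by
      have := congrArg (si • ·) (vecMul_curv_eq_zero T.commute C'.parallel_η i j)
      simp only [T.η_eq, smul_vecMul, smul_smul, T.si_mul_σ, one_smul, smul_zero] at this
      exact this
    have h1 : σ • (curv δ G' i j * gi')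
        = (1 - vecMulVec ξ η) * curv δ G' i j * (gi - vecMulVec ξ ξ) := by
      rw [T.gi'_eq, mul_add, mul_vecMulVec, curv_mulVec_eq_zero T.commute C'.parallel_ξ,
        zero_vecMulVec, add_zero, mul_smul_comm, smul_smul, T.σ_mul_si, one_smul, sub_mul, one_mul,
        vecMulVec_mul, hη, vecMulVec_zero, sub_zero]
    rw [← h1]
    rfl
  have e2 : ∀ i j, (curv δ G i j * gi) i j
      = ((1 - vecMulVec ξ η) * curv δ G i j * (gi - vecMulVec ξ ξ)) i j := by
    intro i j
    rw [ParacontactMatrix.curv_mul_gi T.commute C]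
  have hD : ∀ i j, (1 - vecMulVec ξ η) * (G' - G) i * (1 - vecMulVec ξ η) * (G' - G) j
      * (gi - vecMulVec ξ ξ) = (1 - vecMulVec ξ η) * (G' - G) i * (G' - G) j
      * (gi - vecMulVec ξ ξ) := by
    intro i j
    have : (1 - vecMulVec ξ η) * ((G' - G) j * (gi - vecMulVec ξ ξ))
        = (G' - G) j * (gi - vecMulVec ξ ξ) := by
      rw [sub_mul 1, one_mul, vecMulVec_mul, T.η_mul_sub_mul_h C C', vecMulVec_zero, sub_zero]
    rw [mul_assoc _ ((G' - G) j), mul_assoc _ (1 - vecMulVec ξ η), this, ← mul_assoc]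
  have e3 : ∀ i j, ((1 - vecMulVec ξ η) * curv δ G' i j * (gi - vecMulVec ξ ξ)) i j
      - ((1 - vecMulVec ξ η) * curv δ G i j * (gi - vecMulVec ξ ξ)) i j
      = ((1 - vecMulVec ξ η) * ((((G' - G) j).map (δ i) + G i * (G' - G) j - (G' - G) j * G i)
          - (((G' - G) i).map (δ j) + G j * (G' - G) i - (G' - G) i * G j))
          * (gi - vecMulVec ξ ξ)) i j
        + ((1 - vecMulVec ξ η) * ((G' - G) i * (G' - G) j - (G' - G) j * (G' - G) i)
          * (gi - vecMulVec ξ ξ)) i j := by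
    intro i j
    have h := curv_add (δ := δ) (G := G) (G' - G) i j
    rw [add_sub_cancel] at h
    rw [h, mul_add, mul_add, add_mul, add_mul, Matrix.add_apply, Matrix.add_apply]
    ring
  have hB := T.horizontalPart_eq C C'
  have hBf : horizontalPart (1 - vecMulVec ξ η) (G' - G)
      = gaugeTensor (1 - vecMulVec ξ η) (g - vecMulVec η η) φ θ s ζ z := funext hB
  -- the two vectors whose divergences occur are traces of the gauge tensor
  have hV : (fun i => ∑ j, ((1 - vecMulVec ξ η) * (G' - G) j * (gi - vecMulVec ξ ξ)) i j)
      = (-m) • s := by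
    ext i
    rw [H.sum_mul_h_eq_horizontalPart, hBf, H.sum_gaugeTensor_mul_h K]
    rfl
  have hU : (fun j => ∑ i, ((1 - vecMulVec ξ η) * (G' - G) i * (gi - vecMulVec ξ ξ)) i j)
      = (m + 2) • s := by
    ext j
    rw [H.sum_mul_h_diag_eq_horizontalPart, hBf]
    simp only [Matrix.mul_apply]
    rw [sum_comm]
    simp only [← sum_mul, H.sum_gaugeTensor_diag K]
    rw [Pi.smul_apply, smul_eq_mul, ← K.h_θ, mulVec, dotProduct, mul_sum]
    refine sum_congr rfl fun t _ => ?_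
    rw [show (gi - vecMulVec ξ ξ) j t = (gi - vecMulVec ξ ξ) t j from
      congrFun (congrFun H.h_symm t) j]
    ring
  have hQ : ∑ r, ∑ j, (gaugeTensor (1 - vecMulVec ξ η) (g - vecMulVec η η) φ θ s ζ z r
      * gaugeTensor (1 - vecMulVec ξ η) (g - vecMulVec η η) φ θ s ζ z j
      * (gi - vecMulVec ξ ξ)) r j = -m * (m + 2) * q := by
    simp only [mul_assoc (gaugeTensor _ _ _ _ _ _ _ _)]
    have h1 : ∀ r, ∑ j, (gaugeTensor (1 - vecMulVec ξ η) (g - vecMulVec η η) φ θ s ζ z r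
        * (gaugeTensor (1 - vecMulVec ξ η) (g - vecMulVec η η) φ θ s ζ z j
        * (gi - vecMulVec ξ ξ))) r j
        = ∑ t, gaugeTensor (1 - vecMulVec ξ η) (g - vecMulVec η η) φ θ s ζ z r r t
          * (-m * s t) := by
      intro r
      rw [sum_congr rfl fun j _ => Matrix.mul_apply, sum_comm]
      refine sum_congr rfl fun t _ => ?_
      rw [← mul_sum, H.sum_gaugeTensor_mul_h K]
    rw [sum_congr rfl fun r _ => h1 r, sum_comm]
    simp only [← sum_mul, H.sum_gaugeTensor_diag K]
    have h2 : ∀ t, (m + 2) * θ t * (-m * s t) = -m * (m + 2) * (θ t * s t) := fun t => by ring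
    rw [sum_congr rfl fun t _ => h2 t, ← mul_sum]
    have h3 : ∑ t, θ t * s t = q := K.θ_s
    rw [h3]
  have hcurl := sum_covariant_curl (fun i => ParacontactMatrix.parallel_P C i)
    (fun i => T.fst.parallel_h C i) (G' - G)
  rw [hV, hU, divergence_smul_const (fun i => by rw [map_neg, hm, neg_zero]),
    divergence_smul_const (fun i => by
      rw [map_add, hm, zero_add]; exact Derivation.map_natCast (δ i) 2),
    T.sum_mul_torsion C, T.trace_φ_mul_sub_ξ C C' hτ hτ'] at hcurl
  have hquad := H.sum_mul_mul_h_eq_horizontalPart hD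
  rw [hBf, hQ, H.sum_gaugeTensor_mul_gaugeTensor K] at hquad
  rw [mul_sum, sum_congr rfl fun i _ => mul_sum _ _ _]
  simp only [e1, e2]
  rw [← sum_sub_distrib, sum_congr rfl fun i _ => (sum_sub_distrib _ _).symm]
  simp only [e3, sum_add_distrib]
  rw [hcurl, hquad]
  ring

include T in
/-- The change of the scalar curvature of the canonical connection under a gauge
transformation. -/
theorem scalar_curvature :
    4 * (σ * ∑ i, ∑ j, (curv δ (canonicalMatrix δ g' gi' φ' ξ' η') i j * gi') i j
        - ∑ i, ∑ j, (curv δ (canonicalMatrix δ g gi φ ξ η) i j * gi) i j)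
      = -4 * (m + 2) * (si * ∑ i, ∑ j, (gi - vecMulVec ξ ξ) i j
          * (δ i (δ j σ) - ∑ s, leviCivita δ g gi i s j * δ s σ))
        - (m + 2) * (m - 4) * (si ^ 2 * ∑ i, ∑ j, (gi - vecMulVec ξ ξ) i j * (δ i σ * δ j σ)) := by
  have H := T.fst.paraHermitian
  have C := T.fst.adaptedConnection
  have hsub := T.scalar_curvature_sub C T.snd.adaptedConnection T.fst.trace_φ_mul_τ
    T.snd.trace_φ_mul_τ
  have h2 : (2 : A) * ⅟2 = 1 := mul_invOf_self 2
  have hs : s = (gi - vecMulVec ξ ξ) *ᵥ ((⅟2 * si) • fun i => δ i σ) := by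
    rw [← T.covector.h_θ, T.θ_eq, mulVec_smul, mulVec_smul, ← mulVec_transpose, mulVec_mulVec,
      H.h_mul_Pt]
  have hdsi : ∀ i, δ i si = -(si ^ 2 * δ i σ) := by
    intro i
    have h0 : δ i (σ * si) = 0 := by rw [T.σ_mul_si]; simp
    rw [Derivation.leibniz, smul_eq_mul, smul_eq_mul] at h0
    linear_combination si * h0 - δ i si * T.σ_mul_si
  have hdhalf : ∀ i, δ i (⅟2 : A) = 0 := by
    intro i
    have h0 : δ i (2 * ⅟2 : A) = 0 := by rw [h2]; simp
    rw [Derivation.leibniz, smul_eq_mul, smul_eq_mul,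
      show δ i (2 : A) = 0 from Derivation.map_natCast (δ i) 2] at h0
    linear_combination ⅟2 * h0 - δ i (⅟2 : A) * h2
  have hdiv : 2 * divergence δ (canonicalMatrix δ g gi φ ξ η) s
      = si * ∑ i, ∑ j, (gi - vecMulVec ξ ξ) i j
          * (δ i (δ j σ) - ∑ s, leviCivita δ g gi i s j * δ s σ)
        - si ^ 2 * ∑ i, ∑ j, (gi - vecMulVec ξ ξ) i j * (δ i σ * δ j σ) := by
    rw [hs, divergence_mulVec (fun i => T.fst.parallel_h C i)]
    simp only [T.fst.sum_h_mul_canonicalMatrix T.commute, Pi.smul_apply, smul_eq_mul,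
      Derivation.leibniz, hdsi, hdhalf]
    have a1 : ∑ i, ∑ j, (gi - vecMulVec ξ ξ) i j
          * (δ i (δ j σ) - ∑ s, leviCivita δ g gi i s j * δ s σ)
        = ∑ i, ∑ j, (gi - vecMulVec ξ ξ) i j * δ i (δ j σ)
          - ∑ s, (∑ i, ∑ j, (gi - vecMulVec ξ ξ) i j * leviCivita δ g gi i s j) * δ s σ := by
      simp only [mul_sub, sum_sub_distrib, mul_sum, sum_mul]
      congr 1
      rw [sum_congr rfl fun i _ => sum_comm, sum_comm]
      exact sum_congr rfl fun _ _ => sum_congr rfl fun _ _ => sum_congr rfl fun _ _ => by ring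
    have a2 : ∀ i j, (gi - vecMulVec ξ ξ) i j * (⅟2 * si * δ i (δ j σ)
          + δ j σ * (⅟2 * -(si ^ 2 * δ i σ) + si * 0))
        = ⅟2 * si * ((gi - vecMulVec ξ ξ) i j * δ i (δ j σ))
          - ⅟2 * si ^ 2 * ((gi - vecMulVec ξ ξ) i j * (δ i σ * δ j σ)) := by
      intro i j
      ring
    have a3 : ∀ k, (∑ i, ∑ j, (gi - vecMulVec ξ ξ) i j * leviCivita δ g gi i k j)
          * (⅟2 * si * δ k σ)
        = ⅟2 * si * ((∑ i, ∑ j, (gi - vecMulVec ξ ξ) i j * leviCivita δ g gi i k j)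
          * δ k σ) := by
      intro k
      ring
    rw [sum_congr rfl fun i _ => sum_congr rfl fun j _ => a2 i j,
      sum_congr rfl fun k _ => a3 k, a1]
    simp only [sum_sub_distrib, ← mul_sum]
    linear_combination (si * (∑ i, ∑ j, (gi - vecMulVec ξ ξ) i j * δ i (δ j σ)
      - ∑ s, (∑ i, ∑ j, (gi - vecMulVec ξ ξ) i j * leviCivita δ g gi i s j) * δ s σ)
      - si ^ 2 * ∑ i, ∑ j, (gi - vecMulVec ξ ξ) i j * (δ i σ * δ j σ)) * h2
  have hq : 4 * q = si ^ 2 * ∑ i, ∑ j, (gi - vecMulVec ξ ξ) i j * (δ i σ * δ j σ) := by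
    have a1 : 2 * σ * q = ⅟2 * si * ∑ i, ∑ j, (gi - vecMulVec ξ ξ) i j * (δ i σ * δ j σ) := by
      rw [← T.dσ_s, hs, mulVec_smul, dotProduct_smul, smul_eq_mul]
      congr 1
      simp only [mulVec, dotProduct, mul_sum]
      exact sum_congr rfl fun _ _ => sum_congr rfl fun _ _ => by ring
    linear_combination 2 * si * a1 - 4 * q * T.si_mul_σ
      + si ^ 2 * (∑ i, ∑ j, (gi - vecMulVec ξ ξ) i j * (δ i σ * δ j σ)) * h2
  linear_combination 4 * hsub - 4 * (m + 2) * hdiv - m * (m + 2) * hq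

end GaugeMatrix

noncomputable section

/-! ### The ring of smooth functions on an open set -/

/-- The derivations of a commutative ring, with the structure of a `ℤ`-algebra that any commutative
ring has. -/
abbrev RingDerivation (A : Type*) [CommRing A] := Derivation ℤ A A

section SmoothFunctions

open TopologicalSpace

variable {E : Type*} [NormedAddCommGroup E] [NormedSpace ℝ E]

/-- The extension by zero of a function on an open set. -/
def extendZero (U : Opens E) (f : U → ℝ) (x : E) : ℝ :=
  open Classical in if h : x ∈ U then f ⟨x, h⟩ else 0

omit [NormedSpace ℝ E] in
lemma extendZero_apply {U : Opens E} (f : U → ℝ) (x : U) : extendZero U f x = f x := by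
  simp [extendZero]

lemma contDiffOn_extendZero_iff {U : Opens E} {f : U → ℝ} {F : E → ℝ}
    (h : ∀ x : U, f x = F x) :
    ContDiffOn ℝ ∞ (extendZero U f) U ↔ ContDiffOn ℝ ∞ F U :=
  contDiffOn_congr fun x hx => (extendZero_apply f ⟨x, hx⟩).trans (h ⟨x, hx⟩)

/-- The algebra of smooth real functions on an open set `U`, as functions on the subtype. -/
def smoothFunctions (U : Opens E) : Subalgebra ℝ (U → ℝ) where
  carrier := {f | ContDiffOn ℝ ∞ (extendZero U f) U}
  mul_mem' {f g} hf hg :=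
    (contDiffOn_extendZero_iff (F := extendZero U f * extendZero U g)
      fun x => by simp [extendZero_apply]).2 (ContDiffOn.mul hf hg)
  add_mem' {f g} hf hg :=
    (contDiffOn_extendZero_iff (F := extendZero U f + extendZero U g)
      fun x => by simp [extendZero_apply]).2 (ContDiffOn.add hf hg)
  algebraMap_mem' r :=
    (contDiffOn_extendZero_iff (F := fun _ => r) fun x => by simp).2 contDiffOn_const

namespace smoothFunctions

variable {U : Opens E}

/-- The smooth function on `U` given by a function that is smooth on `U`. -/
def mk (U : Opens E) (F : E → ℝ) (hF : ContDiffOn ℝ ∞ F U) : smoothFunctions U :=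
  ⟨fun x => F x, (contDiffOn_extendZero_iff fun _ => rfl).2 hF⟩

/-- Evaluation at a point. -/
def ev (x : U) : smoothFunctions U →+* ℝ :=
  (Pi.evalRingHom (fun _ : U => ℝ) x).comp (smoothFunctions U).val.toRingHom

@[simp] lemma ev_mk (F : E → ℝ) (hF : ContDiffOn ℝ ∞ F U) (x : U) : ev x (mk U F hF) = F x := rfl

lemma ev_eq (f : smoothFunctions U) (x : U) : ev x f = extendZero U f.1 x :=
  (extendZero_apply f.1 x).symm

lemma ext_ev {f g : smoothFunctions U} (h : ∀ x, ev x f = ev x g) : f = g :=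
  Subtype.ext (funext h)

lemma differentiableAt_extendZero (f : smoothFunctions U) (x : U) :
    DifferentiableAt ℝ (extendZero U f.1) x :=
  (f.2.differentiableOn (by simp)).differentiableAt (U.isOpen.mem_nhds x.2)

lemma contDiffOn_fderiv_apply {F : E → ℝ} (hF : ContDiffOn ℝ ∞ F U) (v : E) :
    ContDiffOn ℝ ∞ (fun x => fderiv ℝ F x v) U :=
  (hF.fderiv_of_isOpen U.isOpen (by simp)).clm_apply contDiffOn_const

lemma fderiv_congr_on {F G : E → ℝ} (h : ∀ x : U, F x = G x) (x : U) :
    fderiv ℝ F x = fderiv ℝ G x :=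
  Filter.EventuallyEq.fderiv_eq
    (Filter.eventually_of_mem (U.isOpen.mem_nhds x.2) fun y hy => h ⟨y, hy⟩)

/-- The derivative in the direction of a fixed vector. -/
def dirDeriv (v : E) : RingDerivation (smoothFunctions U) :=
  Derivation.mk' (AddMonoidHom.toIntLinearMap
    { toFun := fun f => mk U (fun x => fderiv ℝ (extendZero U f.1) x v)
        (contDiffOn_fderiv_apply f.2 v)
      map_zero' := ext_ev fun x => by
        have : fderiv ℝ (extendZero U (0 : U → ℝ)) x = fderiv ℝ (fun _ : E => (0 : ℝ)) x :=
          fderiv_congr_on (fun y => by simp [extendZero_apply]) x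
        simp [this]
      map_add' := fun f g => ext_ev fun x => by
        have : fderiv ℝ (extendZero U (f.1 + g.1)) x
            = fderiv ℝ (fun y => extendZero U f.1 y + extendZero U g.1 y) x :=
          fderiv_congr_on (fun y => by simp [extendZero_apply]) x
        have h2 := fderiv_fun_add (differentiableAt_extendZero f x)
          (differentiableAt_extendZero g x)
        simp [this, h2] })
    fun f g => ext_ev fun x => by
      have : fderiv ℝ (extendZero U (f.1 * g.1)) x
          = fderiv ℝ (fun y => extendZero U f.1 y * extendZero U g.1 y) x :=
        fderiv_congr_on (fun y => by simp [extendZero_apply]) x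
      have h2 := fderiv_fun_mul (differentiableAt_extendZero f x)
        (differentiableAt_extendZero g x)
      change fderiv ℝ (extendZero U (f.1 * g.1)) x v
        = f.1 x * fderiv ℝ (extendZero U g.1) x v + g.1 x * fderiv ℝ (extendZero U f.1) x v
      simp [this, h2, extendZero_apply]

lemma ev_dirDeriv (v : E) (f : smoothFunctions U) (x : U) :
    ev x (dirDeriv v f) = fderiv ℝ (extendZero U f.1) x v := rfl

lemma dirDeriv_mk (v : E) (F : E → ℝ) (hF : ContDiffOn ℝ ∞ F U) :
    dirDeriv v (mk U F hF) = mk U (fun x => fderiv ℝ F x v) (contDiffOn_fderiv_apply hF v) :=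
  ext_ev fun x => by
    have h : fderiv ℝ (extendZero U (mk U F hF).1) x = fderiv ℝ F x :=
      fderiv_congr_on (fun y => extendZero_apply _ y) x
    rw [ev_dirDeriv, h]; rfl

lemma exists_eq_mk (f : smoothFunctions U) :
    ∃ (F : E → ℝ) (hF : ContDiffOn ℝ ∞ F U), f = mk U F hF :=
  ⟨extendZero U f.1, f.2, ext_ev fun x => ev_eq f x⟩

/-- Directional derivatives commute: the second derivative is symmetric. -/
lemma dirDeriv_comm (v w : E) (f : smoothFunctions U) :
    dirDeriv v (dirDeriv w f) = dirDeriv w (dirDeriv v f) := by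
  obtain ⟨F, hF, rfl⟩ := exists_eq_mk f
  simp only [dirDeriv_mk]
  refine ext_ev fun x => ?_
  have hx : ContDiffAt ℝ ∞ F x := hF.contDiffAt (U.isOpen.mem_nhds x.2)
  have hd : DifferentiableAt ℝ (fderiv ℝ F) x :=
    (hx.fderiv_right (m := 1)
      (by rw [one_add_one_eq_two]; exact ENat.LEInfty.out)).differentiableAt (by simp)
  have key : ∀ a b : E, fderiv ℝ (fun y => fderiv ℝ F y a) x b = fderiv ℝ (fderiv ℝ F) x b a := by
    intro a b
    rw [fderiv_clm_apply hd (differentiableAt_const a)]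
    simp
  simp only [ev_mk, key]
  exact (hx.isSymmSndFDerivAt (by simpa using ENat.LEInfty.out)).eq v w

instance invertibleTwo : Invertible (2 : smoothFunctions U) where
  invOf := algebraMap ℝ _ (1 / 2)
  invOf_mul_self := by
    rw [← map_ofNat (algebraMap ℝ (smoothFunctions U)) 2, ← map_mul]; norm_num
  mul_invOf_self := by
    rw [← map_ofNat (algebraMap ℝ (smoothFunctions U)) 2, ← map_mul]; norm_num

@[simp] lemma ev_invOf_two (x : U) : ev x ⅟2 = 1 / 2 := rfl

end smoothFunctions

end SmoothFunctions

/-! ### Coordinate frames -/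

section Frames

variable {N : ℕ} {M : Type*} [TopologicalSpace M] [ChartedSpace (EuclideanSpace ℝ (Fin N)) M]

/-- Smoothness of a vector field at a point. -/
abbrev SmoothVectorAt [IsManifold (𝓡 N) ∞ M] (V : ∀ y : M, TangentSpace (𝓡 N) y) (x : M) : Prop :=
  ContMDiffAt (𝓡 N) ((𝓡 N).prod 𝓘(ℝ, EuclideanSpace ℝ (Fin N))) ∞
    (fun y => Bundle.TotalSpace.mk' (EuclideanSpace ℝ (Fin N)) y (V y)) x

/-- A constant vector field on Euclidean space. -/
def constField (w : EuclideanSpace ℝ (Fin N)) (u : EuclideanSpace ℝ (Fin N)) :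
    TangentSpace (𝓡 N) u := w

/-- The coordinate vector field `∂_i` of the chart `e`, as a vector field on the manifold. It is
meaningful on the source of `e` only. -/
def coordField (e : OpenPartialHomeomorph M (EuclideanSpace ℝ (Fin N))) (i : Fin N) :
    ∀ x : M, TangentSpace (𝓡 N) x :=
  VectorField.mpullback (𝓡 N) (𝓡 N) e
    (constField (EuclideanSpace.single i (1 : ℝ)))

variable {e : OpenPartialHomeomorph M (EuclideanSpace ℝ (Fin N))}

section Atlas

variable (he : e ∈ IsManifold.maximalAtlas (𝓡 N) ∞ M)
include he

lemma mdifferentiable_of_mem_maximalAtlas : e.MDifferentiable (𝓡 N) (𝓡 N) :=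
  ⟨(contMDiffOn_of_mem_maximalAtlas he).mdifferentiableOn (by simp),
    (contMDiffOn_symm_of_mem_maximalAtlas he).mdifferentiableOn (by simp)⟩

lemma isInvertible_mfderiv_chart {x : M} (hx : x ∈ e.source) :
    (mfderiv (𝓡 N) (𝓡 N) e x).IsInvertible :=
  ⟨(mdifferentiable_of_mem_maximalAtlas he).mfderiv hx, rfl⟩

lemma smoothVectorAt_coordField [IsManifold (𝓡 N) ∞ M] (i : Fin N) {x : M} (hx : x ∈ e.source) :
    SmoothVectorAt (coordField e i) x :=
  ContMDiffAt.mpullback_vectorField_preimage (n := ∞)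
    (contMDiffAt_vectorSpace_iff_contDiffAt.2 (contDiffAt_const (c := (EuclideanSpace.single i 1))))
    (contMDiffAt_of_mem_maximalAtlas he hx) (isInvertible_mfderiv_chart he hx) le_rfl

variable {u : EuclideanSpace ℝ (Fin N)} (hu : u ∈ e.target)
include hu

lemma coordField_symm (i : Fin N) : coordField e i (e.symm u) = coordVector e i u := by
  have hd := mdifferentiable_of_mem_maximalAtlas he
  have h := hd.comp_symm_deriv hu
  have hs : e.symm u ∈ e.source := e.map_target hu
  have h1 : mfderiv (𝓡 N) (𝓡 N) e (e.symm u) (coordVector e i u)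
      = (EuclideanSpace.single i (1 : ℝ) : EuclideanSpace ℝ (Fin N)) :=
    congrArg (fun L => L (EuclideanSpace.single i (1 : ℝ) : EuclideanSpace ℝ (Fin N))) h
  obtain ⟨L, hL⟩ := isInvertible_mfderiv_chart he hs
  rw [coordField, VectorField.mpullback_apply, ← hL, ContinuousLinearMap.inverse_equiv]
  rw [← hL] at h1
  exact (L.symm_apply_eq).2 h1.symm

lemma coordComp_coordVector (i j : Fin N) :
    coordComp e i u (coordVector e j u) = if i = j then 1 else 0 := by
  have h := (mdifferentiable_of_mem_maximalAtlas he).comp_symm_deriv hu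
  have h1 : mfderiv (𝓡 N) (𝓡 N) e (e.symm u) (coordVector e j u)
      = (EuclideanSpace.single j (1 : ℝ) : EuclideanSpace ℝ (Fin N)) :=
    congrArg (fun L => L (EuclideanSpace.single j (1 : ℝ) : EuclideanSpace ℝ (Fin N))) h
  have h2 : coordComp e i u (coordVector e j u)
      = (EuclideanSpace.single j (1 : ℝ) : EuclideanSpace ℝ (Fin N)) i :=
    congrArg (fun w : EuclideanSpace ℝ (Fin N) => w i) h1
  rw [h2, PiLp.single_apply]

lemma sum_coordComp_smul_coordVector (v : TangentSpace (𝓡 N) (e.symm u)) :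
    ∑ i, coordComp e i u v • coordVector e i u = v := by
  have h := (mdifferentiable_of_mem_maximalAtlas he).symm_comp_deriv (e.map_target hu)
  have h1 : mfderiv (𝓡 N) (𝓡 N) e.symm (e (e.symm u)) (mfderiv (𝓡 N) (𝓡 N) e (e.symm u) v) = v :=
    congrArg (fun L => L v) h
  rw [e.right_inv hu] at h1
  set w : EuclideanSpace ℝ (Fin N) := mfderiv (𝓡 N) (𝓡 N) e (e.symm u) v with hw
  have h3 : w = ∑ i, w i • EuclideanSpace.single i (1 : ℝ) := by
    ext j
    simp [Pi.single_apply]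
  have h4 : mfderiv (𝓡 N) (𝓡 N) e.symm u w = ∑ i, w i • coordVector e i u := by
    conv_lhs => rw [h3]
    erw [map_sum]
    refine Finset.sum_congr rfl fun i _ => ?_
    erw [map_smul]
    rfl
  exact h4.symm.trans h1

end Atlas

end Frames

section Frames

variable {N : ℕ} {M : Type*} [TopologicalSpace M] [ChartedSpace (EuclideanSpace ℝ (Fin N)) M]
  {e : OpenPartialHomeomorph M (EuclideanSpace ℝ (Fin N))}
  (he : e ∈ IsManifold.maximalAtlas (𝓡 N) ∞ M)
include he

/-- Coordinate vector fields commute. -/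
lemma mlieBracket_coordField [IsManifold (𝓡 N) ∞ M] (i j : Fin N) {x : M} (hx : x ∈ e.source) :
    VectorField.mlieBracket (𝓡 N) (coordField e i) (coordField e j) x = 0 := by
  have hc : ∀ (w u : EuclideanSpace ℝ (Fin N)), MDifferentiableAt (𝓡 N) (𝓡 N).tangent
      (fun u => (⟨u, constField w u⟩ : TangentBundle (𝓡 N) (EuclideanSpace ℝ (Fin N)))) u :=
    fun w u => (contMDiffAt_vectorSpace_iff_contDiffAt (n := 1).2
      (contDiffAt_const (c := w))).mdifferentiableAt (by simp)
  have : IsManifold (𝓡 N) (minSmoothness ℝ 2) M := by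
    simpa using (inferInstance : IsManifold (𝓡 N) 2 M)
  have h := VectorField.mpullback_mlieBracket (I := 𝓡 N) (I' := 𝓡 N) (n := ∞) (f := e) (x₀ := x)
    (V := constField (EuclideanSpace.single i (1 : ℝ)))
    (W := constField (EuclideanSpace.single j (1 : ℝ)))
    (hc _ _) (hc _ _) (contMDiffAt_of_mem_maximalAtlas he hx) (by simpa using ENat.LEInfty.out)
  have h0 : ∀ w w' u : EuclideanSpace ℝ (Fin N),
      VectorField.mlieBracket (𝓡 N) (constField w) (constField w') u = 0 := by
    intro w w' u
    rw [← VectorField.mlieBracketWithin_univ]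
    refine (congrFun VectorField.mlieBracketWithin_eq_lieBracketWithin u).trans ?_
    change VectorField.lieBracketWithin ℝ (fun _ => w) (fun _ => w') Set.univ u = 0
    simp [VectorField.lieBracketWithin]
  rw [coordField, coordField, ← h, VectorField.mpullback_apply, h0, map_zero]

lemma contDiffOn_comp_symm {f : M → ℝ}
    (hf : ∀ x ∈ e.source, ContMDiffAt (𝓡 N) 𝓘(ℝ, ℝ) ∞ f x) :
    ContDiffOn ℝ ∞ (fun u => f (e.symm u)) e.target := by
  intro u hu
  have h := (hf _ (e.map_target hu)).comp u (contMDiffAt_symm_of_mem_maximalAtlas he hu)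
  exact (contMDiffAt_iff_contDiffAt.1 h).contDiffWithinAt

lemma pd_comp_symm {f : M → ℝ} {u : EuclideanSpace ℝ (Fin N)} (hu : u ∈ e.target)
    (hf : MDifferentiableAt (𝓡 N) 𝓘(ℝ, ℝ) f (e.symm u)) (i : Fin N) :
    pd i (fun w => f (e.symm w)) u = mvfderiv (𝓡 N) f (e.symm u) (coordVector e i u) := by
  have h := mfderiv_comp u hf
    ((contMDiffAt_symm_of_mem_maximalAtlas he hu).mdifferentiableAt (by simp))
  rw [pd, ← mfderiv_eq_fderiv]
  change mfderiv (𝓡 N) 𝓘(ℝ, ℝ) (f ∘ e.symm) u (EuclideanSpace.single i 1) = _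
  rw [h]
  rfl

lemma contDiffOn_coordComp [IsManifold (𝓡 N) ∞ M] {V : ∀ y : M, TangentSpace (𝓡 N) y}
    (hV : ∀ x ∈ e.source, SmoothVectorAt V x) (i : Fin N) :
    ContDiffOn ℝ ∞ (fun u => coordComp e i u (V (e.symm u))) e.target := by
  intro u hu
  have hd := mdifferentiable_of_mem_maximalAtlas he
  have hinv : ∀ w ∈ e.target, (mfderiv (𝓡 N) (𝓡 N) e.symm w).IsInvertible :=
    fun w hw => ⟨hd.symm.mfderiv hw, rfl⟩
  have h := ContMDiffAt.mpullback_vectorField_preimage (n := ∞) (m := ∞)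
    (hV _ (e.map_target hu)) (contMDiffAt_symm_of_mem_maximalAtlas he hu) (hinv u hu) le_rfl
  have h2 : ContDiffAt ℝ ∞ (VectorField.mpullback (𝓡 N) (𝓡 N) e.symm V :
      EuclideanSpace ℝ (Fin N) → EuclideanSpace ℝ (Fin N)) u :=
    contMDiffAt_vectorSpace_iff_contDiffAt.1 h
  have h3 := (contDiffAt_piLp 2).1 h2 i
  refine (h3.congr_of_eventuallyEq ?_).contDiffWithinAt
  filter_upwards [e.open_target.mem_nhds hu] with w hw
  have h4 : VectorField.mpullback (𝓡 N) (𝓡 N) e.symm V w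
      = mfderiv (𝓡 N) (𝓡 N) e (e.symm w) (V (e.symm w)) := by
    obtain ⟨L, hL⟩ := hinv w hw
    rw [VectorField.mpullback_apply, ← hL, ContinuousLinearMap.inverse_equiv]
    refine (L.symm_apply_eq).2 ?_
    have h5 := hd.symm_comp_deriv (e.map_target hw)
    rw [e.right_inv hw, ← hL] at h5
    exact (congrArg (fun L => L (V (e.symm w))) h5).symm
  exact congrArg (fun v : EuclideanSpace ℝ (Fin N) => v i) h4.symm

/-- A vector field with smooth coordinate components is smooth. -/
lemma smoothVectorAt_of_coordComp [IsManifold (𝓡 N) ∞ M] {V : ∀ y : M, TangentSpace (𝓡 N) y}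
    (hV : ∀ i, ContDiffOn ℝ ∞ (fun u => coordComp e i u (V (e.symm u))) e.target)
    {x : M} (hx : x ∈ e.source) : SmoothVectorAt V x := by
  have hc : ∀ i, ContMDiffAt (𝓡 N) 𝓘(ℝ, ℝ) ∞
      (fun y => coordComp e i (e y) (V (e.symm (e y)))) x := fun i =>
    ((hV i).contDiffAt (e.open_target.mem_nhds (e.map_source hx))).contMDiffAt.comp x
      (contMDiffAt_of_mem_maximalAtlas he hx)
  have h := ContMDiffAt.sum_section (s := Finset.univ)
    (t := fun i => (fun y => coordComp e i (e y) (V (e.symm (e y)))) • coordField e i)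
    fun i _ => (hc i).smul_section (smoothVectorAt_coordField he i hx)
  refine h.congr_of_eventuallyEq ?_
  filter_upwards [e.open_source.mem_nhds hx] with y hy
  have h2 : ∀ z, z = y → V z = ∑ i, coordComp e i (e y) (V (e.symm (e y))) • coordField e i z →
      V y = ∑ i, coordComp e i (e y) (V (e.symm (e y))) • coordField e i y := by
    rintro z rfl h; exact h
  refine congrArg (Bundle.TotalSpace.mk' (EuclideanSpace ℝ (Fin N)) y)
    (h2 (e.symm (e y)) (e.left_inv hy) ?_)
  simp only [coordField_symm he (e.map_source hy)]
  exact (sum_coordComp_smul_coordVector he (e.map_source hy) _).symm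

omit he in
/-- Every tangent vector extends to a smooth vector field near its base point. -/
lemma exists_smoothVectorAt [IsManifold (𝓡 N) ∞ M] (x : M) (v : TangentSpace (𝓡 N) x) :
    ∃ V : ∀ y : M, TangentSpace (𝓡 N) y, SmoothVectorAt V x ∧ V x = v := by
  have key : ∀ {e : OpenPartialHomeomorph M (EuclideanSpace ℝ (Fin N))},
      e ∈ IsManifold.maximalAtlas (𝓡 N) ∞ M → ∀ u ∈ e.target, ∀ v : TangentSpace (𝓡 N) (e.symm u),
      ∃ V : ∀ y : M, TangentSpace (𝓡 N) y, SmoothVectorAt V (e.symm u) ∧ V (e.symm u) = v := by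
    intro e he u hu v
    refine ⟨_, ContMDiffAt.sum_section (s := Finset.univ)
      (t := fun i => (fun _ : M => coordComp e i u v) • coordField e i)
      fun i _ => contMDiffAt_const.smul_section
        (smoothVectorAt_coordField he i (e.map_target hu)), ?_⟩
    refine Eq.trans ?_ (sum_coordComp_smul_coordVector he hu v)
    simp only [← coordField_symm he hu]
    rfl
  have h := key (IsManifold.chart_mem_maximalAtlas x) _ (mem_chart_target _ x)
  rw [(chartAt (EuclideanSpace ℝ (Fin N)) x).left_inv (mem_chart_source _ x)] at h
  exact h v

end Frames

/-! ### Gauge transformations of one tangent space -/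

section Pointwise

variable {V : Type*} [AddCommGroup V] [Module ℝ V] [TopologicalSpace V]

/-- The algebraic part of a paracontact metric structure on one tangent space. -/
structure PointwiseMetric (φ : V →L[ℝ] V) (ξ : V) (η : V →L[ℝ] ℝ) (g : V →L[ℝ] V →L[ℝ] ℝ) :
    Prop where
  φ_ξ : φ ξ = 0
  η_φ : ∀ v, η (φ v) = 0
  η_ξ : η ξ = 1
  φ_φ : ∀ v, φ (φ v) = v - η v • ξ
  symm : ∀ v w, g v w = g w v
  nondegenerate : ∀ v, (∀ w, g v w = 0) → v = 0
  compatible : ∀ v w, g (φ v) (φ w) = -g v w + η v * η w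

/-- The vector `(2σ)⁻¹ (a - η(a) ξ)`; for `a` the gradient of `σ` this is the horizontal part of
the gradient of `½ log |σ|`. -/
def gaugeVector (ξ : V) (η : V →L[ℝ] ℝ) (σ : ℝ) (a : V) : V :=
  (1 / (2 * σ)) • (a - η a • ξ)

/-- The metric of the gauge-transformed structure, with `ζ` as in the formula for the new Reeb
field `σ⁻¹ (ξ + ζ)`. -/
def gaugeMetric (η : V →L[ℝ] ℝ) (g : V →L[ℝ] V →L[ℝ] ℝ) (σ : ℝ) (ζ : V) : V →L[ℝ] V →L[ℝ] ℝ :=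
  σ • (g - η.smulRight (g ζ) - (g ζ).smulRight η)
    + (σ * (σ - 1 + g ζ ζ)) • η.smulRight η

lemma gaugeMetric_apply (η : V →L[ℝ] ℝ) (g : V →L[ℝ] V →L[ℝ] ℝ) (σ : ℝ) (ζ v w : V) :
    gaugeMetric η g σ ζ v w = σ * (g v w - η v * g ζ w - g ζ v * η w)
      + σ * (σ - 1 + g ζ ζ) * (η v * η w) := by
  simp [gaugeMetric]

variable {φ : V →L[ℝ] V} {ξ : V} {η : V →L[ℝ] ℝ} {g : V →L[ℝ] V →L[ℝ] ℝ}

namespace PointwiseMetric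

variable (H : PointwiseMetric φ ξ η g)
include H

lemma g_ξ (v : V) : g v ξ = η v := by
  have h := H.compatible v ξ
  simp only [H.φ_ξ, map_zero, H.η_ξ] at h
  linarith

lemma g_φ (v w : V) : g (φ v) w = -g v (φ w) := by
  have h := H.compatible v (φ w)
  simp only [H.φ_φ, map_sub, map_smul, smul_eq_mul, H.η_φ, H.g_ξ] at h
  linarith

variable (σ : ℝ) (a : V)

lemma η_gaugeVector : η (gaugeVector ξ η σ a) = 0 := by
  simp [gaugeVector, H.η_ξ]

lemma g_gaugeVector (v : V) :
    g (gaugeVector ξ η σ a) v = 1 / (2 * σ) * (g a v - η a * η v) := by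
  have : g ξ v = η v := by rw [H.symm, H.g_ξ]
  simp [gaugeVector, this]

variable {σ} (hσ : σ ≠ 0)
include hσ

/-- The contact condition for the gauge-transformed structure:
`g'(v, φ' w) = σ g(v, φ w) + ½ (dσ ∧ η)(v, w)`. -/
lemma gaugeMetric_gauge (v w : V) :
    gaugeMetric η g σ (-φ (gaugeVector ξ η σ a)) v (φ w + η w • gaugeVector ξ η σ a)
      = σ * g v (φ w) + 1 / 2 * (g a v * η w - g a w * η v) := by
  have hs := H.η_gaugeVector σ a
  have hgs := H.g_gaugeVector σ a
  set s := gaugeVector ξ η σ a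
  have hζ : ∀ w, g (-φ s) w = g s (φ w) := fun w => by simp [H.g_φ]
  have hφs : φ (φ s) = s := by simp [H.φ_φ, hs]
  have h1 : g s (φ (φ w)) = g s w := by simp [H.φ_φ, H.g_ξ, hs]
  rw [gaugeMetric_apply, hζ]
  have h2 : g s (φ s) = 0 := by
    have h3 := H.g_φ s s
    rw [H.symm] at h3
    linarith
  simp only [map_add, map_smul, smul_eq_mul, h1, h2, H.η_φ, hs]
  rw [H.symm v s, hgs, hgs]
  field_simp
  ring

variable [IsTopologicalAddGroup V] [ContinuousSMul ℝ V]

/-- The gauge transformation by `σ` of the structure on a tangent space; `a` is the gradient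
of `σ`. -/
lemma gauge :
    PointwiseMetric (φ + η.smulRight (gaugeVector ξ η σ a))
      (σ⁻¹ • (ξ - φ (gaugeVector ξ η σ a))) (σ • η)
      (gaugeMetric η g σ (-φ (gaugeVector ξ η σ a))) := by
  have hs := H.η_gaugeVector σ a
  set s := gaugeVector ξ η σ a
  have hφs : φ (φ s) = s := by simp [H.φ_φ, hs]
  have hζ : ∀ w, g (-φ s) w = g s (φ w) := fun w => by simp [H.g_φ]
  have hη' : ∀ v, η (φ v + η v • s) = 0 := fun v => by simp [H.η_φ, hs]
  have comp : ∀ v w, gaugeMetric η g σ (-φ s) (φ v + η v • s) (φ w + η w • s)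
      = -gaugeMetric η g σ (-φ s) v w + (σ * η v) * (σ * η w) := by
    intro v w
    have hss : g (-φ s) (-φ s) = -g s s := by rw [hζ, map_neg, hφs, map_neg]
    rw [gaugeMetric_apply, gaugeMetric_apply, hη', hη', hss, hζ w, hζ v]
    simp only [map_add, map_smul, _root_.add_apply, _root_.smul_apply, smul_eq_mul, H.compatible]
    rw [H.symm (φ v) s]
    ring
  have symm : ∀ v w, gaugeMetric η g σ (-φ s) v w = gaugeMetric η g σ (-φ s) w v := by
    intro v w
    rw [gaugeMetric_apply, gaugeMetric_apply, H.symm v w]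
    ring
  have φξ : (φ + η.smulRight s) (σ⁻¹ • (ξ - φ s)) = 0 := by
    simp [H.φ_ξ, H.η_ξ, H.η_φ, hφs]
  refine ⟨φξ, fun v => by simp [H.η_φ, hs], by simp [H.η_ξ, H.η_φ, hσ], fun v => ?_, symm,
    fun v hv => ?_, fun v w => by simpa using comp v w⟩
  · simp only [_root_.add_apply, ContinuousLinearMap.smulRight_apply]
    rw [hη', map_add, map_smul, H.φ_φ, zero_smul, add_zero, _root_.smul_apply, smul_smul,
      smul_eq_mul]
    rw [mul_right_comm, mul_inv_cancel₀ hσ, one_mul, smul_sub]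
    abel
  · -- if `v` is in the radical, pairing with the new Reeb vector shows `η v = 0`
    have h1 := comp v (σ⁻¹ • (ξ - φ s))
    have h2 : φ (σ⁻¹ • (ξ - φ s)) + η (σ⁻¹ • (ξ - φ s)) • s = 0 := φξ
    rw [h2, map_zero, hv] at h1
    have h3 : η v = 0 := by simpa [hσ, H.η_ξ, H.η_φ] using h1
    refine H.nondegenerate v fun w => ?_
    have h4 := hv (w - η w • ξ)
    rw [gaugeMetric_apply] at h4
    simpa [h3, H.η_ξ, hσ, H.g_ξ] using h4

variable {φ' : V →L[ℝ] V} {ξ' : V} {g' : V →L[ℝ] V →L[ℝ] ℝ}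

/-- The gauge-transformed structure is determined by its contact form `σ η`, by `φ'` on the
kernel of `η`, and by the contact condition. -/
lemma gauge_unique (H' : PointwiseMetric φ' ξ' (σ • η) g')
    (hφ : ∀ v, η v = 0 → φ' v = φ v)
    (hc : ∀ v w, g' v (φ' w) = σ * g v (φ w) + 1 / 2 * (g a v * η w - g a w * η v)) :
    φ' = φ + η.smulRight (gaugeVector ξ η σ a) ∧
      ξ' = σ⁻¹ • (ξ - φ (gaugeVector ξ η σ a)) ∧
      g' = gaugeMetric η g σ (-φ (gaugeVector ξ η σ a)) := by
  have G := H.gauge a hσ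
  have hs := H.η_gaugeVector σ a
  have hξ' : η ξ' = σ⁻¹ := by
    have h := H'.η_ξ
    rw [_root_.smul_apply, smul_eq_mul] at h
    exact eq_inv_of_mul_eq_one_right h
  have hcg := H.gaugeMetric_gauge a hσ
  set s := gaugeVector ξ η σ a with s_def
  -- the contact condition at `ξ'`, where its left-hand side vanishes, determines `φ ξ'`
  have h1 : σ • φ ξ' + (1 / 2 * σ⁻¹) • a - (1 / 2 * g a ξ') • ξ = 0 := by
    refine H.nondegenerate _ fun v => ?_
    have h := hc v ξ'
    rw [H'.φ_ξ, map_zero, hξ'] at h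
    have h5 : g ξ v = η v := by rw [H.symm, H.g_ξ]
    have h6 : g (φ ξ') v = g v (φ ξ') := H.symm _ _
    simp only [map_sub, map_add, map_smul, _root_.sub_apply,
      _root_.add_apply, _root_.smul_apply, smul_eq_mul, h5, h6]
    linarith
  have h2 : g a ξ' = σ⁻¹ * η a := by
    have h := congrArg η h1
    simp only [map_sub, map_add, map_smul, smul_eq_mul, H.η_φ, H.η_ξ, map_zero] at h
    linarith
  have h3 : φ ξ' = -(σ⁻¹ • s) := by
    have h4 : σ • φ ξ' = -s := by
      rw [h2] at h1
      rw [← sub_eq_zero, ← h1, s_def, gaugeVector]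
      match_scalars <;> field_simp
    rw [← smul_neg, ← h4, inv_smul_smul₀ hσ]
  have hξ : ξ' = σ⁻¹ • (ξ - φ s) := by
    have h := H.φ_φ ξ'
    rw [h3, hξ'] at h
    have h5 : ξ' = φ (-(σ⁻¹ • s)) + σ⁻¹ • ξ := by rw [h]; abel
    rw [h5, map_neg, map_smul, smul_sub]
    abel
  -- split `v` along the kernel of `η` and the new Reeb vector, which `φ'` annihilates
  have hφ' : ∀ v, φ' v = φ v + η v • s := by
    intro v
    have h := hφ (v - (σ * η v) • ξ') (by
      rw [map_sub, map_smul, hξ', smul_eq_mul]; field_simp; ring)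
    rw [map_sub, map_sub, map_smul, map_smul, H'.φ_ξ, h3, smul_zero, sub_zero] at h
    rw [h, smul_neg, smul_smul, mul_right_comm, mul_inv_cancel₀ hσ, one_mul, sub_neg_eq_add]
  refine ⟨ContinuousLinearMap.ext fun v => by simp [hφ'], hξ, ?_⟩
  refine ContinuousLinearMap.ext fun v => ContinuousLinearMap.ext fun w => ?_
  -- `w` is in the span of the image of `φ'` and the Reeb vector, where `g' v` is known
  have e1 : w = φ' (φ' w) + (σ * η w) • ξ' := by
    rw [H'.φ_φ]; simp
  have h5 := hc v (φ' w)
  have h6 := hcg v (φ' w)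
  rw [← hφ'] at h6
  have h7 := G.g_ξ v
  rw [← hξ] at h7
  rw [e1, map_add, map_add, map_smul, map_smul, H'.g_ξ, h7, h5, h6]

end PointwiseMetric

end Pointwise

/-! ### Smoothness of matrices of functions -/

lemma contDiffOn_det {E ι : Type*} [NormedAddCommGroup E] [NormedSpace ℝ E] [Fintype ι]
    [DecidableEq ι] {U : Set E} {A : E → Matrix ι ι ℝ}
    (hA : ∀ i j, ContDiffOn ℝ ∞ (fun u => A u i j) U) :
    ContDiffOn ℝ ∞ (fun u => (A u).det) U := by
  simp only [Matrix.det_apply']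
  exact ContDiffOn.sum fun p _ => contDiffOn_const.mul (contDiffOn_prod fun i _ => hA _ _)

lemma contDiffOn_inv {E ι : Type*} [NormedAddCommGroup E] [NormedSpace ℝ E] [Fintype ι]
    [DecidableEq ι] {U : Set E} {A : E → Matrix ι ι ℝ}
    (hA : ∀ i j, ContDiffOn ℝ ∞ (fun u => A u i j) U) (h0 : ∀ u ∈ U, (A u).det ≠ 0) (i j : ι) :
    ContDiffOn ℝ ∞ (fun u => (A u)⁻¹ i j) U := by
  simp only [Matrix.inv_def, Ring.inverse_eq_inv', Matrix.smul_apply, smul_eq_mul,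
    Matrix.adjugate_apply]
  refine ((contDiffOn_det hA).inv h0).mul (contDiffOn_det fun k l => ?_)
  simp only [Matrix.updateRow_apply]
  split_ifs
  · exact contDiffOn_const
  · exact hA k l

/-! ### Smooth sections -/

section SmulRight

variable {N : ℕ} {M : Type*} [TopologicalSpace M] [ChartedSpace (EuclideanSpace ℝ (Fin N)) M]
  [IsManifold (𝓡 N) ∞ M] {F : Type*} [NormedAddCommGroup F] [NormedSpace ℝ F] {B : M → Type*}
  [TopologicalSpace (Bundle.TotalSpace F B)] [∀ x, TopologicalSpace (B x)]
  [∀ x, AddCommGroup (B x)] [∀ x, Module ℝ (B x)] [∀ x, IsTopologicalAddGroup (B x)]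
  [∀ x, ContinuousSMul ℝ (B x)] [FiberBundle F B] [VectorBundle ℝ F B]

/-- The tensor product of a smooth covector field and a smooth section is smooth. -/
lemma contMDiffAt_smulRight {α : ∀ x : M, TangentSpace (𝓡 N) x →L[ℝ] ℝ} {s : ∀ x : M, B x} {x : M}
    (hα : ContMDiffAt (𝓡 N) ((𝓡 N).prod 𝓘(ℝ, EuclideanSpace ℝ (Fin N) →L[ℝ] ℝ)) ∞
      (fun y => Bundle.TotalSpace.mk' (EuclideanSpace ℝ (Fin N) →L[ℝ] ℝ)
        (E := fun y : M => TangentSpace (𝓡 N) y →L[ℝ] Bundle.Trivial M ℝ y) y (α y)) x)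
    (hs : ContMDiffAt (𝓡 N) ((𝓡 N).prod 𝓘(ℝ, F)) ∞ (fun y => Bundle.TotalSpace.mk' F y (s y)) x) :
    ContMDiffAt (𝓡 N) ((𝓡 N).prod 𝓘(ℝ, EuclideanSpace ℝ (Fin N) →L[ℝ] F)) ∞
      (fun y => Bundle.TotalSpace.mk' (EuclideanSpace ℝ (Fin N) →L[ℝ] F)
        (E := fun y : M => TangentSpace (𝓡 N) y →L[ℝ] B y) y ((α y).smulRight (s y))) x := by
  have h1 := ((contMDiffAt_hom_bundle _).1 hα).2
  have h2 := (Bundle.contMDiffAt_totalSpace.1 hs).2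
  refine (contMDiffAt_hom_bundle _).2 ⟨contMDiffAt_id, ?_⟩
  have hb : ContDiff ℝ ∞ (fun p : (EuclideanSpace ℝ (Fin N) →L[ℝ] ℝ) × F => p.1.smulRight p.2) :=
    isBoundedBilinearMap_smulRight.contDiff
  have h3 := hb.contDiffAt.contMDiffAt.comp x (h1.prodMk_space h2)
  refine h3.congr_of_eventuallyEq ?_
  have hB := (trivializationAt F B x).open_baseSet.mem_nhds
    (FiberBundle.mem_baseSet_trivializationAt' x)
  filter_upwards [hB] with y hy
  refine ContinuousLinearMap.ext fun v => ?_
  simp [ContinuousLinearMap.inCoordinates, Bundle.Trivial.continuousLinearMapAt_trivialization]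
  rw [(trivializationAt F B x).coe_linearMapAt_of_mem (R := ℝ) hy]

end SmulRight

section Pointwise

variable {V : Type*} [AddCommGroup V] [Module ℝ V] [TopologicalSpace V] [FiniteDimensional ℝ V]
  {φ : V →L[ℝ] V} {ξ : V} {η : V →L[ℝ] ℝ} {g : V →L[ℝ] V →L[ℝ] ℝ}

/-- A nondegenerate form represents every covector. -/
lemma PointwiseMetric.exists_gradient (H : PointwiseMetric φ ξ η g) (α : V →L[ℝ] ℝ) :
    ∃ a, ∀ v, g a v = α v := by
  let f : V →ₗ[ℝ] Module.Dual ℝ V :=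
    { toFun := fun v => (g v).toLinearMap
      map_add' := fun v w => by ext; simp
      map_smul' := fun c v => by ext; simp }
  have hf : Function.Injective f := by
    refine (injective_iff_map_eq_zero f).2 fun v hv => H.nondegenerate v fun w => ?_
    exact congrArg (fun l : Module.Dual ℝ V => l w) hv
  obtain ⟨a, ha⟩ := (LinearMap.injective_iff_surjective_of_finrank_eq_finrank
    (Subspace.dual_finrank_eq (K := ℝ) (V := V)).symm).1 hf α.toLinearMap
  exact ⟨a, fun v => congrArg (fun l : Module.Dual ℝ V => l v) ha⟩

end Pointwise

/-! ### Components in a chart -/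

section Components

variable {N : ℕ} {M : Type*} [TopologicalSpace M] [ChartedSpace (EuclideanSpace ℝ (Fin N)) M]

/-- The coordinate differential `dx^i` at the point with coordinates `u`. -/
def coordForm (e : OpenPartialHomeomorph M (EuclideanSpace ℝ (Fin N))) (i : Fin N)
    (u : EuclideanSpace ℝ (Fin N)) : TangentSpace (𝓡 N) (e.symm u) →L[ℝ] ℝ :=
  (EuclideanSpace.proj (𝕜 := ℝ) i).comp (mvfderiv (𝓡 N) e (e.symm u))

lemma coordComp_eq (e : OpenPartialHomeomorph M (EuclideanSpace ℝ (Fin N))) (i : Fin N)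
    (u : EuclideanSpace ℝ (Fin N)) (v : TangentSpace (𝓡 N) (e.symm u)) :
    coordComp e i u v = coordForm e i u v := rfl

variable {e : OpenPartialHomeomorph M (EuclideanSpace ℝ (Fin N))}
  (he : e ∈ IsManifold.maximalAtlas (𝓡 N) ∞ M) {u : EuclideanSpace ℝ (Fin N)} (hu : u ∈ e.target)
include he hu

lemma apply_eq_sum (α : TangentSpace (𝓡 N) (e.symm u) →L[ℝ] ℝ) (v : TangentSpace (𝓡 N) (e.symm u)) :
    α v = ∑ i, α (coordVector e i u) * coordComp e i u v := by
  conv_lhs => rw [← sum_coordComp_smul_coordVector he hu v]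
  simp [mul_comm]

end Components

namespace ParacontactMetric

variable {n : ℕ} {M : Type*} [TopologicalSpace M]
  [ChartedSpace (EuclideanSpace ℝ (Fin (2 * n + 1))) M] [IsManifold (𝓡 (2 * n + 1)) ∞ M]
  (S : ParacontactMetric n M)

lemma pointwise (x : M) : PointwiseMetric (S.φ x) (S.ξ x) (S.η x) (S.g x) :=
  ⟨S.φ_ξ x, S.η_φ x, S.η_ξ x, S.φ_φ x, S.g_symm x, S.g_nondegenerate x, S.g_compatible x⟩

lemma contMDiffAt_η_apply {V : ∀ y : M, TangentSpace (𝓡 (2 * n + 1)) y} {x : M}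
    (hV : SmoothVectorAt V x) :
    ContMDiffAt (𝓡 (2 * n + 1)) 𝓘(ℝ, ℝ) ∞ (fun y => S.η y (V y)) x := by
  have h := ContMDiffAt.clm_bundle_apply (F₁ := EuclideanSpace ℝ (Fin (2 * n + 1))) (F₂ := ℝ)
    (E₁ := (TangentSpace (𝓡 (2 * n + 1)) : M → Type _))
    (E₂ := Bundle.Trivial M ℝ) (S.smooth_η x) hV
  exact (Bundle.contMDiffAt_totalSpace.1 h).2

lemma smoothVectorAt_φ_apply {V : ∀ y : M, TangentSpace (𝓡 (2 * n + 1)) y} {x : M}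
    (hV : SmoothVectorAt V x) : SmoothVectorAt (fun y => S.φ y (V y)) x :=
  ContMDiffAt.clm_bundle_apply (S.smooth_φ x) hV

lemma contMDiffAt_g_apply {V W : ∀ y : M, TangentSpace (𝓡 (2 * n + 1)) y} {x : M}
    (hV : SmoothVectorAt V x) (hW : SmoothVectorAt W x) :
    ContMDiffAt (𝓡 (2 * n + 1)) 𝓘(ℝ, ℝ) ∞ (fun y => S.g y (V y) (W y)) x := by
  have h := ContMDiffAt.clm_bundle_apply₂ (F₁ := EuclideanSpace ℝ (Fin (2 * n + 1)))
    (F₂ := EuclideanSpace ℝ (Fin (2 * n + 1))) (F₃ := ℝ)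
    (E₁ := (TangentSpace (𝓡 (2 * n + 1)) : M → Type _))
    (E₂ := (TangentSpace (𝓡 (2 * n + 1)) : M → Type _))
    (E₃ := Bundle.Trivial M ℝ) (S.smooth_g x) hV hW
  exact (Bundle.contMDiffAt_totalSpace.1 h).2

end ParacontactMetric

/-! ### The gradient, and uniqueness of gauge transformations -/

namespace ParacontactMetric

variable {n : ℕ} {M : Type*} [TopologicalSpace M]
  [ChartedSpace (EuclideanSpace ℝ (Fin (2 * n + 1))) M] [IsManifold (𝓡 (2 * n + 1)) ∞ M]
  (S : ParacontactMetric n M)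

instance finiteDimensional_tangentSpace (N : ℕ) {M : Type*} [TopologicalSpace M]
    [ChartedSpace (EuclideanSpace ℝ (Fin N)) M] (x : M) :
    FiniteDimensional ℝ (TangentSpace (𝓡 N) x) :=
  inferInstanceAs (FiniteDimensional ℝ (EuclideanSpace ℝ (Fin N)))

/-- The gradient of a function with respect to the metric of a paracontact metric structure. -/
def grad (f : M → ℝ) (x : M) : TangentSpace (𝓡 (2 * n + 1)) x :=
  ((S.pointwise x).exists_gradient (mvfderiv (𝓡 (2 * n + 1)) f x)).choose

lemma g_grad (f : M → ℝ) (x : M) (v : TangentSpace (𝓡 (2 * n + 1)) x) :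
    S.g x (S.grad f x) v = mvfderiv (𝓡 (2 * n + 1)) f x v :=
  ((S.pointwise x).exists_gradient (mvfderiv (𝓡 (2 * n + 1)) f x)).choose_spec v

section Chart

variable {e : OpenPartialHomeomorph M (EuclideanSpace ℝ (Fin (2 * n + 1)))}
  (he : e ∈ IsManifold.maximalAtlas (𝓡 (2 * n + 1)) ∞ M)
include he

lemma contDiffOn_gComp (i j : Fin (2 * n + 1)) :
    ContDiffOn ℝ ∞ (fun u => S.gComp e u i j) e.target := by
  refine (contDiffOn_comp_symm he fun x hx => S.contMDiffAt_g_apply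
    (smoothVectorAt_coordField he i hx) (smoothVectorAt_coordField he j hx)).congr fun u hu => ?_
  simp only [coordField_symm he hu]
  rfl

lemma contDiffOn_ηComp (i : Fin (2 * n + 1)) : ContDiffOn ℝ ∞ (S.ηComp e i) e.target := by
  refine (contDiffOn_comp_symm he fun x hx => S.contMDiffAt_η_apply
    (smoothVectorAt_coordField he i hx)).congr fun u hu => ?_
  simp only [coordField_symm he hu]
  rfl

lemma contDiffOn_ξComp (i : Fin (2 * n + 1)) : ContDiffOn ℝ ∞ (S.ξComp e i) e.target :=
  contDiffOn_coordComp he (fun x _ => S.smooth_ξ x) i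

lemma contDiffOn_φComp (i j : Fin (2 * n + 1)) : ContDiffOn ℝ ∞ (S.φComp e i j) e.target := by
  refine (contDiffOn_coordComp he (fun x hx => S.smoothVectorAt_φ_apply
    (smoothVectorAt_coordField he j hx)) i).congr fun u hu => ?_
  simp only [coordField_symm he hu]
  rfl

section Point

variable {u : EuclideanSpace ℝ (Fin (2 * n + 1))} (hu : u ∈ e.target)
include hu

lemma g_coordVector (i : Fin (2 * n + 1)) (v : TangentSpace (𝓡 (2 * n + 1)) (e.symm u)) :
    S.g (e.symm u) (coordVector e i u) v = ∑ j, S.gComp e u i j * coordComp e j u v :=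
  apply_eq_sum he hu _ v

lemma det_gComp_ne_zero : (S.gComp e u).det ≠ 0 := by
  intro h
  obtain ⟨c, hc, h0⟩ := Matrix.exists_mulVec_eq_zero_iff.2 h
  set v : TangentSpace (𝓡 (2 * n + 1)) (e.symm u) := ∑ j, c j • coordVector e j u with hv
  have hvc : ∀ i, coordComp e i u v = c i := fun i => by
    simp only [hv, coordComp_eq, map_sum, map_smul]
    simp only [← coordComp_eq, coordComp_coordVector he hu]
    simp
  refine hc (funext fun i => ?_)
  rw [← hvc i, S.g_nondegenerate _ v fun w => ?_, coordComp_eq, map_zero, Pi.zero_apply]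
  rw [apply_eq_sum he hu]
  refine Finset.sum_eq_zero fun i _ => ?_
  rw [S.g_symm, S.g_coordVector he hu]
  have h1 : ∑ j, S.gComp e u i j * c j = 0 := congrFun h0 i
  simp only [hvc, h1, zero_mul]

omit [IsManifold (𝓡 (2 * n + 1)) ∞ M] in
lemma dComp_eq {f : M → ℝ} (hf : MDifferentiableAt (𝓡 (2 * n + 1)) 𝓘(ℝ, ℝ) f (e.symm u))
    (i : Fin (2 * n + 1)) :
    dComp e f i u = mvfderiv (𝓡 (2 * n + 1)) f (e.symm u) (coordVector e i u) :=
  pd_comp_symm he hu hf i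

lemma coordComp_grad {f : M → ℝ} (hf : MDifferentiableAt (𝓡 (2 * n + 1)) 𝓘(ℝ, ℝ) f (e.symm u))
    (i : Fin (2 * n + 1)) : coordComp e i u (S.grad f (e.symm u)) = S.gradComp e f i u := by
  have h : S.gComp e u *ᵥ (fun j => coordComp e j u (S.grad f (e.symm u)))
      = fun j => dComp e f j u := by
    funext j
    rw [dComp_eq he hu hf, ← S.g_grad, S.g_symm, S.g_coordVector he hu]
    rfl
  have h2 := congrArg (fun w => (S.gComp e u)⁻¹ *ᵥ w) h
  simp only [Matrix.mulVec_mulVec, Matrix.nonsing_inv_mul _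
    (isUnit_iff_ne_zero.2 (S.det_gComp_ne_zero he hu)), Matrix.one_mulVec] at h2
  exact congrFun h2 i

end Point

omit [IsManifold (𝓡 (2 * n + 1)) ∞ M] in
lemma contDiffOn_dComp {f : M → ℝ} (hf : ContMDiff (𝓡 (2 * n + 1)) 𝓘(ℝ, ℝ) ∞ f)
    (i : Fin (2 * n + 1)) : ContDiffOn ℝ ∞ (dComp e f i) e.target :=
  ((contDiffOn_comp_symm he fun x _ => hf x).fderiv_of_isOpen e.open_target (by simp)).clm_apply
    contDiffOn_const

lemma contDiffOn_gComp_inv (i j : Fin (2 * n + 1)) :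
    ContDiffOn ℝ ∞ (fun u => (S.gComp e u)⁻¹ i j) e.target :=
  contDiffOn_inv (S.contDiffOn_gComp he) (fun _ hu => S.det_gComp_ne_zero he hu) i j

end Chart

lemma smoothVectorAt_grad {f : M → ℝ} (hf : ContMDiff (𝓡 (2 * n + 1)) 𝓘(ℝ, ℝ) ∞ f) (x : M) :
    SmoothVectorAt (S.grad f) x := by
  have he : chartAt (EuclideanSpace ℝ (Fin (2 * n + 1))) x ∈
    IsManifold.maximalAtlas (𝓡 (2 * n + 1)) ∞ M := IsManifold.chart_mem_maximalAtlas x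
  refine smoothVectorAt_of_coordComp he (fun i => ?_) (mem_chart_source _ x)
  refine ContDiffOn.congr (ContDiffOn.sum (s := Finset.univ) fun j _ =>
    (S.contDiffOn_gComp_inv he i j).mul (contDiffOn_dComp he hf j)) fun u hu => ?_
  exact S.coordComp_grad he hu ((hf _).mdifferentiableAt (by simp)) i

variable {S} {σ : M → ℝ}

/-- `d(ση) = σ dη + ½ dσ ∧ η`, where `dη(X, Y) = g(X, φ Y)` and `dσ` is given by the gradient. -/
lemma dForm_smul (hσ : ContMDiff (𝓡 (2 * n + 1)) 𝓘(ℝ, ℝ) ∞ σ) {x : M}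
    {X Y : ∀ y : M, TangentSpace (𝓡 (2 * n + 1)) y} (hX : SmoothVectorAt X x)
    (hY : SmoothVectorAt Y x) :
    dForm (fun y => σ y • S.η y) X Y x = σ x * S.g x (X x) (S.φ x (Y x)) + 1 / 2 *
      (S.g x (S.grad σ x) (X x) * S.η x (Y x) - S.g x (S.grad σ x) (Y x) * S.η x (X x)) := by
  rw [S.g_contact x X Y hX hY, S.g_grad, S.g_grad]
  have hs := (hσ x).mdifferentiableAt (by simp)
  have h1 := mvfderiv_mul hs ((S.contMDiffAt_η_apply hX).mdifferentiableAt (by simp))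
  have h2 := mvfderiv_mul hs ((S.contMDiffAt_η_apply hY).mdifferentiableAt (by simp))
  simp only [dForm, _root_.smul_apply, smul_eq_mul]
  have h1' := congrArg (fun L => L (Y x)) h1
  have h2' := congrArg (fun L => L (X x)) h2
  simp only [_root_.add_apply, _root_.smul_apply, smul_eq_mul] at h1' h2'
  erw [h1', h2']
  ring

/-- The tensors of a gauge transformation are determined by the scaling function. -/
lemma gauge_eq (hσ : ContMDiff (𝓡 (2 * n + 1)) 𝓘(ℝ, ℝ) ∞ σ) (hσ0 : ∀ x, σ x ≠ 0)
    {S' : ParacontactMetric n M} (h : IsGauge σ S S') (x : M) :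
    S'.φ x = S.φ x + (S.η x).smulRight (gaugeVector (S.ξ x) (S.η x) (σ x) (S.grad σ x)) ∧
      S'.ξ x = (σ x)⁻¹ • (S.ξ x
        - S.φ x (gaugeVector (S.ξ x) (S.η x) (σ x) (S.grad σ x))) ∧
      S'.g x = gaugeMetric (S.η x) (S.g x) (σ x)
        (-S.φ x (gaugeVector (S.ξ x) (S.η x) (σ x) (S.grad σ x))) := by
  have h' := S'.pointwise x
  rw [h.η_eq] at h'
  refine (S.pointwise x).gauge_unique _ (hσ0 x) h' (h.φ_eq x) fun v w => ?_
  obtain ⟨X, hX, rfl⟩ := exists_smoothVectorAt x v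
  obtain ⟨Y, hY, rfl⟩ := exists_smoothVectorAt x w
  rw [S'.g_contact x X Y hX hY, ← dForm_smul hσ hX hY, funext h.η_eq]

end ParacontactMetric

/-! ### Existence of gauge transformations -/

/-- On the kernel of `η` the endomorphisms `φ` and `φ + η ⊗ s` have the same eigenvectors. -/
lemma ker_inf_eigenspace_smulRight {V : Type*} [AddCommGroup V] [Module ℝ V] [TopologicalSpace V]
    [IsTopologicalAddGroup V] [ContinuousSMul ℝ V] (φ : V →L[ℝ] V) (η : V →L[ℝ] ℝ) (s : V) {σ : ℝ}
    (hσ : σ ≠ 0) (c : ℝ) :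
    LinearMap.ker (σ • η).toLinearMap ⊓ Module.End.eigenspace (φ + η.smulRight s).toLinearMap c
      = LinearMap.ker η.toLinearMap ⊓ Module.End.eigenspace φ.toLinearMap c := by
  ext v
  simp only [Submodule.mem_inf, LinearMap.mem_ker, Module.End.mem_eigenspace_iff,
    ContinuousLinearMap.coe_coe, _root_.smul_apply, _root_.add_apply, smul_eq_mul,
    ContinuousLinearMap.smulRight_apply, mul_eq_zero, hσ, false_or]
  exact and_congr_right fun h => by simp [h]

namespace ParacontactMetric

variable {n : ℕ} {M : Type*} [TopologicalSpace M]
  [ChartedSpace (EuclideanSpace ℝ (Fin (2 * n + 1))) M] [IsManifold (𝓡 (2 * n + 1)) ∞ M]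
  (S : ParacontactMetric n M) {σ : M → ℝ} (hσ : ContMDiff (𝓡 (2 * n + 1)) 𝓘(ℝ, ℝ) ∞ σ)
  (hσ0 : ∀ x, σ x ≠ 0)

/-- The horizontal part of the gradient of `½ log |σ|`, as a vector field. -/
def gaugeField (σ : M → ℝ) (x : M) : TangentSpace (𝓡 (2 * n + 1)) x :=
  gaugeVector (S.ξ x) (S.η x) (σ x) (S.grad σ x)

include hσ hσ0 in
lemma smoothVectorAt_gaugeField (x : M) : SmoothVectorAt (S.gaugeField σ) x := by
  have h1 : ContMDiffAt (𝓡 (2 * n + 1)) 𝓘(ℝ, ℝ) ∞ (fun y => 1 / (2 * σ y)) x :=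
    (contMDiffAt_const.div₀ (contMDiffAt_const.mul (hσ x)) (by simp [hσ0 x]))
  have h2 := S.smoothVectorAt_grad hσ x
  exact h1.smul_section (h2.sub_section ((S.contMDiffAt_η_apply h2).smul_section (S.smooth_ξ x)))

lemma contMDiffAt_gaugeMetric {f : M → ℝ} {ζ : ∀ y : M, TangentSpace (𝓡 (2 * n + 1)) y} {x : M}
    (hf : ContMDiffAt (𝓡 (2 * n + 1)) 𝓘(ℝ, ℝ) ∞ f x) (hζ : SmoothVectorAt ζ x) :
    ContMDiffAt (𝓡 (2 * n + 1))
      ((𝓡 (2 * n + 1)).prod 𝓘(ℝ, EuclideanSpace ℝ (Fin (2 * n + 1)) →L[ℝ]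
        EuclideanSpace ℝ (Fin (2 * n + 1)) →L[ℝ] ℝ)) ∞
      (fun y => Bundle.TotalSpace.mk' (EuclideanSpace ℝ (Fin (2 * n + 1)) →L[ℝ]
        EuclideanSpace ℝ (Fin (2 * n + 1)) →L[ℝ] ℝ)
        (E := fun y : M => TangentSpace (𝓡 (2 * n + 1)) y →L[ℝ]
          TangentSpace (𝓡 (2 * n + 1)) y →L[ℝ] Bundle.Trivial M ℝ y) y
        (gaugeMetric (S.η y) (S.g y) (f y) (ζ y))) x := by
  have h1 : ContMDiffAt (𝓡 (2 * n + 1))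
      ((𝓡 (2 * n + 1)).prod 𝓘(ℝ, EuclideanSpace ℝ (Fin (2 * n + 1)) →L[ℝ] ℝ)) ∞
      (fun y => Bundle.TotalSpace.mk' (EuclideanSpace ℝ (Fin (2 * n + 1)) →L[ℝ] ℝ)
        (E := fun y : M => TangentSpace (𝓡 (2 * n + 1)) y →L[ℝ] Bundle.Trivial M ℝ y) y
        (S.g y (ζ y))) x :=
    ContMDiffAt.clm_bundle_apply (S.smooth_g x) hζ
  have h2 := contMDiffAt_smulRight (S.smooth_η x) h1
  have h3 := contMDiffAt_smulRight h1 (S.smooth_η x)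
  have h4 := contMDiffAt_smulRight (S.smooth_η x) (S.smooth_η x)
  have h5 : ContMDiffAt (𝓡 (2 * n + 1)) 𝓘(ℝ, ℝ) ∞
      (fun y => f y * (f y - 1 + S.g y (ζ y) (ζ y))) x :=
    hf.mul ((hf.sub contMDiffAt_const).add (S.contMDiffAt_g_apply hζ hζ))
  have h0 : ContMDiffAt (𝓡 (2 * n + 1))
      ((𝓡 (2 * n + 1)).prod 𝓘(ℝ, EuclideanSpace ℝ (Fin (2 * n + 1)) →L[ℝ]
        EuclideanSpace ℝ (Fin (2 * n + 1)) →L[ℝ] ℝ)) ∞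
      (fun y => Bundle.TotalSpace.mk' (EuclideanSpace ℝ (Fin (2 * n + 1)) →L[ℝ]
        EuclideanSpace ℝ (Fin (2 * n + 1)) →L[ℝ] ℝ)
        (E := fun y : M => TangentSpace (𝓡 (2 * n + 1)) y →L[ℝ]
          TangentSpace (𝓡 (2 * n + 1)) y →L[ℝ] Bundle.Trivial M ℝ y) y (S.g y)) x := S.smooth_g x
  have h6 := h0.sub_section h2
  have h7 := h6.sub_section h3
  have h8 := hf.smul_section h7
  have h9 := h5.smul_section h4
  refine (h8.add_section h9).congr_of_eventuallyEq (Filter.Eventually.of_forall fun y => ?_)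
  refine congrArg (Bundle.TotalSpace.mk' _ y)
    (ContinuousLinearMap.ext fun v => ContinuousLinearMap.ext fun w => ?_)
  exact gaugeMetric_apply (S.η y) (S.g y) (f y) (ζ y) v w

/-- The gauge transformation of a paracontact metric structure by a nowhere vanishing function. -/
def gauge : ParacontactMetric n M where
  φ x := S.φ x + (S.η x).smulRight (S.gaugeField σ x)
  ξ x := (σ x)⁻¹ • (S.ξ x - S.φ x (S.gaugeField σ x))
  η x := σ x • S.η x
  g x := gaugeMetric (S.η x) (S.g x) (σ x) (-S.φ x (S.gaugeField σ x))
  smooth_φ x := (S.smooth_φ x).add_section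
    (contMDiffAt_smulRight (S.smooth_η x) (S.smoothVectorAt_gaugeField hσ hσ0 x))
  smooth_ξ x := ((hσ x).inv₀ (hσ0 x)).smul_section ((S.smooth_ξ x).sub_section
    (S.smoothVectorAt_φ_apply (S.smoothVectorAt_gaugeField hσ hσ0 x)))
  smooth_η x := (hσ x).smul_section (S.smooth_η x)
  smooth_g x := S.contMDiffAt_gaugeMetric (hσ x) ((S.smoothVectorAt_φ_apply
    (S.smoothVectorAt_gaugeField hσ hσ0 x)).neg_section)
  φ_ξ x := ((S.pointwise x).gauge _ (hσ0 x)).φ_ξ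
  η_φ x := ((S.pointwise x).gauge _ (hσ0 x)).η_φ
  η_ξ x := ((S.pointwise x).gauge _ (hσ0 x)).η_ξ
  φ_φ x := ((S.pointwise x).gauge _ (hσ0 x)).φ_φ
  g_symm x := ((S.pointwise x).gauge _ (hσ0 x)).symm
  g_nondegenerate x := ((S.pointwise x).gauge _ (hσ0 x)).nondegenerate
  g_compatible x := ((S.pointwise x).gauge _ (hσ0 x)).compatible
  finrank_pos x := by
    rw [ker_inf_eigenspace_smulRight _ _ _ (hσ0 x)]
    exact S.finrank_pos x
  finrank_neg x := by
    rw [ker_inf_eigenspace_smulRight _ _ _ (hσ0 x)]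
    exact S.finrank_neg x
  g_contact x X Y hX hY := by
    rw [dForm_smul hσ hX hY]
    exact (S.pointwise x).gaugeMetric_gauge _ (hσ0 x) _ _

end ParacontactMetric

/-! ### The components in a chart as matrices over the ring of smooth functions -/

section GaugeMatrix

variable {ι A : Type*} [Fintype ι] [DecidableEq ι] [CommRing A] [Invertible (2 : A)]
  {δ : ι → Derivation ℤ A A} {m : A} {g gi φ : Matrix ι ι A} {ξ η : ι → A}
  {g' gi' φ' : Matrix ι ι A} {ξ' η' : ι → A} {σ si : A} {s ζ z : ι → A}

theorem ParacontactMatrix.gaugeMatrix (S : ParacontactMatrix δ m g gi φ ξ η)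
    (S' : ParacontactMatrix δ m g' gi' φ' ξ' η') (hδ : ∀ i j a, δ i (δ j a) = δ j (δ i a))
    (hσ : σ * si = 1) (hs : s = (gi - vecMulVec ξ ξ) *ᵥ ((⅟2 * si) • fun i => δ i σ))
    (hζ : ζ = -(φ *ᵥ s)) (hz : z = g *ᵥ ζ) (hη' : η' = σ • η) (hξ' : σ • ξ' = ξ + ζ)
    (hφ' : φ' = φ + vecMulVec s η)
    (hg' : g' = σ • (g - vecMulVec η z - vecMulVec z η)
      + (σ * (σ - 1 + z ⬝ᵥ ζ)) • vecMulVec η η) :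
    GaugeMatrix δ m g gi φ ξ η g' gi' φ' ξ' η' σ si
      ((⅟2 * si) • ((fun i => δ i σ) ᵥ* (1 - vecMulVec ξ η))) s ζ z
      (((⅟2 * si) • ((fun i => δ i σ) ᵥ* (1 - vecMulVec ξ η))) ⬝ᵥ s) where
  fst := S
  snd := S'
  commute := hδ
  σ_mul_si := hσ
  θ_eq := rfl
  covector := by
    have H := S.paraHermitian
    refine H.horizontalCovector ?_ ?_ hζ ?_ rfl
    · rw [smul_vecMul, vecMul_vecMul, H.P_mul_P]
    · rw [hs, mulVec_smul, mulVec_smul, ← mulVec_transpose, mulVec_mulVec, H.h_mul_Pt]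
    · have hηζ : η ⬝ᵥ ζ = 0 := by
        rw [hζ, dotProduct_neg, dotProduct_mulVec, S.η_φ, zero_dotProduct, neg_zero]
      rw [hz, sub_mulVec, vecMulVec_mulVec, hηζ]
      simp
  η_eq := hη'
  ξ_eq := hξ'
  φ_eq := hφ'
  g_eq := hg'

end GaugeMatrix

section Domain

variable {N : ℕ} {M : Type*} [TopologicalSpace M] [ChartedSpace (EuclideanSpace ℝ (Fin N)) M]

/-- The coordinate domain of a chart, as an open subset of Euclidean space. -/
def coordDomain (e : OpenPartialHomeomorph M (EuclideanSpace ℝ (Fin N))) :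
    TopologicalSpace.Opens (EuclideanSpace ℝ (Fin N)) := ⟨e.target, e.open_target⟩

/-- The partial derivatives, as derivations of the ring of smooth functions. -/
def coordDeriv (U : TopologicalSpace.Opens (EuclideanSpace ℝ (Fin N))) (i : Fin N) :
    RingDerivation (smoothFunctions U) :=
  smoothFunctions.dirDeriv (EuclideanSpace.single i 1)

open smoothFunctions in
lemma ev_coordDeriv {U : TopologicalSpace.Opens (EuclideanSpace ℝ (Fin N))} {a : smoothFunctions U}
    {F : EuclideanSpace ℝ (Fin N) → ℝ} (h : ∀ x : U, ev x a = F x) (i : Fin N) (x : U) :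
    ev x (coordDeriv U i a) = pd i F x := by
  rw [coordDeriv, ev_dirDeriv, fderiv_congr_on (fun y => (ev_eq a y).symm.trans (h y)) x, pd]

end Domain

namespace ParacontactMetric

variable {n : ℕ} {M : Type*} [TopologicalSpace M]
  [ChartedSpace (EuclideanSpace ℝ (Fin (2 * n + 1))) M] [IsManifold (𝓡 (2 * n + 1)) ∞ M]
  (S : ParacontactMetric n M)
  {e : OpenPartialHomeomorph M (EuclideanSpace ℝ (Fin (2 * n + 1)))}
  (he : e ∈ IsManifold.maximalAtlas (𝓡 (2 * n + 1)) ∞ M)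

/-- The components `g_{ij}` as smooth functions. -/
def gRing : Matrix (Fin (2 * n + 1)) (Fin (2 * n + 1)) (smoothFunctions (coordDomain e)) :=
  Matrix.of fun i j => smoothFunctions.mk _ (fun u => S.gComp e u i j) (S.contDiffOn_gComp he i j)

/-- The components `g^{ij}` as smooth functions. -/
def giRing : Matrix (Fin (2 * n + 1)) (Fin (2 * n + 1)) (smoothFunctions (coordDomain e)) :=
  Matrix.of fun i j =>
    smoothFunctions.mk _ (fun u => (S.gComp e u)⁻¹ i j) (S.contDiffOn_gComp_inv he i j)

/-- The components `φ^i_j` as smooth functions. -/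
def φRing : Matrix (Fin (2 * n + 1)) (Fin (2 * n + 1)) (smoothFunctions (coordDomain e)) :=
  Matrix.of fun i j => smoothFunctions.mk _ (S.φComp e i j) (S.contDiffOn_φComp he i j)

/-- The components `ξ^i` as smooth functions. -/
def ξRing (i : Fin (2 * n + 1)) : smoothFunctions (coordDomain e) :=
  smoothFunctions.mk _ (S.ξComp e i) (S.contDiffOn_ξComp he i)

/-- The components `η_i` as smooth functions. -/
def ηRing (i : Fin (2 * n + 1)) : smoothFunctions (coordDomain e) :=
  smoothFunctions.mk _ (S.ηComp e i) (S.contDiffOn_ηComp he i)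

open smoothFunctions

lemma ev_gRing (i j : Fin (2 * n + 1)) (x : coordDomain e) :
    ev x (S.gRing he i j) = S.gComp e x i j := rfl

lemma ev_giRing (i j : Fin (2 * n + 1)) (x : coordDomain e) :
    ev x (S.giRing he i j) = (S.gComp e x)⁻¹ i j := rfl

lemma ev_φRing (i j : Fin (2 * n + 1)) (x : coordDomain e) :
    ev x (S.φRing he i j) = S.φComp e i j x := rfl

lemma ev_ξRing (i : Fin (2 * n + 1)) (x : coordDomain e) :
    ev x (S.ξRing he i) = S.ξComp e i x := rfl

lemma ev_ηRing (i : Fin (2 * n + 1)) (x : coordDomain e) :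
    ev x (S.ηRing he i) = S.ηComp e i x := rfl

section Point

variable {u : EuclideanSpace ℝ (Fin (2 * n + 1))} (hu : u ∈ e.target)
include he hu

lemma coordComp_φ (v : TangentSpace (𝓡 (2 * n + 1)) (e.symm u)) (i : Fin (2 * n + 1)) :
    coordComp e i u (S.φ (e.symm u) v) = ∑ j, S.φComp e i j u * coordComp e j u v :=
  apply_eq_sum he hu ((coordForm e i u).comp (S.φ (e.symm u))) v

lemma η_eq_sum (v : TangentSpace (𝓡 (2 * n + 1)) (e.symm u)) :
    S.η (e.symm u) v = ∑ j, S.ηComp e j u * coordComp e j u v :=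
  apply_eq_sum he hu (S.η (e.symm u)) v

/-- The contact condition in coordinates. -/
lemma contact_coord (i j : Fin (2 * n + 1)) :
    2 * ∑ k, S.gComp e u i k * S.φComp e k j u
      = pd i (S.ηComp e j) u - pd j (S.ηComp e i) u := by
  have hx : e.symm u ∈ e.source := e.map_target hu
  have hX := smoothVectorAt_coordField he i hx
  have hY := smoothVectorAt_coordField he j hx
  have h := S.g_contact _ _ _ hX hY
  have hpd : ∀ a b : Fin (2 * n + 1),
      mvfderiv (𝓡 (2 * n + 1)) (fun y => S.η y (coordField e b y)) (e.symm u) (coordVector e a u)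
        = pd a (S.ηComp e b) u := by
    intro a b
    rw [← pd_comp_symm he hu ((S.contMDiffAt_η_apply
      (smoothVectorAt_coordField he b hx)).mdifferentiableAt (by simp)), pd, pd]
    congr 1
    refine Filter.EventuallyEq.fderiv_eq ?_
    filter_upwards [e.open_target.mem_nhds hu] with w hw
    rw [coordField_symm he hw, ηComp]
  rw [dForm, mlieBracket_coordField he i j hx, coordField_symm he hu, coordField_symm he hu,
    hpd, hpd, map_zero, S.g_coordVector he hu] at h
  change ∑ k, S.gComp e u i k * S.φComp e k j u = _ at h
  rw [h]
  ring

end Point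

lemma paracontactMatrix : ParacontactMatrix (coordDeriv (coordDomain e)) (2 * (n : smoothFunctions
    (coordDomain e))) (S.gRing he) (S.giRing he) (S.φRing he) (S.ξRing he) (S.ηRing he) where
  g_symm := by
    refine Matrix.ext fun i j => ext_ev fun x => ?_
    exact S.g_symm (e.symm x) (coordVector e j x) (coordVector e i x)
  gi_mul_g := by
    refine Matrix.ext fun i j => ext_ev fun x => ?_
    have h := congrFun (congrFun (Matrix.nonsing_inv_mul (S.gComp e x)
      (isUnit_iff_ne_zero.2 (S.det_gComp_ne_zero he x.2))) i) j
    rw [Matrix.mul_apply] at h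
    simp only [Matrix.mul_apply, map_sum, map_mul, ev_gRing, ev_giRing, h, Matrix.one_apply]
    split_ifs <;> simp
  φ_ξ := by
    refine funext fun i => ext_ev fun x => ?_
    simp only [Matrix.mulVec, dotProduct, map_sum, map_mul, ev_φRing, ev_ξRing]
    refine (S.coordComp_φ he x.2 (S.ξ _) i).symm.trans ?_
    rw [S.φ_ξ, coordComp_eq, map_zero, Pi.zero_apply, map_zero]
  η_φ := by
    refine funext fun i => ext_ev fun x => ?_
    simp only [Matrix.vecMul, dotProduct, map_sum, map_mul, ev_φRing, ev_ηRing]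
    refine (S.η_eq_sum he x.2 (S.φ _ (coordVector e i x))).symm.trans ?_
    rw [S.η_φ, Pi.zero_apply, map_zero]
  η_ξ := by
    refine ext_ev fun x => ?_
    simp only [dotProduct, map_sum, map_mul, ev_ξRing, ev_ηRing]
    refine (S.η_eq_sum he x.2 (S.ξ _)).symm.trans ?_
    rw [S.η_ξ, map_one]
  φ_mul_φ := by
    refine Matrix.ext fun i j => ext_ev fun x => ?_
    simp only [Matrix.mul_apply, map_sum, map_mul, ev_φRing, Matrix.sub_apply, map_sub,
      vecMulVec_apply, ev_ξRing, ev_ηRing]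
    refine (S.coordComp_φ he x.2 (S.φ _ (coordVector e j x)) i).symm.trans ?_
    rw [S.φ_φ, coordComp_eq, map_sub, map_smul, ← coordComp_eq, ← coordComp_eq,
      coordComp_coordVector he x.2, Matrix.one_apply, smul_eq_mul,
      mul_comm (S.η _ _)]
    split_ifs <;> simp [ξComp, ηComp]
  compatible := by
    refine Matrix.ext fun i j => ext_ev fun x => ?_
    have h := S.g_compatible _ (coordVector e i x) (coordVector e j x)
    rw [apply_eq_sum he x.2 (S.g _ (S.φ _ (coordVector e i x)))] at h
    simp only [Matrix.mul_apply, map_sum, map_mul, ev_φRing, Matrix.add_apply, map_add,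
      Matrix.neg_apply, map_neg, vecMulVec_apply, ev_ηRing, ev_gRing, Matrix.transpose_apply]
    refine Eq.trans (Finset.sum_congr rfl fun k _ => ?_) h
    congr 1
    rw [S.g_symm, S.g_coordVector he x.2]
    refine Finset.sum_congr rfl fun l _ => ?_
    rw [mul_comm]
    congr 1
    exact S.g_symm _ _ _
  contact i j := by
    refine ext_ev fun x => ?_
    have h1 := ev_coordDeriv (a := S.ηRing he j) (F := S.ηComp e j) (fun _ => rfl) i x
    have h2 := ev_coordDeriv (a := S.ηRing he i) (F := S.ηComp e i) (fun _ => rfl) j x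
    simp only [Matrix.mul_apply, map_sum, map_mul, ev_φRing, ev_gRing, map_ofNat, map_sub, h1, h2]
    exact S.contact_coord he x.2 i j
  card := by simp

end ParacontactMetric

/-! ### The coordinate formulas -/

namespace ParacontactMetric

variable {n : ℕ} {M : Type*} [TopologicalSpace M]
  [ChartedSpace (EuclideanSpace ℝ (Fin (2 * n + 1))) M] [IsManifold (𝓡 (2 * n + 1)) ∞ M]
  (S : ParacontactMetric n M)
  {e : OpenPartialHomeomorph M (EuclideanSpace ℝ (Fin (2 * n + 1)))}
  (he : e ∈ IsManifold.maximalAtlas (𝓡 (2 * n + 1)) ∞ M)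

section Point

variable {u : EuclideanSpace ℝ (Fin (2 * n + 1))} (hu : u ∈ e.target) {σ : M → ℝ}
  (hσ : ContMDiff (𝓡 (2 * n + 1)) 𝓘(ℝ, ℝ) ∞ σ)
include he hu hσ

lemma η_grad : S.η (e.symm u) (S.grad σ (e.symm u)) = S.ξDeriv e σ u := by
  rw [← (S.pointwise _).g_ξ, S.g_grad, apply_eq_sum he hu, ξDeriv]
  refine Finset.sum_congr rfl fun i _ => ?_
  rw [dComp_eq he hu ((hσ _).mdifferentiableAt (by simp)), mul_comm]
  rfl

lemma coordComp_gaugeField (i : Fin (2 * n + 1)) :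
    coordComp e i u (S.gaugeField σ (e.symm u)) =
      1 / (2 * σ (e.symm u)) * (S.gradComp e σ i u - S.ξDeriv e σ u * S.ξComp e i u) := by
  rw [gaugeField, gaugeVector, S.η_grad he hu hσ, coordComp_eq, map_smul, map_sub, map_smul,
    ← coordComp_eq, S.coordComp_grad he hu ((hσ _).mdifferentiableAt (by simp))]
  rfl

lemma coordComp_ζ (k : Fin (2 * n + 1)) :
    coordComp e k u (-S.φ (e.symm u) (S.gaugeField σ (e.symm u))) = S.ζComp e σ k u := by
  have h : ∑ j, S.φComp e k j u * S.ξComp e j u = 0 := by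
    refine (S.coordComp_φ he hu (S.ξ _) k).symm.trans ?_
    rw [S.φ_ξ, coordComp_eq, map_zero]
  rw [coordComp_eq, map_neg, ← coordComp_eq, S.coordComp_φ he hu, ζComp]
  simp only [S.coordComp_gaugeField he hu hσ]
  have h2 : ∀ j, S.φComp e k j u * (1 / (2 * σ (e.symm u)) *
      (S.gradComp e σ j u - S.ξDeriv e σ u * S.ξComp e j u))
      = 1 / (2 * σ (e.symm u)) * (S.φComp e k j u * S.gradComp e σ j u)
        - 1 / (2 * σ (e.symm u)) * S.ξDeriv e σ u * (S.φComp e k j u * S.ξComp e j u) :=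
    fun j => by ring
  simp only [h2, Finset.sum_sub_distrib, ← Finset.mul_sum, h]
  ring

lemma g_ζ (i : Fin (2 * n + 1)) :
    S.g (e.symm u) (-S.φ (e.symm u) (S.gaugeField σ (e.symm u))) (coordVector e i u)
      = S.ζLower e σ i u := by
  rw [S.g_symm, S.g_coordVector he hu, ζLower]
  simp only [S.coordComp_ζ he hu hσ]

lemma g_ζ_ζ :
    S.g (e.symm u) (-S.φ (e.symm u) (S.gaugeField σ (e.symm u)))
      (-S.φ (e.symm u) (S.gaugeField σ (e.symm u))) = S.ζNormSq e σ u := by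
  rw [apply_eq_sum he hu, ζNormSq]
  simp only [S.g_ζ he hu hσ, S.coordComp_ζ he hu hσ]

variable {S} {S' : ParacontactMetric n M} (h : IsGauge σ S S') (hσ0 : ∀ x, σ x ≠ 0)
include h

omit he hu hσ in
lemma ηComp_gauge (i : Fin (2 * n + 1)) : S'.ηComp e i u = σ (e.symm u) * S.ηComp e i u := by
  rw [ηComp, h.η_eq]
  rfl

include hσ0

lemma ξComp_gauge (k : Fin (2 * n + 1)) :
    S'.ξComp e k u = 1 / σ (e.symm u) * (S.ξComp e k u + S.ζComp e σ k u) := by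
  rw [ξComp, (gauge_eq hσ hσ0 h _).2.1, ← S.coordComp_ζ he hu hσ, coordComp_eq, map_smul, map_sub,
    coordComp_eq, map_neg, one_div, ← sub_eq_add_neg]
  rfl

lemma φComp_gauge (i j : Fin (2 * n + 1)) :
    S'.φComp e i j u = S.φComp e i j u + 1 / (2 * σ (e.symm u)) *
      (S.gradComp e σ i u - S.ξDeriv e σ u * S.ξComp e i u) * S.ηComp e j u := by
  rw [φComp, (gauge_eq hσ hσ0 h _).1, ← S.coordComp_gaugeField he hu hσ, coordComp_eq,
    _root_.add_apply, map_add, ContinuousLinearMap.smulRight_apply, map_smul, smul_eq_mul,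
    mul_comm (S.η _ _)]
  rfl

lemma gComp_gauge (i j : Fin (2 * n + 1)) :
    S'.gComp e u i j =
      σ (e.symm u) * (S.gComp e u i j - S.ηComp e i u * S.ζLower e σ j u
        - S.ηComp e j u * S.ζLower e σ i u) +
      σ (e.symm u) * (σ (e.symm u) - 1 + S.ζNormSq e σ u)
        * (S.ηComp e i u * S.ηComp e j u) := by
  have h1 : S'.gComp e u i j = S'.g (e.symm u) (coordVector e i u) (coordVector e j u) := rfl
  rw [h1, (gauge_eq hσ hσ0 h _).2.2, ← S.g_ζ_ζ he hu hσ, ← S.g_ζ he hu hσ, ← S.g_ζ he hu hσ,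
    gaugeMetric_apply, mul_comm (S.ηComp e j u)]
  rfl

end Point

/-! ### The curvature of the canonical connection -/

open smoothFunctions

lemma ev_leviCivita (i j k : Fin (2 * n + 1)) (x : coordDomain e) :
    ev x (leviCivita (coordDeriv _) (S.gRing he) (S.giRing he) i k j)
      = christoffel (S.gComp e) k i j x := by
  have h : ∀ a b c, ev x (coordDeriv (coordDomain e) a (S.gRing he b c))
      = pd a (fun w => S.gComp e w b c) x := fun a b c => ev_coordDeriv (fun _ => rfl) a x
  simp only [leviCivita, of_apply, map_mul, map_sum, map_add, map_sub, h, ev_invOf_two, ev_giRing]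
  rfl

lemma ev_canonicalMatrix (i j k : Fin (2 * n + 1)) (x : coordDomain e) :
    ev x (canonicalMatrix (coordDeriv _) (S.gRing he) (S.giRing he) (S.φRing he) (S.ξRing he)
      (S.ηRing he) i k j) = S.canonicalConnection e k i j x := by
  have h1 : ∀ a b, ev x (coordDeriv (coordDomain e) a (S.ξRing he b)) = pd a (S.ξComp e b) x :=
    fun a b => ev_coordDeriv (fun _ => rfl) a x
  have h2 : ∀ a b, ev x (coordDeriv (coordDomain e) a (S.ηRing he b)) = pd a (S.ηComp e b) x :=
    fun a b => ev_coordDeriv (fun _ => rfl) a x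
  simp only [canonicalMatrix, Matrix.add_apply, Matrix.sub_apply, Matrix.smul_apply,
    vecMulVec_apply, Matrix.transpose_apply, nablaVector, nablaForm, of_apply, map_add, map_sub,
    map_mul, map_sum, smul_eq_mul, h1, h2, ev_leviCivita, ev_φRing, ev_ξRing, ev_ηRing,
    canonicalConnection, covVector, covForm]
  ring

lemma ev_curv (i j k l : Fin (2 * n + 1)) (x : coordDomain e) :
    ev x (curv (coordDeriv _) (canonicalMatrix (coordDeriv _) (S.gRing he) (S.giRing he)
      (S.φRing he) (S.ξRing he) (S.ηRing he)) i j l k)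
      = curvature (S.canonicalConnection e) i j k l x := by
  have h : ∀ a b c d, ev x (coordDeriv (coordDomain e) a (canonicalMatrix (coordDeriv _)
      (S.gRing he) (S.giRing he) (S.φRing he) (S.ξRing he) (S.ηRing he) b c d))
      = pd a (S.canonicalConnection e c b d) x :=
    fun a b c d => ev_coordDeriv (S.ev_canonicalMatrix he b d c) a x
  simp only [curv, Matrix.add_apply, Matrix.sub_apply, Matrix.map_apply, Matrix.mul_apply,
    map_add, map_sub, map_sum, map_mul, h, ev_canonicalMatrix, curvature, Finset.sum_sub_distrib]

lemma ev_scalarCurvature (x : coordDomain e) :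
    ev x (∑ i, ∑ j, (curv (coordDeriv _) (canonicalMatrix (coordDeriv _) (S.gRing he) (S.giRing he)
      (S.φRing he) (S.ξRing he) (S.ηRing he)) i j * S.giRing he) i j) = S.W₁ e x := by
  have hs : ∀ j k, (S.gComp e x)⁻¹ j k = (S.gComp e x)⁻¹ k j := fun j k =>
    congrArg (ev x) (congrFun (congrFun (S.paracontactMatrix he).gi_symm k) j)
  simp only [Matrix.mul_apply, map_sum, map_mul, ev_curv, ev_giRing, W₁, ricci, Finset.mul_sum]
  rw [Finset.sum_comm]
  refine Finset.sum_congr rfl fun j _ => ?_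
  rw [Finset.sum_comm]
  refine Finset.sum_congr rfl fun k _ => Finset.sum_congr rfl fun i _ => ?_
  rw [hs, mul_comm]

end ParacontactMetric

/-! ### Transformation of the scalar curvature -/

namespace ParacontactMetric

variable {n : ℕ} {M : Type*} [TopologicalSpace M]
  [ChartedSpace (EuclideanSpace ℝ (Fin (2 * n + 1))) M] [IsManifold (𝓡 (2 * n + 1)) ∞ M]
  {S S' : ParacontactMetric n M}
  {e : OpenPartialHomeomorph M (EuclideanSpace ℝ (Fin (2 * n + 1)))}
  (he : e ∈ IsManifold.maximalAtlas (𝓡 (2 * n + 1)) ∞ M) {σ : M → ℝ}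
  (hσ : ContMDiff (𝓡 (2 * n + 1)) 𝓘(ℝ, ℝ) ∞ σ) (hσ0 : ∀ x, σ x ≠ 0)

open smoothFunctions

/-- A function on the manifold, in a chart. -/
def funRing (hσ : ContMDiff (𝓡 (2 * n + 1)) 𝓘(ℝ, ℝ) ∞ σ) : smoothFunctions (coordDomain e) :=
  smoothFunctions.mk _ (fun u => σ (e.symm u)) (contDiffOn_comp_symm he fun x _ => hσ x)

include he hσ hσ0 in
/-- The behaviour of the scalar curvature of the canonical connection under a gauge
transformation. -/
lemma W₁_gauge (h : IsGauge σ S S') {u : EuclideanSpace ℝ (Fin (2 * n + 1))} (hu : u ∈ e.target) :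
    σ (e.symm u) * S'.W₁ e u =
      S.W₁ e u - 2 * ((n : ℝ) + 1) / σ (e.symm u) * S.laplacianD e σ u
        - ((n : ℝ) + 1) * ((n : ℝ) - 2) / σ (e.symm u) ^ 2 * S.normSqD e σ u := by
  set F : smoothFunctions (coordDomain e) := funRing he hσ
  have hinv : ContMDiff (𝓡 (2 * n + 1)) 𝓘(ℝ, ℝ) ∞ fun x => (σ x)⁻¹ :=
    fun x => (hσ x).inv₀ (hσ0 x)
  set Fi : smoothFunctions (coordDomain e) := funRing he hinv
  have evF : ∀ x : coordDomain e, ev x F = σ (e.symm x) := fun _ => rfl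
  have evFi : ∀ x : coordDomain e, ev x Fi = (σ (e.symm x))⁻¹ := fun _ => rfl
  have evdF : ∀ i (x : coordDomain e), ev x (coordDeriv _ i F) = dComp e σ i x :=
    fun i x => ev_coordDeriv (fun _ => rfl) i x
  have evddF : ∀ i j (x : coordDomain e),
      ev x (coordDeriv _ i (coordDeriv _ j F)) = pd i (dComp e σ j) x :=
    fun i j x => ev_coordDeriv (evdF j) i x
  -- `s`, `ζ`, `z` have the components of the gauge vector, of `ζ` and of its dual covector
  set s := (S.giRing he - vecMulVec (S.ξRing he) (S.ξRing he)) *ᵥ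
    ((⅟2 * Fi) • fun i => coordDeriv _ i F) with s_def
  have evs : ∀ i (x : coordDomain e), ev x (s i)
      = 1 / (2 * σ (e.symm x)) * (S.gradComp e σ i x - S.ξDeriv e σ x * S.ξComp e i x) := by
    intro i x
    simp only [s_def, Matrix.mulVec, dotProduct, map_sum, map_mul, Matrix.sub_apply, map_sub,
      vecMulVec_apply, Pi.smul_apply, smul_eq_mul, ev_invOf_two, ev_giRing, ev_ξRing, evFi, evdF,
      gradComp, ξDeriv, Finset.sum_mul, ← Finset.sum_sub_distrib, Finset.mul_sum]
    refine Finset.sum_congr rfl fun j _ => ?_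
    rw [one_div, one_div, mul_inv]
    ring
  set ζ := -(S.φRing he *ᵥ s) with ζ_def
  have evζ : ∀ i (x : coordDomain e), ev x (ζ i) = S.ζComp e σ i x := by
    intro i x
    rw [← S.coordComp_ζ he x.2 hσ, coordComp_eq, map_neg, ← coordComp_eq, S.coordComp_φ he x.2]
    simp only [ζ_def, Pi.neg_apply, Matrix.mulVec, dotProduct, map_neg, map_sum, map_mul, evs,
      ev_φRing, S.coordComp_gaugeField he x.2 hσ]
  set z := S.gRing he *ᵥ ζ with z_def
  have evz : ∀ i (x : coordDomain e), ev x (z i) = S.ζLower e σ i x := by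
    intro i x
    simp only [z_def, Matrix.mulVec, dotProduct, map_sum, map_mul, evζ, ev_gRing, ζLower]
  have T := (S.paracontactMatrix he).gaugeMatrix (S'.paracontactMatrix he)
    (fun i j a => dirDeriv_comm _ _ a) (σ := F) (si := Fi)
    (ext_ev fun x => by simp [evF, evFi, hσ0]) s_def ζ_def z_def
    (funext fun i => ext_ev fun x => by
      rw [Pi.smul_apply, smul_eq_mul, map_mul, ev_ηRing, ev_ηRing, evF, ηComp_gauge h])
    (funext fun i => ext_ev fun x => by
      rw [Pi.smul_apply, smul_eq_mul, map_mul, Pi.add_apply, map_add, ev_ξRing, ev_ξRing, evF, evζ,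
        ξComp_gauge he x.2 hσ h hσ0, ← mul_assoc, mul_one_div_cancel (hσ0 _), one_mul])
    (Matrix.ext fun i j => ext_ev fun x => by
      rw [Matrix.add_apply, vecMulVec_apply, map_add, map_mul, ev_φRing, ev_φRing, ev_ηRing, evs,
        φComp_gauge he x.2 hσ h hσ0])
    (Matrix.ext fun i j => ext_ev fun x => by
      have hq : ev x (z ⬝ᵥ ζ) = S.ζNormSq e σ x := by
        simp only [dotProduct, map_sum, map_mul, evz, evζ, ζNormSq]
      simp only [Matrix.add_apply, Matrix.sub_apply, Matrix.smul_apply, smul_eq_mul,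
        vecMulVec_apply, map_add, map_sub, map_mul, map_one, hq, evz, evF, ev_ηRing, ev_gRing]
      rw [gComp_gauge he x.2 hσ h hσ0]
      ring)
  have key := congrArg (ev ⟨u, hu⟩) T.scalar_curvature
  simp only [map_mul, map_sub, ev_scalarCurvature, map_neg, map_add, map_ofNat, map_natCast, evF,
    evFi, map_pow] at key
  simp only [map_sum, map_mul, map_sub, Matrix.sub_apply, vecMulVec_apply, evdF, evddF, ev_giRing,
    ev_ξRing, ev_leviCivita] at key
  have hL : S.laplacianD e σ u = ∑ i, ∑ j, ((S.gComp e u)⁻¹ i j - S.ξComp e i u * S.ξComp e j u) *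
      (pd i (dComp e σ j) u - ∑ s, christoffel (S.gComp e) s i j u * dComp e σ s u) := rfl
  have hN : S.normSqD e σ u = ∑ i, ∑ j, ((S.gComp e u)⁻¹ i j - S.ξComp e i u * S.ξComp e j u) *
      (dComp e σ i u * dComp e σ j u) := rfl
  rw [← hL, ← hN] at key
  rw [div_eq_mul_inv, div_eq_mul_inv, ← inv_pow]
  linarith

end ParacontactMetric

end

end Paracontact

theorem mainTheorem3 {n : ℕ} {M : Type*} [TopologicalSpace M]
    [ChartedSpace (EuclideanSpace ℝ (Fin (2 * n + 1))) M] [IsManifold (𝓡 (2 * n + 1)) ∞ M]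
    (S : Paracontact.ParacontactMetric n M) (σ : M → ℝ)
    (hσ : ContMDiff (𝓡 (2 * n + 1)) 𝓘(ℝ, ℝ) ∞ σ) (hσ0 : ∀ x, σ x ≠ 0) :
    (∃ S' : Paracontact.ParacontactMetric n M, Paracontact.IsGauge σ S S') ∧
    ∀ S' : Paracontact.ParacontactMetric n M, Paracontact.IsGauge σ S S' →
      ∀ e ∈ IsManifold.maximalAtlas (𝓡 (2 * n + 1)) ∞ M, ∀ u ∈ e.target,
        (∀ k, S'.ξComp e k u = 1 / σ (e.symm u) * (S.ξComp e k u + S.ζComp e σ k u)) ∧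
        (∀ i j, S'.φComp e i j u = S.φComp e i j u +
          1 / (2 * σ (e.symm u)) *
            (S.gradComp e σ i u - S.ξDeriv e σ u * S.ξComp e i u) * S.ηComp e j u) ∧
        (∀ i j, S'.gComp e u i j =
          σ (e.symm u) * (S.gComp e u i j - S.ηComp e i u * S.ζLower e σ j u
            - S.ηComp e j u * S.ζLower e σ i u) +
          σ (e.symm u) * (σ (e.symm u) - 1 + S.ζNormSq e σ u)
            * (S.ηComp e i u * S.ηComp e j u)) ∧
        σ (e.symm u) * S'.W₁ e u =
          S.W₁ e u - 2 * ((n : ℝ) + 1) / σ (e.symm u) * S.laplacianD e σ u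
            - ((n : ℝ) + 1) * ((n : ℝ) - 2) / σ (e.symm u) ^ 2 * S.normSqD e σ u :=
  open Paracontact ParacontactMetric in
  ⟨⟨S.gauge hσ hσ0, ⟨fun _ => rfl, fun x v hv => by
      change S.φ x v + S.η x v • S.gaugeField σ x = S.φ x v
      rw [hv, zero_smul, add_zero]⟩⟩,
    fun _ h _ he _ hu => ⟨ξComp_gauge he hu hσ h hσ0, φComp_gauge he hu hσ h hσ0,
      gComp_gauge he hu hσ h hσ0, W₁_gauge he hσ hσ0 h hu⟩⟩
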